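/- **Network and sensors.** Let $\mathcal G=(\mathcal V,\mathcal E)$ be a finite digraph with real weighted adjacency matrix $G=[g_{ij}]$, where $g_{ij}=0$ if $(i,j)\notin\mathcal E$. Let $\mathcal K\subseteq\mathcal V$ be the set of input nodes, and let $\Pi$ be the matrix with columns $e_k$, $k\in\mathcal K$. The states evolve by $x[k+1]=Gx[k]+\Pi w[k]$, $x[0]=0$, so an edge $(i,j)$ carries the influence of $j$ on $i$; paths follow the direction of influence. A sensor set $\mathcal J\subseteq \mathcal V$, with selection matrix $C_{\mathcal J}$, provides $y_{\mathcal J}[k]=C_{\mathcal J}x[k]+v[k]$, $k=1,\dots,N$, where the $v[k]\sim\mathcal N(0,\sigma_v^2I)$ are i.i.d. and independent of the inputs, and $\sigma_v^2>0$. Under hypothesis $H_i$ ($i=1,2$; priors $\tfrac12$) the inputs $w[k]$ are i.i.d. $\mathcal N(\mu_i,\Sigma_i)$. Assume that $G$ is stable (all eigenvalues lie in $|z|<1$). **Cutset.** Let $d>1$ and $\mathcal V=\mathcal S\sqcup\mathcal C\sqcup\mathcal P$ with $\mathcal S,\mathcal P\neq\emptyset$, $\mathcal K\subseteq\mathcal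 S$, $\mathrm{dist}(\mathcal K,\mathcal C)\ge d$ (smallest number of edges of a path from $\mathcal K$ to $\mathcal C$, $\infty$ if there is none), and such that every path from $\mathcal S$ to $\mathcal P$ contains a node of $\mathcal C$. Let $G_{pp},G_{pc}$ be the blocks of $G$ with rows in $\mathcal P$ and columns in $\mathcal P$, respectively $\mathcal C$; assume that $G_{pp}$ has no eigenvalue with $|z|=1$. Let $T_s(z)=(zI-G_{pp})^{-1}G_{pc}$, and let $\overline\rho(z)$, $\underline\rho(z)$ be the square roots of the largest and the smallest eigenvalue of the $|\mathcal C|\times|\mathcal C|$ matrix $T_s(z)^*T_s(z)$ (largest and smallest singular value; $\underline\rho(z)=\min_{\|u\|=1}\|T_s(z)u\|$). For a sensor set $\mathcal J$ let $T_{\mathcal J}(z)=C_{\mathcal J}(zI-G)^{-1}\Pi$. **Mean shift.** Let $\Sigma_1=\Sigma_2=\Sigma_c\succ0$, let $G^k=0$ for some $k$, and let $\mu_1,\mu_2$ depend on $N$ in such a way that $N\|\mu_2-\mu_1\|_2^2$ converges to a finite limit as $N\to\infty$. Let $\widehat{\mathbb P}_{N}(\mathcal J)$ be the error probability of the MAP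 detector based on $y_{\mathcal J}[1],\dots,y_{\mathcal J}[N]$, and let $$\mathbb P_{e_m}(\mathcal J)=\Pr[Z\ge \tfrac12\eta],\quad Z\sim\mathcal N(0,1),\qquad \eta^2=N\tilde\mu^{\mathsf T}[L^{\mathsf T}L+\sigma_v^2I]^{-1}L^{\mathsf T}L\,\tilde\mu,$$ $L=T_{\mathcal J}(1)\Sigma_c^{1/2}$, $\tilde\mu=\Sigma_c^{-1/2}(\mu_2-\mu_1)$ (which depends on $N$). Then $\widehat{\mathbb P}_N(\mathcal J)-\mathbb P_{e_m}(\mathcal J)\to0$ as $N\to\infty$ for $\mathcal J\in\{\mathcal C,\mathcal P\}$, and: 1a) If $\overline\rho(1)\le1$, then $\mathbb P_{e_m}(\mathcal C)\le\mathbb P_{e_m}(\mathcal P)$. 1b) If $\underline\rho(1)>1$, then $\mathbb P_{e_m}(\mathcal C)\ge\mathbb P_{e_m}(\mathcal P)$, with strict inequality whenever $\mathbb P_{e_m}(\mathcal C)<\tfrac12$. Here the inequalities hold for every $N$; the same inequalities hold for the limits of $\widehat{\mathbb P}_N(\mathcal C)$ and $\widehat{\mathbb P}_N(\mathcal P)$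 as $N\to\infty$ whenever both limits exist (with strict inequality in 1b) whenever the limit for $\mathcal C$ is less than $\tfrac12$). **Covariance shift.** Let $\mu_1=\mu_2$, $\Sigma_1\succ0$, $\Sigma_2=0$. The LD-MAP detector is the MAP detector based on the scalar $b^{\mathsf T}Y_{\mathcal J}$, where $Y_{\mathcal J}$ stacks $y_{\mathcal J}[1],\dots,y_{\mathcal J}[N]$ and $b\ne0$ maximizes the information divergence $\tfrac12\mathbb E[\ln (f_1/f_2)\mid H_1]+\tfrac12\mathbb E[\ln (f_2/f_1)\mid H_2]$, $f_i$ being the density of $b^{\mathsf T}Y_{\mathcal J}$ under $H_i$. Let $$\mathbb P_{e_v}(\mathcal J)=\tfrac12\bigl(1-\Pr[U\ge\tau]\bigr)+\tfrac12\Pr[U\ge\tau R],\quad U\sim\chi^2(1),\quad \tau=\frac{\ln R}{R-1},\quad R=1+\sigma_v^{-2}\operatorname*{ess\,sup}_{|z|=1}\|T_{\mathcal J}(z)\Sigma_1^{1/2}\|_2^2,$$ with $\mathbb P_{e_v}(\mathcal J)=\tfrac12$ if $R=1$. For $\mathcal J\in\{\mathcal C,\mathcal P\}$ the error probability of the LD-MAP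 detector converges to $\mathbb P_{e_v}(\mathcal J)$ as $N\to\infty$, and: 2a) If $\sup_{|z|=1}\overline\rho(z)\le1$, then $\mathbb P_{e_v}(\mathcal C)\le\mathbb P_{e_v}(\mathcal P)$. 2b) If $\inf_{|z|=1}\underline\rho(z)>1$, then $\mathbb P_{e_v}(\mathcal C)\ge\mathbb P_{e_v}(\mathcal P)$, with strict inequality whenever $\mathbb P_{e_v}(\mathcal C)<\tfrac12$. -/

import Mathlib

open MeasureTheory ProbabilityTheory Filter Topology
open scoped NNReal ENNReal Matrix MatrixOrder

noncomputable section

namespace NetDetect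

/-! ### Networks and node cutsets -/

section Graph

variable {V : Type*}

/-- `w 0, w 1, …, w n` is a path with `n` edges. The weight `g i j` of an edge `(i, j)` is the
influence of node `j` on node `i`, and a path follows the direction of influence:
each `(w (t + 1), w t)` is an edge. -/
def IsPath (E : Digraph V) (n : ℕ) (w : ℕ → V) : Prop :=
  ∀ t < n, E.Adj (w (t + 1)) (w t)

/-- Smallest number of edges of a path from a node of `K` to a node of `J`
(`⊤` if there is no such path). -/
def setDist (E : Digraph V) (K J : Finset V) : ℕ∞ :=
  sInf {l : ℕ∞ | ∃ (n : ℕ) (w : ℕ → V), l = n ∧ IsPath E n w ∧ w 0 ∈ K ∧ w n ∈ J}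

/-- `C` is a node cutset at distance at least `d` from the input nodes `K`, with source set `S`
and partitioned set `P`. -/
structure IsNodeCutset (E : Digraph V) (K : Finset V) (d : ℕ) (S C P : Finset V) : Prop where
  one_lt : 1 < d
  source_nonempty : S.Nonempty
  part_nonempty : P.Nonempty
  cover : ∀ v, v ∈ S ∨ v ∈ C ∨ v ∈ P
  disj_SC : Disjoint S C
  disj_SP : Disjoint S P
  disj_CP : Disjoint C P
  input_subset : K ⊆ S
  le_dist : (d : ℕ∞) ≤ setDist E K C
  separates : ∀ (n : ℕ) (w : ℕ → V), IsPath E n w → w 0 ∈ S → w n ∈ P → ∃ t ≤ n, w t ∈ C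

/-- `G` is a weighted adjacency matrix of the digraph `E`. -/
def IsWeightedAdj (E : Digraph V) (G : Matrix V V ℝ) : Prop :=
  ∀ i j, ¬ E.Adj i j → G i j = 0

end Graph

/-! ### The linear network, its sensors, and the law of the measurements -/

section System

variable {V : Type*} [Fintype V] [DecidableEq V]

/-- The input matrix `Π`, with columns `e_k`, `k ∈ K`. -/
def inputMatrix (𝕜 : Type*) [Zero 𝕜] [One 𝕜] (K : Finset V) : Matrix V K 𝕜 :=
  (1 : Matrix V V 𝕜).submatrix id Subtype.val

/-- The sensor matrix, with rows `e_jᵀ`, `j ∈ J`. -/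
def sensorMatrix (𝕜 : Type*) [Zero 𝕜] [One 𝕜] (J : Finset V) : Matrix J V 𝕜 :=
  (1 : Matrix V V 𝕜).submatrix Subtype.val id

/-- The block of `G` with rows in `A` and columns in `B`, as a complex matrix. -/
def blockC (G : Matrix V V ℝ) (A B : Finset V) : Matrix A B ℂ :=
  (G.map Complex.ofReal).submatrix Subtype.val Subtype.val

/-- The states `x[k + 1] = G x[k] + Π w[k]`, with `x[0] = 0`. -/
def state (G : Matrix V V ℝ) (K : Finset V) (w : ℕ → K → ℝ) : ℕ → V → ℝ
  | 0 => 0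
  | k + 1 => G *ᵥ state G K w k + inputMatrix ℝ K *ᵥ w k

/-- The stacked measurements `y[t] = C x[t] + v[t]`, `t = 1, …, N`, as a function of the inputs
`w[0], …, w[N - 1]` and of the noises `v[1], …, v[N]`. The index `(t, j)` stands for the
measurement of node `j` at time `t + 1`. -/
def measurement (G : Matrix V V ℝ) (K J : Finset V) (N : ℕ)
    (ω : (Fin N → EuclideanSpace ℝ K) × (Fin N → EuclideanSpace ℝ J)) :
    EuclideanSpace ℝ (Fin N × J) :=
  WithLp.toLp 2 fun p =>
    (sensorMatrix ℝ J *ᵥ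
      state G K (fun k => if h : k < N then (ω.1 ⟨k, h⟩).ofLp else 0) (p.1 + 1)) p.2
      + ω.2 p.1 p.2

/-- The law of the stacked measurements when the inputs `w[k]` are i.i.d. `𝓝(μ, Σ)` and the sensor
noises `v[k]` are i.i.d. `𝓝(0, σ² I)`, independent of the inputs. -/
def measurementLaw (G : Matrix V V ℝ) (K J : Finset V) (σ : ℝ) (N : ℕ)
    (μ : EuclideanSpace ℝ K) (Sig : Matrix K K ℝ) : Measure (EuclideanSpace ℝ (Fin N × J)) :=
  ((Measure.pi fun _ : Fin N => multivariateGaussian μ Sig).prod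
    (Measure.pi fun _ : Fin N => multivariateGaussian (0 : EuclideanSpace ℝ J)
      (σ ^ 2 • (1 : Matrix J J ℝ)))).map (measurement G K J N)

end System

/-! ### MAP and LD-MAP detectors -/

section Detector

variable {Y : Type*} [MeasurableSpace Y]

/-- The posterior probability `y ↦ Pr(hypothesis | y)` of the hypothesis with prior `p` and data
law `P`, when the alternative has prior `p'` and data law `P'`. -/
def posterior (p p' : ℝ≥0) (P P' : Measure Y) : Y → ℝ≥0∞ :=
  (p • P).rnDeriv (p • P + p' • P')

/-- Error probability `∑ i, π_i Pr(Ĥ ≠ H_i | H_i)` of the MAP detector, which decides `H₂` if the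
posterior probability of `H₂` exceeds that of `H₁`, and decides `H₁` otherwise. -/
def mapError (p₁ p₂ : ℝ≥0) (P₁ P₂ : Measure Y) : ℝ :=
  p₁ * P₁.real {y | posterior p₁ p₂ P₁ P₂ y < posterior p₂ p₁ P₂ P₁ y} +
    p₂ * P₂.real {y | posterior p₂ p₁ P₂ P₁ y ≤ posterior p₁ p₂ P₁ P₂ y}

/-- The information divergence
`π₁ E[ln (f₁ / f₂) | H₁] + π₂ E[ln (f₂ / f₁) | H₂]` of two laws of a scalar statistic. -/
def infoDivergence (p₁ p₂ : ℝ≥0) (Q₁ Q₂ : Measure ℝ) : ℝ :=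
  p₁ * ∫ y, llr Q₁ Q₂ y ∂Q₁ + p₂ * ∫ y, llr Q₂ Q₁ y ∂Q₂

/-- The law of the linear statistic `bᵀ Y` when `Y` has law `P`. -/
def linLaw {ι : Type*} [Fintype ι] (b : EuclideanSpace ℝ ι) (P : Measure (EuclideanSpace ℝ ι)) :
    Measure ℝ :=
  P.map fun y => inner ℝ b y

/-- `b ≠ 0` maximizes the information divergence of the linear statistic `bᵀ Y`. -/
def IsDiscriminant {ι : Type*} [Fintype ι] (p₁ p₂ : ℝ≥0)
    (P₁ P₂ : Measure (EuclideanSpace ℝ ι)) (b : EuclideanSpace ℝ ι) : Prop :=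
  b ≠ 0 ∧ ∀ b' : EuclideanSpace ℝ ι, b' ≠ 0 →
    infoDivergence p₁ p₂ (linLaw b' P₁) (linLaw b' P₂) ≤
      infoDivergence p₁ p₂ (linLaw b P₁) (linLaw b P₂)

/-- Error probability of the LD-MAP detector, i.e. of the MAP detector based on `bᵀ Y`. -/
def ldMapError {ι : Type*} [Fintype ι] (p₁ p₂ : ℝ≥0)
    (P₁ P₂ : Measure (EuclideanSpace ℝ ι)) (b : EuclideanSpace ℝ ι) : ℝ :=
  mapError p₁ p₂ (linLaw b P₁) (linLaw b P₂)

end Detector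

/-! ### Asymptotic error probabilities -/

section Asymptotic

variable {V : Type*} [Fintype V] [DecidableEq V]

/-- `Pr[Z ≥ t]` for a standard normal variable `Z`. -/
def gaussianTail (t : ℝ) : ℝ := (gaussianReal 0 1).real (Set.Ici t)

/-- `Pr[U ≥ t]` for a chi-squared variable `U` with one degree of freedom. -/
def chiSqOneTail (t : ℝ) : ℝ := ((gaussianReal 0 1).map fun x => x ^ 2).real (Set.Ici t)

/-- The transfer matrix `T(z) = C (z I - G)⁻¹ Π` from the nodes `K` to the nodes `J`. -/
def transfer {𝕜 : Type*} [Field 𝕜] (G : Matrix V V 𝕜) (K J : Finset V) (z : 𝕜) : Matrix J K 𝕜 :=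
  sensorMatrix 𝕜 J * (z • (1 : Matrix V V 𝕜) - G)⁻¹ * inputMatrix 𝕜 K

/-- The positive square root of a positive semidefinite matrix. -/
def matrixSqrt {ι : Type*} [Fintype ι] [DecidableEq ι] (A : Matrix ι ι ℝ) : Matrix ι ι ℝ :=
  CFC.sqrt A

/-- The squared SNR `η² = N mᵀ ([Lᵀ L + σ² I]⁻¹ Lᵀ L) m` of the mean shift model, with
`L = T(1) Σ^{1/2}` and `m = Σ^{-1/2} (μ₂ - μ₁)`. -/
def etaSq (G : Matrix V V ℝ) (K J : Finset V) (σ : ℝ) (N : ℕ)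
    (μ₁ μ₂ : EuclideanSpace ℝ K) (Sig : Matrix K K ℝ) : ℝ :=
  let L : Matrix J K ℝ := transfer G K J 1 * matrixSqrt Sig
  let m : K → ℝ := (matrixSqrt Sig)⁻¹ *ᵥ (μ₂ - μ₁).ofLp
  N * (m ⬝ᵥ (((Lᵀ * L + σ ^ 2 • (1 : Matrix K K ℝ))⁻¹ * (Lᵀ * L)) *ᵥ m))

/-- Asymptotic error probability of the MAP detector for the mean shift model. -/
def asympMeanError (G : Matrix V V ℝ) (K J : Finset V) (σ : ℝ) (N : ℕ)
    (μ₁ μ₂ : EuclideanSpace ℝ K) (Sig : Matrix K K ℝ) : ℝ :=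
  gaussianTail (1 / 2 * √(etaSq G K J σ N μ₁ μ₂ Sig))

open scoped Matrix.Norms.L2Operator in
/-- The SNR `R = 1 + σ⁻² ‖T(z) Σ₁^{1/2}‖²_∞` of the covariance shift model, where `‖·‖_∞` is the
essential supremum over the unit circle of the spectral norm. -/
def snrR (G : Matrix V V ℝ) (K J : Finset V) (σ : ℝ) (Sig₁ : Matrix K K ℝ) : ℝ :=
  1 + (σ ^ 2)⁻¹ *
    (essSup (fun θ : ℝ => ‖transfer (G.map Complex.ofReal) K J (Complex.exp (θ * Complex.I)) *
      (matrixSqrt Sig₁).map Complex.ofReal‖) (volume.restrict (Set.Ioc 0 (2 * Real.pi)))) ^ 2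

/-- Asymptotic error probability of the LD-MAP detector for the covariance shift model with
`Σ₂ = 0`, in terms of `R` and of the threshold `τ = ln R / (R - 1)`
(for `R = 1` the value is `1 / 2`, whatever `τ` is). -/
def asympCovError (G : Matrix V V ℝ) (K J : Finset V) (σ : ℝ) (Sig₁ : Matrix K K ℝ) : ℝ :=
  let R := snrR G K J σ Sig₁
  let τ := Real.log R / (R - 1)
  1 / 2 * (1 - chiSqOneTail τ) + 1 / 2 * chiSqOneTail (τ * R)

/-- The transfer matrix `T_s(z) = (z I - G_pp)⁻¹ G_pc` from the cutset to the partitioned set. -/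
def cutTransfer (G : Matrix V V ℝ) (C P : Finset V) (z : ℂ) : Matrix P C ℂ :=
  (z • (1 : Matrix P P ℂ) - blockC G P P)⁻¹ * blockC G P C

/-- Largest singular value of `T_s(z)`. -/
def rhoMax (G : Matrix V V ℝ) (C P : Finset V) (z : ℂ) : ℝ :=
  (Matrix.toEuclideanLin (cutTransfer G C P z)).singularValues 0

/-- Smallest singular value of `T_s(z)`: the square root of the smallest eigenvalue of
`T_s(z)ᴴ T_s(z)`, i.e. the last of its `card C` singular values. -/
def rhoMin (G : Matrix V V ℝ) (C P : Finset V) (z : ℂ) : ℝ :=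
  (Matrix.toEuclideanLin (cutTransfer G C P z)).singularValues (C.card - 1)

end Asymptotic

end NetDetect

end

/-! No edge leads from the source set to the partitioned set and no input enters the latter, so the
rows of `(zI - G) X = Π` indexed by `P` read `(zI - G_pp) X_P = G_pc X_C`. Hence `T_P(z) = T_s(z)
T_C(z)` (`transfer_eq_cutTransfer_mul`), and the extreme singular values of `T_s` compare the gains
of the two sensor sets. What remains is to express both error probabilities through these gains and
to see that they are monotone in them.

Mean shift. With `A` the block Toeplitz matrix of the whitened impulse response, the measurements
are Gaussian with covariance `AAᵀ + σ²`, and their means differ by `Ax`, where `x` repeats `m =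
Σ^{-1/2}(μ₂ - μ₁)`. The MAP error is `gaussianTail (δ/2)` with `δ² = (Ax)ᵀ(AAᵀ + σ²)⁻¹Ax`
(`mapError_gaussian_shift`). Since `G` is nilpotent, `A` acts on constant sequences as `L` outside a
bounded number of blocks, so `|δ² - η²| = O(√N ‖m‖²)` (`exists_mahalanobis_bound`), and this tends
to 0 because `N‖m‖²` is bounded. Moreover, `s mᵀ(LᵀL + s)⁻¹LᵀL m` is the minimum over `g` of `‖Lg‖²
+ s‖m - g‖²`, hence monotone in the form `‖Lg‖²`. For the limits, a cluster point of `√N(μ₂ - μ₁)`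
realizes both of them at once, so strict inequalities survive.

Covariance shift. Under the two hypotheses `bᵀY` is Gaussian with equal means and variance ratio
`R_b = 1 + σ⁻²‖Aᵀb‖²/‖b‖²`. The divergence is an increasing function of `R_b` on `[1, ∞)`, so the
discriminant maximizes a Rayleigh quotient. Its maximum tends to the squared supremum of the
Toeplitz symbol (`tendsto_rayleigh_toep`): roots of unity give the upper bound, harmonic sequences
the lower one. The scalar MAP error decreases strictly in `R` (`varianceTestError_strictAntiOn`). -/

noncomputable section

namespace NetDetect

/-! ### Optimality of the MAP rule -/

section Bayes

variable {Y : Type*} [MeasurableSpace Y]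

/-- The likelihood comparison integrates `min f₁ f₂` over the whole space; any other decision region
integrates, at each point, one of the two densities, hence at least the minimum. -/
theorem withDensity_bayes_le (ν : Measure Y) {f₁ f₂ : Y → ℝ≥0∞} (h₁ : Measurable f₁)
    (h₂ : Measurable f₂) {B : Set Y} (hB : MeasurableSet B) :
    ν.withDensity f₁ {y | f₁ y < f₂ y} + ν.withDensity f₂ {y | f₂ y ≤ f₁ y} ≤
      ν.withDensity f₁ B + ν.withDensity f₂ Bᶜ := by
  have hA : MeasurableSet {y | f₁ y < f₂ y} := measurableSet_lt h₁ h₂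
  have hAc : {y | f₁ y < f₂ y}ᶜ = {y | f₂ y ≤ f₁ y} := by ext; simp
  rw [← hAc, withDensity_apply _ hA, withDensity_apply _ hA.compl, withDensity_apply _ hB,
    withDensity_apply _ hB.compl]
  calc _ = ∫⁻ y in {y | f₁ y < f₂ y}, min (f₁ y) (f₂ y) ∂ν +
        ∫⁻ y in {y | f₁ y < f₂ y}ᶜ, min (f₁ y) (f₂ y) ∂ν := by
        congr 1
        · exact setLIntegral_congr_fun hA fun y hy => (min_eq_left (le_of_lt hy)).symm
        · exact setLIntegral_congr_fun hA.compl fun y hy => (min_eq_right (by simpa using hy)).symm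
    _ = ∫⁻ y in B, min (f₁ y) (f₂ y) ∂ν + ∫⁻ y in Bᶜ, min (f₁ y) (f₂ y) ∂ν := by
        rw [lintegral_add_compl _ hA, lintegral_add_compl _ hB]
    _ ≤ _ := add_le_add (lintegral_mono fun y => min_le_left _ _)
        (lintegral_mono fun y => min_le_right _ _)

/-- The MAP detector minimizes the error probability. -/
theorem mapError_le (P₁ P₂ : Measure Y) [IsProbabilityMeasure P₁] [IsProbabilityMeasure P₂]
    {B : Set Y} (hB : MeasurableSet B) :
    mapError (1 / 2) (1 / 2) P₁ P₂ ≤ 1 / 2 * P₁.real B + 1 / 2 * P₂.real Bᶜ := by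
  set p : ℝ≥0 := 1 / 2
  set M : Measure Y := p • P₁ + p • P₂ with hM
  have hM' : p • P₂ + p • P₁ = M := add_comm _ _
  have e₁ : M.withDensity (posterior p p P₁ P₂) = p • P₁ :=
    Measure.withDensity_rnDeriv_eq _ _ (Measure.le_add_right le_rfl).absolutelyContinuous
  have e₂ : M.withDensity (posterior p p P₂ P₁) = p • P₂ := by
    rw [posterior, hM']
    exact Measure.withDensity_rnDeriv_eq _ _ (Measure.le_add_left le_rfl).absolutelyContinuous
  have := withDensity_bayes_le M (f₁ := posterior p p P₁ P₂) (f₂ := posterior p p P₂ P₁)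
    (Measure.measurable_rnDeriv _ _) (Measure.measurable_rnDeriv _ _) hB
  rw [e₁, e₂] at this
  have h2 := ENNReal.toReal_mono (by finiteness) this
  rw [ENNReal.toReal_add (by finiteness) (by finiteness),
    ENNReal.toReal_add (by finiteness) (by finiteness)] at h2
  simpa [mapError, Measure.real, p] using h2

/-- The likelihood rule and the rule defined by posteriors are both optimal among decision regions,
so their errors agree. The posteriors themselves need not be computed. -/
theorem mapError_eq_of_density (ν : Measure Y) {f₁ f₂ : Y → ℝ≥0∞} (h₁ : Measurable f₁)
    (h₂ : Measurable f₂) (P₁ P₂ : Measure Y) [IsProbabilityMeasure P₁] [IsProbabilityMeasure P₂]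
    (e₁ : P₁ = ν.withDensity f₁) (e₂ : P₂ = ν.withDensity f₂) :
    mapError (1 / 2) (1 / 2) P₁ P₂ =
      1 / 2 * P₁.real {y | f₁ y < f₂ y} + 1 / 2 * P₂.real {y | f₂ y ≤ f₁ y} := by
  apply le_antisymm
  · have hAc : {y | f₁ y < f₂ y}ᶜ = {y | f₂ y ≤ f₁ y} := by ext; simp
    rw [← hAc]
    exact mapError_le P₁ P₂ (measurableSet_lt h₁ h₂)
  · have hB : MeasurableSet {y | posterior (1 / 2) (1 / 2) P₁ P₂ y <
        posterior (1 / 2) (1 / 2) P₂ P₁ y} :=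
      measurableSet_lt (Measure.measurable_rnDeriv _ _) (Measure.measurable_rnDeriv _ _)
    have hBc : {y | posterior (1 / 2) (1 / 2) P₁ P₂ y < posterior (1 / 2) (1 / 2) P₂ P₁ y}ᶜ =
        {y | posterior (1 / 2) (1 / 2) P₂ P₁ y ≤ posterior (1 / 2) (1 / 2) P₁ P₂ y} := by
      ext; simp
    have := withDensity_bayes_le ν h₁ h₂ hB
    rw [← e₁, ← e₂, hBc] at this
    have h2 := ENNReal.toReal_mono (by finiteness) this
    rw [ENNReal.toReal_add (by finiteness) (by finiteness),
      ENNReal.toReal_add (by finiteness) (by finiteness)] at h2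
    simp only [mapError, Measure.real, NNReal.coe_div, NNReal.coe_one, NNReal.coe_ofNat]
    linarith

theorem mapError_self (P : Measure Y) [IsProbabilityMeasure P] :
    mapError (1 / 2) (1 / 2) P P = 1 / 2 := by
  simp [mapError]

end Bayes

/-! ### Tails of the normal and chi-squared laws -/

section GaussianTail

theorem gaussianPDFReal_std_le_one (x : ℝ) : gaussianPDFReal 0 1 x ≤ 1 := by
  have hpi : 1 ≤ √(2 * Real.pi * (1 : ℝ≥0)) := by
    rw [Real.one_le_sqrt]
    norm_num
    linarith [Real.pi_gt_three]
  rw [gaussianPDFReal]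
  refine mul_le_one₀ (inv_le_one_of_one_le₀ hpi) (Real.exp_nonneg _) (Real.exp_le_one_iff.2 ?_)
  rw [neg_div]
  exact neg_nonpos.2 (by positivity)

theorem gaussianTail_sub_eq {s t : ℝ} (h : s ≤ t) :
    gaussianTail s - gaussianTail t = (gaussianReal 0 1).real (Set.Ico s t) := by
  have : Set.Ici s = Set.Ico s t ∪ Set.Ici t := (Set.Ico_union_Ici_eq_Ici h).symm
  rw [gaussianTail, gaussianTail, this,
    measureReal_union (Set.disjoint_left.2 fun x hx hx' => not_lt.2 (Set.mem_Ici.1 hx') (Set.mem_Ico.1 hx).2) measurableSet_Ici]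
  ring

theorem gaussianTail_sub_le {s t : ℝ} (h : s ≤ t) : gaussianTail s - gaussianTail t ≤ t - s := by
  rw [gaussianTail_sub_eq h, Measure.real, gaussianReal_apply_eq_integral _ one_ne_zero,
    ENNReal.toReal_ofReal (setIntegral_nonneg measurableSet_Ico
      fun x _ => gaussianPDFReal_nonneg _ _ _)]
  calc _ ≤ ∫ x in Set.Ico s t, (1 : ℝ) :=
        setIntegral_mono (integrable_gaussianPDFReal _ _).integrableOn
          (integrableOn_const (by simp)) gaussianPDFReal_std_le_one
    _ = t - s := by simp [h]

theorem gaussianTail_strictAnti : StrictAnti gaussianTail := by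
  intro s t h
  have h1 := gaussianTail_sub_eq h.le
  have h2 : 0 < gaussianReal 0 1 (Set.Ico s t) := by
    refine (pos_iff_ne_zero.2 fun h0 => ?_)
    have := gaussianReal_absolutelyContinuous' 0 one_ne_zero h0
    simp only [Real.volume_Ico, ENNReal.ofReal_eq_zero] at this
    linarith
  have h3 : 0 < (gaussianReal 0 1).real (Set.Ico s t) :=
    ENNReal.toReal_pos h2.ne' (by finiteness)
  linarith

/-- The density is at most 1, so the tail is 1-Lipschitz. A bound uniform in the argument is what
turns a vanishing SNR difference into a vanishing error difference. -/
theorem abs_gaussianTail_sub_le (s t : ℝ) : |gaussianTail s - gaussianTail t| ≤ |s - t| := by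
  rcases le_total s t with h | h
  · rw [abs_of_nonneg (sub_nonneg.2 (gaussianTail_strictAnti.antitone h)), abs_of_nonpos (by linarith)]
    linarith [gaussianTail_sub_le h]
  · rw [abs_of_nonpos (sub_nonpos.2 (gaussianTail_strictAnti.antitone h)), abs_of_nonneg (by linarith)]
    linarith [gaussianTail_sub_le h]

theorem continuous_gaussianTail : Continuous gaussianTail :=
  (LipschitzWith.of_dist_le_mul (K := 1) fun s t => by
    simpa [Real.dist_eq] using abs_gaussianTail_sub_le s t).continuous

theorem gaussianReal_Iic_neg (t : ℝ) : (gaussianReal 0 1).real (Set.Iic (-t)) = gaussianTail t := by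
  have h := gaussianReal_map_neg (μ := 0) (v := 1)
  rw [neg_zero] at h
  rw [gaussianTail]
  conv_lhs => rw [← h]
  rw [map_measureReal_apply measurable_neg measurableSet_Iic]
  congr 1
  ext x
  simp

theorem gaussianTail_neg (t : ℝ) : gaussianTail (-t) = 1 - gaussianTail t := by
  have : NullSingletonClass (gaussianReal 0 1) := nullSingletonClass_gaussianReal one_ne_zero
  have h := probReal_compl_eq_one_sub (μ := gaussianReal 0 1) (s := Set.Iic (-t)) measurableSet_Iic
  rw [gaussianReal_Iic_neg, Set.compl_Iic] at h
  rw [← h, gaussianTail, measureReal_congr Ioi_ae_eq_Ici]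

theorem gaussianTail_zero : gaussianTail 0 = 1 / 2 := by
  have := gaussianTail_neg 0
  rw [neg_zero] at this
  linarith

/-- For negative `t` the convention `√t = 0` makes both sides equal to 1. -/
theorem chiSqOneTail_eq (t : ℝ) : chiSqOneTail t = 2 * gaussianTail (√t) := by
  have : NullSingletonClass (gaussianReal 0 1) := nullSingletonClass_gaussianReal one_ne_zero
  rw [chiSqOneTail, map_measureReal_apply (by fun_prop) measurableSet_Ici]
  have : (fun x : ℝ => x ^ 2) ⁻¹' Set.Ici t = Set.Iic (-√t) ∪ Set.Ici (√t) := by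
    ext x
    simp only [Set.mem_preimage, Set.mem_Ici, Set.mem_union, Set.mem_Iic]
    rw [← Real.sqrt_le_sqrt_iff (sq_nonneg x), Real.sqrt_sq_eq_abs, le_abs, or_comm, le_neg]
  rw [this]
  -- The half-lines meet at 0 when `√t = 0`, so they are disjoint only up to a null set.
  have hd : AEDisjoint (gaussianReal 0 1) (Set.Iic (-√t)) (Set.Ici (√t)) := by
    refine measure_mono_null (t := {0}) ?_ (by simp)
    rintro x ⟨h1, h2⟩
    have := Real.sqrt_nonneg t
    simp only [Set.mem_Iic, Set.mem_Ici] at h1 h2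
    exact le_antisymm (by linarith) (by linarith)
  rw [measureReal_union₀ measurableSet_Ici.nullMeasurableSet hd, gaussianReal_Iic_neg, gaussianTail]
  ring

theorem gaussianReal_eq_map_std (m : ℝ) (v : ℝ≥0) :
    gaussianReal m v = (gaussianReal 0 1).map fun x => m + √v * x := by
  have h : (fun x : ℝ => m + √v * x) = (fun x => m + x) ∘ fun x => √v * x := rfl
  rw [h, ← Measure.map_map (by fun_prop) (by fun_prop), gaussianReal_map_const_mul,
    gaussianReal_map_const_add]
  congr 1
  · simp
  · ext; simp

theorem gaussianReal_Ici {v : ℝ≥0} (hv : v ≠ 0) (m t : ℝ) :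
    (gaussianReal m v).real {x | m + t * √v ≤ x} = gaussianTail t := by
  rw [gaussianReal_eq_map_std, map_measureReal_apply (by fun_prop) (measurableSet_le (by fun_prop) (by fun_prop)), gaussianTail]
  have : 0 < √(v : ℝ) := by positivity
  congr 1
  ext x
  simp [mul_comm t, this]

theorem gaussianReal_sq_ge {v : ℝ≥0} (hv : v ≠ 0) (m t : ℝ) :
    (gaussianReal m v).real {x | t * v ≤ (x - m) ^ 2} = chiSqOneTail t := by
  rw [gaussianReal_eq_map_std, map_measureReal_apply (by fun_prop)
    (measurableSet_le (by fun_prop) (by fun_prop)), chiSqOneTail,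
    map_measureReal_apply (by fun_prop) measurableSet_Ici]
  have : 0 < (v : ℝ) := by positivity
  congr 1
  ext x
  simp [mul_pow, mul_comm t, this]

theorem gaussianReal_sq_lt {v : ℝ≥0} (hv : v ≠ 0) (m t : ℝ) :
    (gaussianReal m v).real {x | (x - m) ^ 2 < t * v} = 1 - chiSqOneTail t := by
  rw [← gaussianReal_sq_ge hv m t, ← probReal_compl_eq_one_sub
    (measurableSet_le (by fun_prop) (by fun_prop))]
  congr 1
  ext; simp

end GaussianTail

/-! ### Testing the variance of a scalar Gaussian -/

section ScalarVarianceTest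

/-- Error probability of the MAP detector of two centred scalar Gaussian laws whose variances have
the ratio `R`. -/
def varianceTestError (R : ℝ) : ℝ :=
  1 / 2 * (1 - chiSqOneTail (Real.log R / (R - 1))) + 1 / 2 * chiSqOneTail (Real.log R / (R - 1) * R)

theorem varianceTestError_one : varianceTestError 1 = 1 / 2 := by
  simp only [varianceTestError, Real.log_one, zero_div, zero_mul]
  ring

theorem gaussianPDF_lt_iff {v₁ v₂ : ℝ≥0} (hv : v₂ ≠ 0) {R : ℝ} (hR : 1 < R)
    (h : (v₁ : ℝ) = R * v₂) (m x : ℝ) :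
    gaussianPDF m v₁ x < gaussianPDF m v₂ x ↔ (x - m) ^ 2 < Real.log R / (R - 1) * v₁ := by
  have hv2 : 0 < (v₂ : ℝ) := by positivity
  have hR0 : 0 < R := by linarith
  have hv1 : 0 < (v₁ : ℝ) := by rw [h]; positivity
  have p2 := gaussianPDFReal_pos m v₂ x hv
  have p1 := gaussianPDFReal_pos m v₁ x (by exact_mod_cast hv1.ne')
  rw [gaussianPDF, gaussianPDF, ENNReal.ofReal_lt_ofReal_iff p2, ← Real.log_lt_log_iff p1 p2]
  simp only [gaussianPDFReal]
  rw [Real.log_mul (by positivity) (by positivity), Real.log_mul (by positivity) (by positivity),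
    Real.log_exp, Real.log_exp, Real.log_inv, Real.log_inv, Real.log_sqrt (by positivity),
    Real.log_sqrt (by positivity), h, ← mul_assoc, mul_comm _ R, mul_assoc,
    Real.log_mul hR0.ne' (by positivity)]
  -- The distance of `(x - m)²` from the threshold is a positive multiple of the log-likelihood
  -- ratio of `v₂` against `v₁`.
  have e : Real.log R / (R - 1) * (R * v₂) - (x - m) ^ 2 = (2 * R * v₂ / (R - 1)) *
      ((-(x - m) ^ 2 / (2 * v₂)) - (-(x - m) ^ 2 / (2 * (R * v₂))) + Real.log R / 2) := by
    have : R - 1 ≠ 0 := by linarith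
    field_simp
    ring
  rw [← sub_pos (b := (x - m) ^ 2), e, mul_pos_iff_of_pos_left
    (div_pos (by positivity) (by linarith))]
  constructor <;> intro h <;> linarith

theorem mapError_gaussian_variance {v₁ v₂ : ℝ≥0} (hv : v₂ ≠ 0) {R : ℝ} (hR : 1 ≤ R)
    (h : (v₁ : ℝ) = R * v₂) (m : ℝ) :
    mapError (1 / 2) (1 / 2) (gaussianReal m v₁) (gaussianReal m v₂) = varianceTestError R := by
  rcases hR.eq_or_lt with rfl | hR
  · have : v₁ = v₂ := by ext; simpa using h
    rw [this, mapError_self, varianceTestError_one]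
  have hv2 : 0 < (v₂ : ℝ) := by positivity
  have hv1 : v₁ ≠ 0 := by
    have : (v₁ : ℝ) ≠ 0 := by rw [h]; positivity
    exact_mod_cast this
  rw [mapError_eq_of_density volume (measurable_gaussianPDF m v₁) (measurable_gaussianPDF m v₂) _ _
    (gaussianReal_of_var_ne_zero m hv1) (gaussianReal_of_var_ne_zero m hv)]
  have e2 : {x | gaussianPDF m v₂ x ≤ gaussianPDF m v₁ x} =
      {x | Real.log R / (R - 1) * R * v₂ ≤ (x - m) ^ 2} := by
    ext x
    simp only [Set.mem_ofPred_eq]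
    rw [← not_lt, gaussianPDF_lt_iff hv hR h, not_lt, h, mul_assoc]
  simp_rw [gaussianPDF_lt_iff hv hR h]
  rw [e2, gaussianReal_sq_lt hv1, gaussianReal_sq_ge hv, varianceTestError]

/-- Normalizing the smaller variance to 1, the right-hand side is the error of the rule that decides
`H₂` when `x² < c`; the MAP rule does no worse. -/
theorem varianceTestError_le {R : ℝ} (hR : 1 ≤ R) (c : ℝ) :
    varianceTestError R ≤ 1 / 2 * (1 - chiSqOneTail (c / R)) + 1 / 2 * chiSqOneTail c := by
  have hR0 : 0 < R := by linarith
  have hR' : R.toNNReal ≠ 0 := by simpa using hR0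
  rw [← mapError_gaussian_variance (v₁ := R.toNNReal) (v₂ := 1) one_ne_zero hR (by simp [hR0.le]) 0]
  have := mapError_le (gaussianReal 0 R.toNNReal) (gaussianReal 0 1)
    (B := {x | (x - 0) ^ 2 < (c / R) * R.toNNReal}) (measurableSet_lt (by fun_prop) (by fun_prop))
  rw [gaussianReal_sq_lt hR'] at this
  convert this using 3
  rw [← gaussianReal_sq_ge one_ne_zero 0 c]
  congr 1
  ext x
  simp [hR0.le, hR0.ne']

theorem chiSqOneTail_strictAntiOn : StrictAntiOn chiSqOneTail (Set.Ici 0) := by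
  intro s hs t _ h
  rw [chiSqOneTail_eq, chiSqOneTail_eq]
  have := gaussianTail_strictAnti (Real.sqrt_lt_sqrt hs h)
  linarith

/-- Freeze the threshold that is optimal for `R`. Passing to `R' > R` only spreads the law under
`H₁`, so the error of the frozen rule drops strictly, and the optimal rule for `R'` does no worse
than it. -/
theorem varianceTestError_strictAntiOn : StrictAntiOn varianceTestError (Set.Ici 1) := by
  intro R hR R' hR' h
  simp only [Set.mem_Ici] at hR hR'
  obtain ⟨c, hc, he⟩ : ∃ c, 0 < c ∧ varianceTestError R =
      1 / 2 * (1 - chiSqOneTail (c / R)) + 1 / 2 * chiSqOneTail c := by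
    rcases hR.eq_or_lt with rfl | hR
    -- At `R = 1` every threshold has error 1/2. The formula's own value `c = 0` would give no
    -- strict decrease, so `c = 1` is taken.
    · exact ⟨1, one_pos, by rw [varianceTestError_one, div_one]; ring⟩
    · have h0 : 0 < Real.log R := Real.log_pos hR
      refine ⟨Real.log R / (R - 1) * R, mul_pos (div_pos h0 (by linarith)) (by linarith), ?_⟩
      rw [mul_div_cancel_right₀ _ (by linarith), varianceTestError]
  rw [he]
  have h1 := varianceTestError_le hR' c
  have h2 : chiSqOneTail (c / R) < chiSqOneTail (c / R') :=
    chiSqOneTail_strictAntiOn (Set.mem_Ici.2 (by positivity)) (Set.mem_Ici.2 (by positivity))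
      (div_lt_div_of_pos_left hc (by linarith) h)
  linarith

theorem continuous_chiSqOneTail : Continuous chiSqOneTail := by
  rw [funext chiSqOneTail_eq]
  exact continuous_const.mul (continuous_gaussianTail.comp Real.continuous_sqrt)

theorem continuousAt_varianceTestError {R : ℝ} (hR : 1 < R) :
    ContinuousAt varianceTestError R := by
  have c1 : ContinuousAt (fun R : ℝ => Real.log R / (R - 1)) R :=
    (Real.continuousAt_log (by linarith)).div (by fun_prop) (by linarith)
  have c2 := continuous_chiSqOneTail.continuousAt.comp c1
  have c3 := continuous_chiSqOneTail.continuousAt.comp (c1.mul continuousAt_id)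
  exact (continuousAt_const.mul (continuousAt_const.sub c2)).add (continuousAt_const.mul c3)

/-- At `R = 1` the threshold `log R / (R - 1)` has the default value 0 rather than its limit 1. The
bounds `1 ≤ r n ≤ R` avoid continuity there: they force `r n = 1`. -/
theorem varianceTestError_tendsto {r : ℕ → ℝ} {R : ℝ} (hr : ∀ᶠ n in atTop, 1 ≤ r n ∧ r n ≤ R)
    (h : Tendsto r atTop (𝓝 R)) :
    Tendsto (fun n => varianceTestError (r n)) atTop (𝓝 (varianceTestError R)) := by
  have hR : 1 ≤ R := ge_of_tendsto h (hr.mono fun n hn => hn.1)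
  rcases hR.eq_or_lt with rfl | hR
  · refine tendsto_const_nhds.congr' ?_
    filter_upwards [hr] with n hn
    rw [le_antisymm hn.2 hn.1]
  · exact (continuousAt_varianceTestError hR).tendsto.comp h

end ScalarVarianceTest

/-! ### Information divergence of scalar Gaussians -/

section Divergence

theorem llr_gaussianReal {v₁ v₂ : ℝ≥0} (h₁ : v₁ ≠ 0) (h₂ : v₂ ≠ 0) (m : ℝ) :
    llr (gaussianReal m v₁) (gaussianReal m v₂) =ᵐ[gaussianReal m v₁] fun x =>
      (Real.log v₂ - Real.log v₁) / 2 + (x - m) ^ 2 * ((2 * (v₂ : ℝ))⁻¹ - (2 * (v₁ : ℝ))⁻¹) := by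
  have a₁ := gaussianReal_absolutelyContinuous m h₁
  have a₂ := gaussianReal_absolutelyContinuous m h₂
  have b₂ := gaussianReal_absolutelyContinuous' m h₂
  have p₁ : 0 < (v₁ : ℝ) := by positivity
  have p₂ : 0 < (v₂ : ℝ) := by positivity
  filter_upwards [a₁.trans b₂ (Measure.rnDeriv_eq_div a₁ a₂), a₁ (rnDeriv_gaussianReal m v₁),
    a₁ (rnDeriv_gaussianReal m v₂)] with x hx h1 h2
  rw [llr, hx, h1, h2, ENNReal.toReal_div, gaussianPDF, gaussianPDF,
    ENNReal.toReal_ofReal (gaussianPDFReal_nonneg _ _ _),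
    ENNReal.toReal_ofReal (gaussianPDFReal_nonneg _ _ _),
    Real.log_div (gaussianPDFReal_pos m v₁ x h₁).ne' (gaussianPDFReal_pos m v₂ x h₂).ne']
  simp only [gaussianPDFReal]
  rw [Real.log_mul (by positivity) (by positivity), Real.log_mul (by positivity) (by positivity),
    Real.log_exp, Real.log_exp, Real.log_inv, Real.log_inv, Real.log_sqrt (by positivity),
    Real.log_sqrt (by positivity), Real.log_mul (by positivity) p₁.ne',
    Real.log_mul (by positivity) p₂.ne']
  field_simp
  ring

theorem integral_sq_gaussianReal (m : ℝ) (v : ℝ≥0) : ∫ x, (x - m) ^ 2 ∂gaussianReal m v = v := by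
  have := variance_fun_id_gaussianReal (μ := m) (v := v)
  rwa [variance_eq_integral measurable_id'.aemeasurable, integral_id_gaussianReal] at this

theorem integral_llr_gaussianReal {v₁ v₂ : ℝ≥0} (h₁ : v₁ ≠ 0) (h₂ : v₂ ≠ 0) (m : ℝ) :
    ∫ x, llr (gaussianReal m v₁) (gaussianReal m v₂) x ∂gaussianReal m v₁ =
      (Real.log v₂ - Real.log v₁) / 2 + v₁ * ((2 * (v₂ : ℝ))⁻¹ - (2 * (v₁ : ℝ))⁻¹) := by
  rw [integral_congr_ae (llr_gaussianReal h₁ h₂ m)]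
  have hi : Integrable (fun x : ℝ => (x - m) ^ 2) (gaussianReal m v₁) :=
    ((memLp_id_gaussianReal' 2 (by simp)).sub (memLp_const m)).integrable_sq
  rw [integral_add (integrable_const _) (hi.mul_const _), integral_mul_const,
    integral_sq_gaussianReal]
  simp

theorem infoDivergence_gaussianReal {v₁ v₂ : ℝ≥0} (h₁ : v₁ ≠ 0) (h₂ : v₂ ≠ 0) (m : ℝ) :
    infoDivergence (1 / 2) (1 / 2) (gaussianReal m v₁) (gaussianReal m v₂) =
      ((v₁ / v₂ : ℝ) + (v₁ / v₂ : ℝ)⁻¹ - 2) / 4 := by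
  have p₁ : 0 < (v₁ : ℝ) := by positivity
  have p₂ : 0 < (v₂ : ℝ) := by positivity
  rw [infoDivergence, integral_llr_gaussianReal h₁ h₂, integral_llr_gaussianReal h₂ h₁]
  simp only [NNReal.coe_div, NNReal.coe_one, NNReal.coe_ofNat]
  field_simp
  ring

/-- The divergence depends on the variance ratio through `x + x⁻¹`, which increases strictly on `[1,
∞)`; maximizing one therefore maximizes the other. -/
theorem le_of_add_inv_le {x y : ℝ} (hx : 1 ≤ x) (hy : 1 ≤ y) (h : x + x⁻¹ ≤ y + y⁻¹) : x ≤ y := by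
  by_contra! hlt
  have hx0 : 0 < x := by linarith
  have hy0 : 0 < y := by linarith
  have e : x + x⁻¹ - (y + y⁻¹) = (x - y) * (x * y - 1) / (x * y) := by field_simp; ring
  have : 0 < (x - y) * (x * y - 1) / (x * y) := by
    refine div_pos (mul_pos (by linarith) ?_) (by positivity)
    nlinarith
  linarith

end Divergence

/-! ### MAP error for two Gaussian laws with a common covariance -/

section GaussianShift

theorem eq_gaussianReal_of_mgf {Q : Measure ℝ} [IsFiniteMeasure Q] {m : ℝ} {v : ℝ≥0}
    (h : ∀ t, mgf id Q t = Real.exp (m * t + v * t ^ 2 / 2)) : Q = gaussianReal m v := by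
  have h' : mgf id (gaussianReal m v) = mgf id Q := by
    ext t
    rw [h, mgf_id_gaussianReal]
  refine (Measure.ext_of_complexMGF_id_eq ?_).symm
  ext z
  exact eqOn_complexMGF_of_mgf h' (by simp)

variable {ι : Type*} [Fintype ι]

/-- Cramér–Wold: the characteristic function at `t` is that of the projection along `t`, taken at 1.
-/
theorem eq_of_linLaw_eq {P Q : Measure (EuclideanSpace ℝ ι)} [IsFiniteMeasure P]
    [IsFiniteMeasure Q] (h : ∀ t, linLaw t P = linLaw t Q) : P = Q := by
  have key : ∀ (P : Measure (EuclideanSpace ℝ ι)) t, charFun P t = charFun (linLaw t P) 1 := by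
    intro P t
    rw [charFun_apply_real, linLaw, integral_map (by fun_prop) (by fun_prop), charFun_apply]
    simp [real_inner_comm]
  refine Measure.ext_of_charFun ?_
  ext t
  rw [key, key, h]

/-- MAP error probability for two Gaussian laws with equal covariances, in terms of the solution
`w` of `Cov w = a₂ - a₁`. -/
theorem mapError_gaussian_shift (P₁ P₂ : Measure (EuclideanSpace ℝ ι)) [IsProbabilityMeasure P₁]
    [IsProbabilityMeasure P₂] (a₁ a₂ w : EuclideanSpace ℝ ι) (v : EuclideanSpace ℝ ι → ℝ≥0)
    (h₁ : ∀ t, linLaw t P₁ = gaussianReal (inner ℝ t a₁) (v t))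
    (h₂ : ∀ t, linLaw t P₂ = gaussianReal (inner ℝ t a₂) (v t))
    (hw : ∀ t, (v (t + w) : ℝ) = v t + v w + 2 * inner ℝ t (a₂ - a₁))
    (hww : inner ℝ w (a₂ - a₁) = v w) :
    mapError (1 / 2) (1 / 2) P₁ P₂ = gaussianTail (1 / 2 * √(v w)) := by
  -- The Cameron–Martin log-density. Hypothesis `hw` is the polarized form of `Cov w = a₂ - a₁`, so
  -- `P₂` is the exponential tilt of `P₁` along `w`. No inverse covariance enters.
  set f : EuclideanSpace ℝ ι → ℝ := fun y => inner ℝ w y - inner ℝ w a₁ - v w / 2 with hf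
  have hfm : Measurable f := by fun_prop
  have hint : ∀ t, ∫ y, Real.exp (inner ℝ t y) ∂P₁ = Real.exp (inner ℝ t a₁ + v t / 2) := by
    intro t
    have := mgf_gaussianReal (X := id) (p := linLaw t P₁) (by simpa using h₁ t) 1
    rw [mgf, linLaw, integral_map (by fun_prop) (by fun_prop)] at this
    simpa using this
  have hP₂ : P₂ = P₁.withDensity fun y => ENNReal.ofReal (Real.exp (f y)) := by
    have hexp : ∀ t : EuclideanSpace ℝ ι, ∫ y, Real.exp (f y) * Real.exp (inner ℝ t y) ∂P₁ =
        Real.exp (inner ℝ t a₂ + v t / 2) := by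
      intro t
      have : ∀ y, Real.exp (f y) * Real.exp (inner ℝ t y) =
          Real.exp (- inner ℝ w a₁ - v w / 2) * Real.exp (inner ℝ (t + w) y) := by
        intro y
        rw [← Real.exp_add, ← Real.exp_add, inner_add_left, hf]
        ring_nf
      simp_rw [this]
      rw [integral_const_mul, hint, ← Real.exp_add, hw, inner_add_left, inner_sub_right]
      ring_nf
    have hfin : IsFiniteMeasure (P₁.withDensity fun y => ENNReal.ofReal (Real.exp (f y))) := by
      refine isFiniteMeasure_withDensity_ofReal ?_
      refine Integrable.hasFiniteIntegral ?_
      -- A nonintegrable function has Bochner integral 0, whereas `hexp 0` gives a positive value.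
      by_contra hni
      have := hexp 0
      simp only [inner_zero_left, Real.exp_zero, mul_one] at this
      rw [integral_undef hni] at this
      exact (Real.exp_pos _).ne this
    refine eq_of_linLaw_eq fun t => ?_
    have : IsFiniteMeasure (linLaw t (P₁.withDensity fun y => ENNReal.ofReal (Real.exp (f y)))) := by
      rw [linLaw]
      infer_instance
    rw [h₂]
    refine (eq_gaussianReal_of_mgf fun u => ?_).symm
    rw [mgf, linLaw, integral_map (by fun_prop) (by fun_prop),
      integral_withDensity_eq_integral_toReal_smul (by fun_prop) (by simp)]
    -- That `v` is homogeneous of degree 2 is not assumed; it is read off from the law of the scaled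
    -- projection.
    have hvu : (v (u • t) : ℝ) = v t * u ^ 2 := by
      have e1 : linLaw (u • t) P₁ = (linLaw t P₁).map (u * ·) := by
        rw [linLaw, linLaw, Measure.map_map (by fun_prop) (by fun_prop)]
        congr 1
        ext y
        simp [inner_smul_left]
      rw [h₁, h₁, gaussianReal_map_const_mul, gaussianReal_ext_iff] at e1
      rw [e1.2]
      simp [mul_comm]
    have := hexp (u • t)
    rw [hvu, inner_smul_left] at this
    simp only [inner_smul_left] at this
    simp only [id, ENNReal.toReal_ofReal (Real.exp_nonneg _), smul_eq_mul]
    simpa [mul_comm] using this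
  -- Relative to `P₁` the densities are `1` and `exp f`, so the MAP rule compares `⟨w, y⟩` with the
  -- midpoint of its two means.
  rw [mapError_eq_of_density P₁ (f₁ := 1) measurable_one (by fun_prop) P₁ P₂ (by simp) hP₂]
  have s₁ : {y | (1 : EuclideanSpace ℝ ι → ℝ≥0∞) y < ENNReal.ofReal (Real.exp (f y))} =
      (fun y => inner ℝ w y) ⁻¹' {x | inner ℝ w a₁ + v w / 2 < x} := by
    ext y
    simp only [Set.mem_ofPred_eq, Set.mem_preimage, Pi.one_apply, ENNReal.one_lt_ofReal,
      Real.one_lt_exp_iff, hf]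
    constructor <;> intro h <;> linarith
  have s₂ : {y | ENNReal.ofReal (Real.exp (f y)) ≤ (1 : EuclideanSpace ℝ ι → ℝ≥0∞) y} =
      (fun y => inner ℝ w y) ⁻¹' {x | x ≤ inner ℝ w a₁ + v w / 2} := by
    ext y
    simp only [Set.mem_ofPred_eq, Set.mem_preimage, Pi.one_apply, ENNReal.ofReal_le_one,
      Real.exp_le_one_iff, hf]
    constructor <;> intro h <;> linarith
  rw [s₁, s₂, ← map_measureReal_apply (by fun_prop) (measurableSet_lt (by fun_prop) (by fun_prop)),
    ← map_measureReal_apply (by fun_prop) (measurableSet_le (by fun_prop) (by fun_prop)),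
    ← linLaw, ← linLaw, h₁, h₂]
  have ha : inner ℝ w a₂ = inner ℝ w a₁ + v w := by
    rw [← hww, inner_sub_right]
    ring
  rw [ha]
  -- Here the statistic has the same point mass under both hypotheses, and the tie goes to `H₁`:
  -- error 1/2.
  by_cases hv : v w = 0
  · simp [hv, gaussianTail_zero, Measure.real]
  have hs : √(v w : ℝ) * √(v w : ℝ) = v w := Real.mul_self_sqrt (by positivity)
  have hna := fun m => nullSingletonClass_gaussianReal (μ := m) hv
  have t₁ : (gaussianReal (inner ℝ w a₁) (v w)).real {x | inner ℝ w a₁ + v w / 2 < x} =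
      gaussianTail (1 / 2 * √(v w)) := by
    rw [← gaussianReal_Ici hv (inner ℝ w a₁)]
    have := hna (inner ℝ w a₁)
    rw [mul_assoc, hs, show (1 / 2 * v w : ℝ) = v w / 2 by ring]
    exact measureReal_congr Ioi_ae_eq_Ici
  have t₂ : (gaussianReal (inner ℝ w a₁ + v w) (v w)).real {x | x ≤ inner ℝ w a₁ + v w / 2} =
      gaussianTail (1 / 2 * √(v w)) := by
    have e : {x | x ≤ inner ℝ w a₁ + v w / 2}ᶜ = {x | inner ℝ w a₁ + v w / 2 < x} := by
      ext; simp
    have h1 := gaussianReal_Ici hv (inner ℝ w a₁ + v w) (-(1 / 2 * √(v w)))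
    have := hna (inner ℝ w a₁ + v w)
    rw [gaussianTail_neg, neg_mul, mul_assoc, hs,
      show (inner ℝ w a₁ + v w + -(1 / 2 * v w) : ℝ) = inner ℝ w a₁ + v w / 2 by ring] at h1
    have h2 := probReal_compl_eq_one_sub (μ := gaussianReal (inner ℝ w a₁ + v w) (v w))
      (s := {x | x ≤ inner ℝ w a₁ + v w / 2}) (measurableSet_le (by fun_prop) (by fun_prop))
    rw [e] at h2
    have h3 : (gaussianReal (inner ℝ w a₁ + v w) (v w)).real {x | inner ℝ w a₁ + v w / 2 < x} =
      (gaussianReal (inner ℝ w a₁ + v w) (v w)).real {x | inner ℝ w a₁ + v w / 2 ≤ x} :=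
      measureReal_congr Ioi_ae_eq_Ici
    linarith
  rw [t₁, t₂]
  ring

end GaussianShift

/-! ### The measurements as a block Toeplitz image of the inputs -/

section MeasurementLaw

variable {V : Type*} [Fintype V] [DecidableEq V]

/-- The impulse response `C G^i Π` from the nodes `K` to the nodes `J`. -/
def impulse (G : Matrix V V ℝ) (K J : Finset V) (i : ℕ) : Matrix J K ℝ :=
  sensorMatrix ℝ J * G ^ i * inputMatrix ℝ K

/-- The block lower triangular Toeplitz matrix with blocks `h (t - k)`. -/
def toep {α β : Type*} (h : ℕ → Matrix α β ℝ) (N : ℕ) : Matrix (Fin N × α) (Fin N × β) ℝ :=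
  fun p q => if q.1 ≤ p.1 then h (p.1 - q.1) p.2 q.2 else 0

theorem toep_mulVec {α β : Type*} [Fintype β] (h : ℕ → Matrix α β ℝ) {N : ℕ}
    (x : Fin N × β → ℝ) (p : Fin N × α) :
    (toep h N *ᵥ x) p =
      ∑ k : Fin N, if k ≤ p.1 then (h (p.1 - k) *ᵥ fun i => x (k, i)) p.2 else 0 := by
  simp only [toep, Matrix.mulVec, dotProduct, Fintype.sum_prod_type, ite_mul, zero_mul]
  refine Finset.sum_congr rfl fun k _ => ?_
  split_ifs <;> simp

theorem toep_transpose_mulVec {α β : Type*} [Fintype α] (h : ℕ → Matrix α β ℝ) {N : ℕ}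
    (b : Fin N × α → ℝ) (p : Fin N × β) :
    ((toep h N)ᵀ *ᵥ b) p =
      ∑ t : Fin N, if p.1 ≤ t then ((h (t - p.1))ᵀ *ᵥ fun j => b (t, j)) p.2 else 0 := by
  simp only [toep, Matrix.mulVec, dotProduct, Fintype.sum_prod_type, ite_mul, zero_mul,
    Matrix.transpose_apply]
  refine Finset.sum_congr rfl fun k _ => ?_
  split_ifs <;> simp

theorem state_eq_sum (G : Matrix V V ℝ) (K : Finset V) (w : ℕ → K → ℝ) (t : ℕ) :
    state G K w (t + 1) = ∑ k ∈ Finset.range (t + 1), (G ^ (t - k) * inputMatrix ℝ K) *ᵥ w k := by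
  induction t with
  | zero => simp [state]
  | succ t ih =>
    rw [state, ih, Finset.sum_range_succ _ (t + 1), Matrix.mulVec_sum]
    congr 1
    · refine Finset.sum_congr rfl fun k hk => ?_
      rw [Matrix.mulVec_mulVec, ← Matrix.mul_assoc, ← pow_succ',
        Nat.sub_add_comm (Nat.lt_succ_iff.1 (Finset.mem_range.1 hk))]
    · simp

theorem measurement_eq (G : Matrix V V ℝ) (K J : Finset V) (N : ℕ)
    (ω : (Fin N → EuclideanSpace ℝ K) × (Fin N → EuclideanSpace ℝ J)) (p : Fin N × J) :
    measurement G K J N ω p =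
      (toep (impulse G K J) N *ᵥ fun q => ω.1 q.1 q.2) p + ω.2 p.1 p.2 := by
  obtain ⟨t, j⟩ := p
  simp only [measurement]
  congr 1
  rw [state_eq_sum, Matrix.mulVec_sum, toep_mulVec, Finset.sum_apply]
  simp_rw [Matrix.mulVec_mulVec, ← Matrix.mul_assoc]
  rw [← Finset.sum_filter]
  -- The default `t` is never reached, since `k ≤ t < N` on the range of summation.
  refine Finset.sum_bij' (fun k _ => if h : k < N then ⟨k, h⟩ else t) (fun k _ => k) ?_ ?_ ?_ ?_ ?_
  · intro k hk
    have hk' : k < N := lt_of_lt_of_le (Finset.mem_range.1 hk) t.2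
    simp only [hk', dite_true, Finset.mem_filter, Finset.mem_univ, true_and]
    exact Nat.lt_succ_iff.1 (Finset.mem_range.1 hk)
  · intro k hk
    simp only [Finset.mem_filter, Finset.mem_univ, true_and] at hk
    exact Finset.mem_range.2 (Nat.lt_succ_iff.2 hk)
  · intro k hk
    have hk' : k < N := lt_of_lt_of_le (Finset.mem_range.1 hk) t.2
    simp [hk']
  · intro k _
    simp
  · intro k hk
    have hk' : k < N := lt_of_lt_of_le (Finset.mem_range.1 hk) t.2
    simp [hk', impulse]

/-- Writes `bᵀY` as a sum with one term per independent input or noise vector, so that its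
characteristic function factors. -/
theorem inner_measurement (G : Matrix V V ℝ) (K J : Finset V) (N : ℕ)
    (b : EuclideanSpace ℝ (Fin N × J))
    (ω : (Fin N → EuclideanSpace ℝ K) × (Fin N → EuclideanSpace ℝ J)) :
    inner ℝ b (measurement G K J N ω) =
      ∑ k, inner ℝ (WithLp.toLp 2 fun i => ((toep (impulse G K J) N)ᵀ *ᵥ b.ofLp) (k, i)) (ω.1 k) +
      ∑ t, inner ℝ (WithLp.toLp 2 fun j => b (t, j)) (ω.2 t) := by
  have h1 : inner ℝ b (measurement G K J N ω) = b.ofLp ⬝ᵥ (measurement G K J N ω).ofLp := by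
    simp [PiLp.inner_apply, dotProduct, mul_comm]
  have h2 : (measurement G K J N ω).ofLp =
      (toep (impulse G K J) N *ᵥ fun q => ω.1 q.1 q.2) + fun p => ω.2 p.1 p.2 :=
    funext fun p => measurement_eq G K J N ω p
  rw [h1, h2, dotProduct_add, Matrix.dotProduct_mulVec, ← Matrix.mulVec_transpose]
  simp [PiLp.inner_apply, dotProduct, mul_comm, Fintype.sum_prod_type]

theorem measurable_measurement (G : Matrix V V ℝ) (K J : Finset V) (N : ℕ) :
    Measurable (measurement G K J N) := by
  refine (WithLp.measurable_toLp 2 _).comp (measurable_pi_iff.2 fun p => ?_)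
  have : (fun ω : (Fin N → EuclideanSpace ℝ K) × (Fin N → EuclideanSpace ℝ J) =>
      (sensorMatrix ℝ J *ᵥ state G K (fun k => if h : k < N then (ω.1 ⟨k, h⟩).ofLp else 0)
        (p.1 + 1)) p.2 + ω.2 p.1 p.2) = fun ω =>
      (toep (impulse G K J) N *ᵥ fun q => ω.1 q.1 q.2) p + ω.2 p.1 p.2 := by
    ext ω
    exact measurement_eq G K J N ω p
  rw [this]
  have : Continuous fun ω : (Fin N → EuclideanSpace ℝ K) × (Fin N → EuclideanSpace ℝ J) =>
      (toep (impulse G K J) N *ᵥ fun q => ω.1 q.1 q.2) p + ω.2 p.1 p.2 := by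
    simp only [Matrix.mulVec, dotProduct]
    fun_prop
  exact this.measurable

instance isProbabilityMeasure_measurementLaw (G : Matrix V V ℝ) (K J : Finset V) (σ : ℝ) (N : ℕ)
    (μ : EuclideanSpace ℝ K) (Sig : Matrix K K ℝ) :
    IsProbabilityMeasure (measurementLaw G K J σ N μ Sig) :=
  Measure.isProbabilityMeasure_map (measurable_measurement G K J N).aemeasurable

/-- The law of `bᵀ Y`, in terms of a square root `Q` of the input covariance. -/
theorem linLaw_measurementLaw (G : Matrix V V ℝ) (K J : Finset V) (σ : ℝ) (N : ℕ)
    (μ : EuclideanSpace ℝ K) {Sig Q : Matrix K K ℝ} (hS : Sig.PosSemidef) (hQ : Q * Qᵀ = Sig)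
    (b : EuclideanSpace ℝ (Fin N × J)) :
    linLaw b (measurementLaw G K J σ N μ Sig) =
      gaussianReal (b.ofLp ⬝ᵥ (toep (impulse G K J) N *ᵥ fun q => μ q.2))
        (Real.toNNReal (σ ^ 2 * (b.ofLp ⬝ᵥ b.ofLp) +
          ((toep (fun i => impulse G K J i * Q) N)ᵀ *ᵥ b.ofLp) ⬝ᵥ
            ((toep (fun i => impulse G K J i * Q) N)ᵀ *ᵥ b.ofLp))) := by
  set A := toep (impulse G K J) N with hA
  set a : Fin N → K → ℝ := fun k i => (Aᵀ *ᵥ b.ofLp) (k, i) with ha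
  have hσ : (σ ^ 2 • (1 : Matrix J J ℝ)).PosSemidef := Matrix.PosSemidef.one.smul (sq_nonneg σ)
  -- The factor `Q` acts blockwise: the transposed Toeplitz matrix with `Q` is the one without it,
  -- followed by `Qᵀ` on each block `a k`.
  have hAQ : ∀ k i, ((toep (fun i => impulse G K J i * Q) N)ᵀ *ᵥ b.ofLp) (k, i) =
      (Qᵀ *ᵥ a k) i := by
    intro k i
    have : a k = ∑ t : Fin N, if k ≤ t then
        ((impulse G K J (t - k))ᵀ *ᵥ fun j => b.ofLp (t, j)) else 0 := by
      ext i
      rw [ha, Finset.sum_apply]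
      simp only [hA, toep_transpose_mulVec, ite_apply, Pi.zero_apply]
    rw [this, Matrix.mulVec_sum, Finset.sum_apply, toep_transpose_mulVec]
    refine Finset.sum_congr rfl fun t _ => ?_
    split_ifs <;> simp [Matrix.mulVec_mulVec]
  have hquad : ((toep (fun i => impulse G K J i * Q) N)ᵀ *ᵥ b.ofLp) ⬝ᵥ
      ((toep (fun i => impulse G K J i * Q) N)ᵀ *ᵥ b.ofLp) = ∑ k, a k ⬝ᵥ (Sig *ᵥ a k) := by
    rw [dotProduct, Fintype.sum_prod_type]
    refine Finset.sum_congr rfl fun k _ => ?_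
    simp_rw [hAQ]
    rw [← hQ, ← Matrix.mulVec_mulVec, Matrix.dotProduct_mulVec, ← Matrix.mulVec_transpose]
    rfl
  have hmean : b.ofLp ⬝ᵥ (A *ᵥ fun q => μ q.2) = ∑ k, a k ⬝ᵥ μ.ofLp := by
    rw [Matrix.dotProduct_mulVec, ← Matrix.mulVec_transpose, dotProduct, Fintype.sum_prod_type]
    rfl
  have hbb : b.ofLp ⬝ᵥ b.ofLp = ∑ t, (fun j => b (t, j)) ⬝ᵥ fun j => b (t, j) := by
    simp [dotProduct, Fintype.sum_prod_type]
  rw [hquad, hmean]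
  have hv : 0 ≤ σ ^ 2 * (b.ofLp ⬝ᵥ b.ofLp) + ∑ k, a k ⬝ᵥ (Sig *ᵥ a k) := by
    refine add_nonneg (mul_nonneg (sq_nonneg _) ?_) (Finset.sum_nonneg fun k _ => ?_)
    · exact Finset.sum_nonneg fun _ _ => mul_self_nonneg _
    · simpa using hS.dotProduct_mulVec_nonneg (a k)
  have hp : IsProbabilityMeasure (linLaw b (measurementLaw G K J σ N μ Sig)) :=
    Measure.isProbabilityMeasure_map (by fun_prop)
  refine Measure.ext_of_charFun ?_
  ext s
  rw [charFun_gaussianReal, charFun_apply_real, linLaw, integral_map (by fun_prop) (by fun_prop),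
    measurementLaw, integral_map (measurable_measurement G K J N).aemeasurable (by fun_prop)]
  have e : ∀ ω : (Fin N → EuclideanSpace ℝ K) × (Fin N → EuclideanSpace ℝ J),
      Complex.exp (s * (inner ℝ b (measurement G K J N ω) : ℝ) * Complex.I) =
      (∏ k, Complex.exp ((inner ℝ (ω.1 k) (s • WithLp.toLp 2 (a k)) : ℝ) * Complex.I)) *
      ∏ t, Complex.exp ((inner ℝ (ω.2 t) (s • WithLp.toLp 2 (fun j => b (t, j))) : ℝ) * Complex.I) := by
    intro ω
    rw [← Complex.exp_sum, ← Complex.exp_sum, ← Complex.exp_add, inner_measurement]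
    congr 1
    simp only [inner_smul_right, real_inner_comm, Complex.ofReal_add, Complex.ofReal_sum,
      Complex.ofReal_mul, ← Finset.sum_mul, ← Finset.mul_sum]
    ring
  simp_rw [e]
  rw [integral_prod_mul (fun w : Fin N → EuclideanSpace ℝ K =>
      ∏ k, Complex.exp ((inner ℝ (w k) (s • WithLp.toLp 2 (a k)) : ℝ) * Complex.I))
    (fun v : Fin N → EuclideanSpace ℝ J =>
      ∏ t, Complex.exp ((inner ℝ (v t) (s • WithLp.toLp 2 (fun j => b (t, j))) : ℝ) * Complex.I)),
    integral_fintype_prod_eq_prod (fun k (w : EuclideanSpace ℝ K) =>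
      Complex.exp ((inner ℝ w (s • WithLp.toLp 2 (a k)) : ℝ) * Complex.I)),
    integral_fintype_prod_eq_prod (fun t (v : EuclideanSpace ℝ J) =>
      Complex.exp ((inner ℝ v (s • WithLp.toLp 2 (fun j => b (t, j))) : ℝ) * Complex.I))]
  simp_rw [← charFun_apply, charFun_multivariateGaussian hS, charFun_multivariateGaussian hσ]
  rw [← Complex.exp_sum, ← Complex.exp_sum, ← Complex.exp_add, Real.coe_toNNReal _ hv,
    hbb]
  congr 1
  have h1 : ∀ k, inner ℝ (s • WithLp.toLp 2 (a k)) μ = s * (a k ⬝ᵥ μ.ofLp) := by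
    intro k
    simp [PiLp.inner_apply, dotProduct, mul_comm, inner_smul_left]
  simp only [h1, inner_zero_right, WithLp.ofLp_smul, Matrix.mulVec_smul, dotProduct_smul,
    smul_dotProduct, Matrix.smul_mulVec, Matrix.one_mulVec, smul_eq_mul, Complex.ofReal_zero,
    zero_mul, zero_sub, Finset.sum_sub_distrib, Finset.sum_neg_distrib, Complex.ofReal_add,
    Complex.ofReal_mul, Complex.ofReal_sum, ← Finset.mul_sum, ← Finset.sum_mul, ← Finset.sum_div,
    Complex.ofReal_pow]
  ring

end MeasurementLaw

/-! ### Toeplitz matrices on constant sequences and the Mahalanobis distance -/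

section MeanShift

theorem sum_fin_ite_le {M : Type*} [AddCommMonoid M] {N : ℕ} (t : Fin N) (f : ℕ → M) :
    (∑ k : Fin N, if k ≤ t then f (t - k) else 0) = ∑ i ∈ Finset.range (t + 1), f i := by
  rw [← Finset.sum_filter]
  refine Finset.sum_bij' (fun k _ => t - k) (fun i _ => ⟨t - i, by omega⟩) ?_ ?_ ?_ ?_ ?_
  · intro k _
    exact Finset.mem_range.2 (by omega)
  · intro i _
    simp only [Finset.mem_filter, Finset.mem_univ, true_and, Fin.le_def]
    omega
  · intro k hk
    simp only [Finset.mem_filter, Finset.mem_univ, true_and, Fin.le_def] at hk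
    refine Fin.ext ?_
    simp
    omega
  · intro i hi
    have := Finset.mem_range.1 hi
    simp
    omega
  · intro k _
    rfl

theorem sum_fin_ite_ge {M : Type*} [AddCommMonoid M] {N : ℕ} (k : Fin N) (f : ℕ → M) :
    (∑ t : Fin N, if k ≤ t then f (t - k) else 0) = ∑ i ∈ Finset.range (N - k), f i := by
  rw [← Finset.sum_filter]
  refine Finset.sum_bij' (fun t _ => t - k)
    (fun i hi => ⟨k + i, by have := Finset.mem_range.1 hi; omega⟩) ?_ ?_ ?_ ?_ ?_
  · intro t ht
    simp only [Finset.mem_filter, Finset.mem_univ, true_and, Fin.le_def] at ht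
    exact Finset.mem_range.2 (by omega)
  · intro i _
    simp only [Finset.mem_filter, Finset.mem_univ, true_and, Fin.le_def]
    omega
  · intro t ht
    simp only [Finset.mem_filter, Finset.mem_univ, true_and, Fin.le_def] at ht
    refine Fin.ext ?_
    simp
    omega
  · intro i hi
    simp
  · intro t _
    rfl

section

variable {α β : Type*} [Fintype α] [Fintype β]

theorem dotProduct_self_nonneg' (x : α → ℝ) : 0 ≤ x ⬝ᵥ x :=
  Finset.sum_nonneg fun _ _ => mul_self_nonneg _

theorem dotProduct_sq_le (x y : α → ℝ) : (x ⬝ᵥ y) ^ 2 ≤ (x ⬝ᵥ x) * (y ⬝ᵥ y) := by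
  have := Finset.sum_mul_sq_le_sq_mul_sq Finset.univ x y
  simpa [dotProduct, sq] using this

theorem exists_mulVec_bound (B : Matrix α β ℝ) :
    ∃ c, 0 ≤ c ∧ ∀ x, (B *ᵥ x) ⬝ᵥ (B *ᵥ x) ≤ c * (x ⬝ᵥ x) := by
  refine ⟨∑ i, B i ⬝ᵥ B i, Finset.sum_nonneg fun i _ => dotProduct_self_nonneg' _, fun x => ?_⟩
  rw [Finset.sum_mul]
  refine Finset.sum_le_sum fun i _ => ?_
  rw [← sq]
  exact dotProduct_sq_le (B i) x

theorem toep_const_mulVec {α β : Type*} [Fintype β] (h : ℕ → Matrix α β ℝ) {N : ℕ} (g : β → ℝ) (p : Fin N × α) :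
    (toep h N *ᵥ fun q => g q.2) p = ((∑ i ∈ Finset.range (p.1 + 1), h i) *ᵥ g) p.2 := by
  rw [toep_mulVec, sum_fin_ite_le p.1 fun i => (h i *ᵥ g) p.2, Matrix.sum_mulVec, Finset.sum_apply]

theorem toep_transpose_const_mulVec {α β : Type*} [Fintype α] (h : ℕ → Matrix α β ℝ) {N : ℕ} (u : α → ℝ)
    (p : Fin N × β) : ((toep h N)ᵀ *ᵥ fun q => u q.2) p =
      ((∑ i ∈ Finset.range (N - p.1), h i)ᵀ *ᵥ u) p.2 := by
  rw [toep_transpose_mulVec, sum_fin_ite_ge p.1 fun i => ((h i)ᵀ *ᵥ u) p.2, Matrix.transpose_sum,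
    Matrix.sum_mulVec, Finset.sum_apply]

/-- The energy of a sequence of blocks `B t *ᵥ u`, only `n` of which are nonzero. -/
theorem exists_energy_bound (B : ℕ → Matrix α β ℝ) (n : ℕ) (hB : ∀ t, n ≤ t → B t = 0) :
    ∃ c, 0 ≤ c ∧ ∀ (N : ℕ) (u : β → ℝ),
      ∑ t ∈ Finset.range N, (B t *ᵥ u) ⬝ᵥ (B t *ᵥ u) ≤ c * (u ⬝ᵥ u) := by
  choose c hc hcb using fun t => exists_mulVec_bound (B t)
  refine ⟨∑ t ∈ Finset.range n, c t, Finset.sum_nonneg fun t _ => hc t, fun N u => ?_⟩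
  calc _ ≤ ∑ t ∈ Finset.range (max N n), (B t *ᵥ u) ⬝ᵥ (B t *ᵥ u) :=
        Finset.sum_le_sum_of_subset_of_nonneg (Finset.range_mono (le_max_left _ _))
          fun t _ _ => dotProduct_self_nonneg' _
    _ = ∑ t ∈ Finset.range n, (B t *ᵥ u) ⬝ᵥ (B t *ᵥ u) := by
        refine (Finset.sum_subset (Finset.range_mono (le_max_right _ _)) fun t _ ht => ?_).symm
        rw [hB t (by simpa using ht)]
        simp
    _ ≤ _ := by
        rw [Finset.sum_mul]
        exact Finset.sum_le_sum fun t _ => hcb t u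

/-- Row `t` of the Toeplitz matrix sends a constant sequence to the partial sum of the first `t + 1`
blocks. This is the full sum once `t + 1 ≥ n`, so the defect sits in the initial blocks and its
energy has a bound independent of `N`. For the transpose the defect sits in the final blocks. -/
theorem exists_toep_boundary_bound (h : ℕ → Matrix α β ℝ) (n : ℕ) (hn : ∀ i, n ≤ i → h i = 0) :
    ∃ c, 0 ≤ c ∧ ∀ (N : ℕ) (g : β → ℝ) (r : Fin N × α → ℝ),
      r = (toep h N *ᵥ fun q => g q.2) - (fun q => ((∑ i ∈ Finset.range n, h i) *ᵥ g) q.2) →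
      r ⬝ᵥ r ≤ c * (g ⬝ᵥ g) := by
  obtain ⟨c, hc, hb⟩ := exists_energy_bound
    (fun t => (∑ i ∈ Finset.range (t + 1), h i) - ∑ i ∈ Finset.range n, h i) n (fun t ht => by
      rw [sub_eq_zero]
      refine (Finset.sum_subset (Finset.range_mono (by omega)) fun i _ hi => hn i ?_).symm
      simpa using hi)
  refine ⟨c, hc, fun N g r hr => le_trans (le_of_eq ?_) (hb N g)⟩
  rw [Finset.sum_range, dotProduct, Fintype.sum_prod_type, hr]
  simp only [Pi.sub_apply, toep_const_mulVec, Matrix.sub_mulVec, dotProduct]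

theorem exists_toep_transpose_boundary_bound (h : ℕ → Matrix α β ℝ) (n : ℕ)
    (hn : ∀ i, n ≤ i → h i = 0) :
    ∃ c, 0 ≤ c ∧ ∀ (N : ℕ) (u : α → ℝ) (r : Fin N × β → ℝ),
      r = ((toep h N)ᵀ *ᵥ fun q => u q.2) -
        (fun q => ((∑ i ∈ Finset.range n, h i)ᵀ *ᵥ u) q.2) →
      r ⬝ᵥ r ≤ c * (u ⬝ᵥ u) := by
  obtain ⟨c, hc, hb⟩ := exists_energy_bound
    (fun t => ((∑ i ∈ Finset.range (t + 1), h i) - ∑ i ∈ Finset.range n, h i)ᵀ) n (fun t ht => by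
      rw [Matrix.transpose_eq_zero, sub_eq_zero]
      refine (Finset.sum_subset (Finset.range_mono (by omega)) fun i _ hi => hn i ?_).symm
      simpa using hi)
  refine ⟨c, hc, fun N u r hr => le_trans (le_of_eq ?_) (hb N u)⟩
  -- Time reversal turns the number `N - k` of remaining blocks into `k + 1`.
  rw [Finset.sum_range, dotProduct, Fintype.sum_prod_type, hr, ← Equiv.sum_comp Fin.revPerm]
  refine Finset.sum_congr rfl fun k _ => ?_
  have : N - (Fin.rev k : ℕ) = k + 1 := by
    rw [Fin.val_rev]
    omega
  simp only [Pi.sub_apply, toep_transpose_const_mulVec, Fin.revPerm_apply, this,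
    Matrix.transpose_sub, Matrix.sub_mulVec, dotProduct]

/-- Stability of the regularized normal equations. -/
theorem normal_equations_stable {s : ℝ} (hs : 0 < s) (A : Matrix α β ℝ) (w u : α → ℝ)
    (x q : β → ℝ) (hw : A *ᵥ (Aᵀ *ᵥ w) + s • w = A *ᵥ x) (r₁ : α → ℝ) (r₂ : β → ℝ)
    (h₁ : r₁ = A *ᵥ (x - q) - u) (h₂ : r₂ = Aᵀ *ᵥ u - s • q) :
    s ^ 2 * ((Aᵀ *ᵥ w - q) ⬝ᵥ (Aᵀ *ᵥ w - q)) ≤ s * (r₁ ⬝ᵥ r₁) + r₂ ⬝ᵥ r₂ := by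
  -- The exact solution satisfies `s w = A(x - Aᵀw)`. The vectors `u` and `q` are candidates for `s
  -- w` and `Aᵀw`, with residuals `r₁` and `r₂`; testing the error equation against `e` gives the
  -- energy identity `key`.
  set e := Aᵀ *ᵥ w - q with he
  have hAe : A *ᵥ e + s • w = A *ᵥ (x - q) := by
    rw [he, Matrix.mulVec_sub, Matrix.mulVec_sub, ← hw]
    abel
  have hse : s • e = Aᵀ *ᵥ (s • w) - s • q := by
    rw [he, smul_sub, Matrix.mulVec_smul]
  have key : (A *ᵥ e) ⬝ᵥ (A *ᵥ e) + s * (e ⬝ᵥ e) = (A *ᵥ e) ⬝ᵥ r₁ + e ⬝ᵥ r₂ := by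
    have e1 : s • w = u + r₁ - A *ᵥ e := by
      rw [h₁, ← hAe]
      abel
    have e2 : s * (e ⬝ᵥ e) = e ⬝ᵥ (Aᵀ *ᵥ (u + r₁ - A *ᵥ e) - s • q) := by
      rw [← e1, ← hse, dotProduct_smul, smul_eq_mul]
    have e3 : ∀ y, e ⬝ᵥ (Aᵀ *ᵥ y) = (A *ᵥ e) ⬝ᵥ y := fun y => by
      rw [Matrix.dotProduct_mulVec, Matrix.vecMul_transpose]
    rw [e2, h₂, dotProduct_sub, dotProduct_sub, e3, e3, dotProduct_sub, dotProduct_add]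
    ring
  -- The two squares absorb the cross terms of `key` into `‖Ae‖²` and half of `s²‖e‖²`.
  have c1 := dotProduct_self_nonneg' (A *ᵥ e - (1 / 2 : ℝ) • r₁)
  have c2 := dotProduct_self_nonneg' (s • e - r₂)
  simp only [sub_dotProduct, dotProduct_sub, smul_dotProduct, dotProduct_smul, smul_eq_mul,
    dotProduct_comm r₁, dotProduct_comm r₂] at c1 c2
  have c3 := dotProduct_self_nonneg' (A *ᵥ e)
  have c4 := mul_nonneg hs.le (dotProduct_self_nonneg' r₁)
  have key' : s * _ = s * _ := congrArg (s * ·) key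
  have c5 := mul_nonneg hs.le c1
  rw [mul_add, mul_add] at key'
  nlinarith

theorem posDef_mul_transpose_add [DecidableEq α] {s : ℝ} (hs : 0 < s) (A : Matrix α β ℝ) :
    (A * Aᵀ + s • (1 : Matrix α α ℝ)).PosDef := by
  have h := Matrix.posSemidef_self_mul_conjTranspose A
  rw [Matrix.conjTranspose_eq_transpose_of_trivial] at h
  exact Matrix.PosDef.posSemidef_add h (Matrix.PosDef.one.smul hs)

theorem exists_normal_solution {s : ℝ} (hs : 0 < s) (A : Matrix α β ℝ) (y : α → ℝ) :
    ∃ w, A *ᵥ (Aᵀ *ᵥ w) + s • w = y := by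
  classical
  refine ⟨(A * Aᵀ + s • (1 : Matrix α α ℝ))⁻¹ *ᵥ y, ?_⟩
  have h : ∀ w, A *ᵥ (Aᵀ *ᵥ w) + s • w = (A * Aᵀ + s • (1 : Matrix α α ℝ)) *ᵥ w := fun w => by
    rw [Matrix.add_mulVec, Matrix.smul_mulVec, Matrix.one_mulVec, Matrix.mulVec_mulVec]
  rw [h, Matrix.mulVec_mulVec, Matrix.mul_nonsing_inv _
    ((Matrix.isUnit_iff_isUnit_det _).1 (posDef_mul_transpose_add hs A).isUnit), Matrix.one_mulVec]

/-- The matrix `(LᵀL + s)⁻¹ LᵀL`. -/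
def regGain [DecidableEq β] (L : Matrix α β ℝ) (s : ℝ) : Matrix β β ℝ :=
  (Lᵀ * L + s • (1 : Matrix β β ℝ))⁻¹ * (Lᵀ * L)

/-- The normal equation for minimizing `‖Lg‖² + s‖m - g‖²`, at `g = m - regGain L s m`. -/
theorem smul_regGain_mulVec [DecidableEq β] {s : ℝ} (hs : 0 < s) (L : Matrix α β ℝ) (m : β → ℝ) :
    s • (regGain L s *ᵥ m) = Lᵀ *ᵥ (L *ᵥ (m - regGain L s *ᵥ m)) := by
  have hpd := posDef_mul_transpose_add hs Lᵀ
  rw [Matrix.transpose_transpose] at hpd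
  have h : (Lᵀ * L + s • (1 : Matrix β β ℝ)) *ᵥ (regGain L s *ᵥ m) = (Lᵀ * L) *ᵥ m := by
    rw [regGain, Matrix.mulVec_mulVec, Matrix.mul_nonsing_inv_cancel_left _ _
      ((Matrix.isUnit_iff_isUnit_det _).1 hpd.isUnit)]
  rw [Matrix.add_mulVec, Matrix.smul_mulVec, Matrix.one_mulVec] at h
  rw [Matrix.mulVec_mulVec, Matrix.mulVec_sub, ← h]
  abel

/-- The squared Mahalanobis distance of the mean shift model with a finite impulse response is
`N mᵀ (LᵀL + s)⁻¹ LᵀL m` up to a boundary term. -/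
theorem exists_mahalanobis_bound [DecidableEq β] {s : ℝ} (hs : 0 < s) (h : ℕ → Matrix α β ℝ)
    (n : ℕ) (hn : ∀ i, n ≤ i → h i = 0) :
    ∃ c, 0 ≤ c ∧ ∀ (N : ℕ) (m : β → ℝ) (w : Fin N × α → ℝ),
      toep h N *ᵥ ((toep h N)ᵀ *ᵥ w) + s • w = toep h N *ᵥ (fun q => m q.2) →
      (w ⬝ᵥ (toep h N *ᵥ fun q => m q.2) -
        N * (m ⬝ᵥ (regGain (∑ i ∈ Finset.range n, h i) s *ᵥ m))) ^ 2 ≤ c * N * (m ⬝ᵥ m) ^ 2 := by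
  set L := ∑ i ∈ Finset.range n, h i with hL
  obtain ⟨c₁, hc₁, hb₁⟩ := exists_toep_boundary_bound h n hn
  obtain ⟨c₂, hc₂, hb₂⟩ := exists_toep_transpose_boundary_bound h n hn
  obtain ⟨c₃, hc₃, hb₃⟩ := exists_mulVec_bound (1 - regGain L s)
  obtain ⟨c₄, hc₄, hb₄⟩ := exists_mulVec_bound L
  refine ⟨(s * (c₁ * c₃) + c₂ * (c₄ * c₃)) / s ^ 2, by positivity, fun N m w hw => ?_⟩
  set A := toep h N with hA
  set g := m - regGain L s *ᵥ m with hg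
  -- In the interior `A` acts as `L`, so the constant sequence with value `regGain L s m` nearly
  -- equals `Aᵀw`; by `smul_regGain_mulVec` both residuals are pure boundary terms.
  set q : Fin N × β → ℝ := fun p => (regGain L s *ᵥ m) p.2 with hq
  set x : Fin N × β → ℝ := fun p => m p.2 with hx
  have hgx : x - q = fun p => g p.2 := rfl
  have hgg : g ⬝ᵥ g ≤ c₃ * (m ⬝ᵥ m) := by
    have := hb₃ m
    rwa [Matrix.sub_mulVec, Matrix.one_mulVec] at this
  have hLg : (L *ᵥ g) ⬝ᵥ (L *ᵥ g) ≤ c₄ * c₃ * (m ⬝ᵥ m) :=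
    (hb₄ g).trans (by rw [mul_assoc]; exact mul_le_mul_of_nonneg_left hgg hc₄)
  have hst := normal_equations_stable hs A w (fun p => (L *ᵥ g) p.2) x q hw _ _ rfl rfl
  have h1 := hb₁ N g _ rfl
  have h2 := hb₂ N (L *ᵥ g) _ rfl
  have hsq : s • q = fun p => (Lᵀ *ᵥ (L *ᵥ g)) p.2 := by
    rw [hg, ← smul_regGain_mulVec hs L m]
    rfl
  rw [hgx, hsq] at hst
  set e := Aᵀ *ᵥ w - q with he
  have hee : e ⬝ᵥ e ≤ (s * (c₁ * c₃) + c₂ * (c₄ * c₃)) / s ^ 2 * (m ⬝ᵥ m) := by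
    rw [div_mul_eq_mul_div, le_div_iff₀ (by positivity)]
    have i1 := mul_le_mul_of_nonneg_left (h1.trans (mul_le_mul_of_nonneg_left hgg hc₁)) hs.le
    have i2 := h2.trans (mul_le_mul_of_nonneg_left hLg hc₂)
    linarith
  have hxx : x ⬝ᵥ x = N * (m ⬝ᵥ m) := by
    simp [hx, dotProduct, Fintype.sum_prod_type]
  have hqx : x ⬝ᵥ q = N * (m ⬝ᵥ (regGain L s *ᵥ m)) := by
    simp [hx, hq, dotProduct, Fintype.sum_prod_type]
  -- The error is `e ⬝ᵥ x`, where `‖e‖²` is bounded by a multiple of `‖m‖²` uniformly in `N` and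
  -- `‖x‖² = N‖m‖²`; Cauchy–Schwarz therefore loses only one factor `N`.
  have hfin : w ⬝ᵥ (A *ᵥ x) - N * (m ⬝ᵥ (regGain L s *ᵥ m)) = e ⬝ᵥ x := by
    rw [← hqx, he, sub_dotProduct, Matrix.dotProduct_mulVec, ← Matrix.mulVec_transpose,
      dotProduct_comm x q]
  rw [hfin]
  calc (e ⬝ᵥ x) ^ 2 ≤ (e ⬝ᵥ e) * (x ⬝ᵥ x) := dotProduct_sq_le e x
    _ ≤ ((s * (c₁ * c₃) + c₂ * (c₄ * c₃)) / s ^ 2 * (m ⬝ᵥ m)) * (x ⬝ᵥ x) :=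
        mul_le_mul_of_nonneg_right hee (dotProduct_self_nonneg' x)
    _ = _ := by rw [hxx]; ring

end

end MeanShift

/-! ### Asymptotic MAP error of the mean shift model -/

section MeanShiftLimit

variable {V : Type*} [Fintype V] [DecidableEq V]

theorem matrixSqrt_mul_self {ι : Type*} [Fintype ι] [DecidableEq ι] {A : Matrix ι ι ℝ}
    (hA : A.PosSemidef) : matrixSqrt A * matrixSqrt A = A :=
  CFC.sqrt_mul_sqrt_self A (Matrix.nonneg_iff_posSemidef.2 hA)

theorem matrixSqrt_transpose {ι : Type*} [Fintype ι] [DecidableEq ι] (A : Matrix ι ι ℝ) :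
    (matrixSqrt A)ᵀ = matrixSqrt A := by
  have h := (Matrix.nonneg_iff_posSemidef.1 (CFC.sqrt_nonneg A)).isHermitian
  rwa [Matrix.IsHermitian, Matrix.conjTranspose_eq_transpose_of_trivial] at h

theorem isUnit_det_matrixSqrt {ι : Type*} [Fintype ι] [DecidableEq ι] {A : Matrix ι ι ℝ}
    (hA : A.PosDef) : IsUnit (matrixSqrt A).det := by
  have h := hA.det_pos
  rw [← matrixSqrt_mul_self hA.posSemidef, Matrix.det_mul] at h
  exact isUnit_iff_ne_zero.2 fun h0 => by simp [h0] at h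

theorem toep_mul_const {α β : Type*} [Fintype β] (h : ℕ → Matrix α β ℝ) (Q : Matrix β β ℝ)
    (N : ℕ) (x : β → ℝ) :
    (toep (fun i => h i * Q) N *ᵥ fun q => x q.2) = toep h N *ᵥ fun q => (Q *ᵥ x) q.2 := by
  ext p
  rw [toep_const_mulVec, toep_const_mulVec, ← Matrix.sum_mul, Matrix.mulVec_mulVec]

/-- Error probability of the MAP detector for the mean shift model with `N` samples. -/
theorem mapError_mean_shift (G : Matrix V V ℝ) (K J : Finset V) {σ : ℝ} (hσ : 0 < σ)
    {Sig : Matrix K K ℝ} (hS : Sig.PosDef) (N : ℕ) (μ₁ μ₂ : EuclideanSpace ℝ K)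
    (A : Matrix (Fin N × J) (Fin N × K) ℝ)
    (hA : A = toep (fun i => impulse G K J i * matrixSqrt Sig) N) (x : Fin N × K → ℝ)
    (hx : x = fun q => ((matrixSqrt Sig)⁻¹ *ᵥ (μ₂ - μ₁).ofLp) q.2) :
    ∃ w : Fin N × J → ℝ, A *ᵥ (Aᵀ *ᵥ w) + σ ^ 2 • w = A *ᵥ x ∧
      mapError (1 / 2) (1 / 2) (measurementLaw G K J σ N μ₁ Sig)
        (measurementLaw G K J σ N μ₂ Sig) = gaussianTail (1 / 2 * √(w ⬝ᵥ (A *ᵥ x))) := by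
  obtain ⟨w, hw⟩ := exists_normal_solution (pow_pos hσ 2) A (A *ᵥ x)
  refine ⟨w, hw, ?_⟩
  have hQ : matrixSqrt Sig * (matrixSqrt Sig)ᵀ = Sig := by
    rw [matrixSqrt_transpose, matrixSqrt_mul_self hS.posSemidef]
  set a : EuclideanSpace ℝ K → EuclideanSpace ℝ (Fin N × J) := fun μ =>
    WithLp.toLp 2 (toep (impulse G K J) N *ᵥ fun q => μ q.2) with ha
  have hlin : ∀ μ t, linLaw t (measurementLaw G K J σ N μ Sig) = gaussianReal (inner ℝ t (a μ))
      (Real.toNNReal (σ ^ 2 * (t.ofLp ⬝ᵥ t.ofLp) + (Aᵀ *ᵥ t.ofLp) ⬝ᵥ (Aᵀ *ᵥ t.ofLp))) := by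
    intro μ t
    rw [linLaw_measurementLaw G K J σ N μ hS.posSemidef hQ t, ← hA]
    congr 1
    simp [PiLp.inner_apply, ha, dotProduct, mul_comm]
  have hv : ∀ t : Fin N × J → ℝ, 0 ≤ σ ^ 2 * (t ⬝ᵥ t) + (Aᵀ *ᵥ t) ⬝ᵥ (Aᵀ *ᵥ t) := fun t =>
    add_nonneg (mul_nonneg (sq_nonneg _) (dotProduct_self_nonneg' _)) (dotProduct_self_nonneg' _)
  have hd : ∀ t : EuclideanSpace ℝ (Fin N × J), inner ℝ t (a μ₂ - a μ₁) =
      (Aᵀ *ᵥ t.ofLp) ⬝ᵥ (Aᵀ *ᵥ w) + σ ^ 2 * (t.ofLp ⬝ᵥ w) := by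
    intro t
    have e1 : (a μ₂ - a μ₁).ofLp = A *ᵥ x := by
      rw [hA, hx, toep_mul_const, Matrix.mulVec_mulVec,
        Matrix.mul_nonsing_inv _ (isUnit_det_matrixSqrt hS), Matrix.one_mulVec]
      simp only [ha, WithLp.ofLp_sub, ← Matrix.mulVec_sub]
      rfl
    have e2 : inner ℝ t (a μ₂ - a μ₁) = t.ofLp ⬝ᵥ (a μ₂ - a μ₁).ofLp := by
      simp [PiLp.inner_apply, dotProduct, mul_comm]
    rw [e2, e1, ← hw, dotProduct_add, dotProduct_smul, smul_eq_mul, Matrix.dotProduct_mulVec,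
      ← Matrix.mulVec_transpose]
  have hwx : w ⬝ᵥ (A *ᵥ x) = σ ^ 2 * (w ⬝ᵥ w) + (Aᵀ *ᵥ w) ⬝ᵥ (Aᵀ *ᵥ w) := by
    rw [← hw, dotProduct_add, dotProduct_smul, smul_eq_mul, Matrix.dotProduct_mulVec,
      ← Matrix.mulVec_transpose, add_comm]
  rw [mapError_gaussian_shift _ _ (a μ₁) (a μ₂) (WithLp.toLp 2 w) _ (hlin μ₁) (hlin μ₂)
    (fun t => ?_) ?_]
  · rw [hwx, Real.coe_toNNReal _ (hv _)]
  · rw [hd, Real.coe_toNNReal _ (hv _)]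
    ring
  · rw [hd, Real.coe_toNNReal _ (hv _), Real.coe_toNNReal _ (hv _), Real.coe_toNNReal _ (hv _)]
    simp only [WithLp.ofLp_add, Matrix.mulVec_add, dotProduct_add, add_dotProduct,
      dotProduct_comm w, dotProduct_comm (Aᵀ *ᵥ w)]
    ring

theorem impulse_eq_zero {G : Matrix V V ℝ} {n : ℕ} (hG : G ^ n = 0) (K J : Finset V) {i : ℕ}
    (hi : n ≤ i) : impulse G K J i = 0 := by
  rw [impulse, pow_eq_zero_of_le hi hG]
  simp

/-- Nilpotency makes the Neumann series of `(I - G)⁻¹` a finite sum. -/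
theorem transfer_one_eq_sum {G : Matrix V V ℝ} {n : ℕ} (hG : G ^ n = 0) (K J : Finset V) :
    transfer G K J 1 = ∑ i ∈ Finset.range n, impulse G K J i := by
  have h : ((1 : ℝ) • (1 : Matrix V V ℝ) - G)⁻¹ = ∑ i ∈ Finset.range n, G ^ i := by
    refine Matrix.inv_eq_right_inv ?_
    rw [one_smul, mul_neg_geom_sum, hG, sub_zero]
  rw [transfer, h, Matrix.mul_sum, Matrix.sum_mul]
  rfl

/-- The square root is 1/2-Hölder; negative arguments are covered since their root is 0 by
convention. -/
theorem abs_sqrt_sub_sqrt_le (x y : ℝ) : |√x - √y| ≤ √|x - y| := by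
  wlog h : y ≤ x generalizing x y
  · rw [abs_sub_comm, abs_sub_comm x]
    exact this y x (le_of_not_ge h)
  rw [abs_of_nonneg (sub_nonneg.2 (Real.sqrt_le_sqrt h)), abs_of_nonneg (sub_nonneg.2 h)]
  rcases le_total y 0 with hy | hy
  · rw [Real.sqrt_eq_zero_of_nonpos hy, sub_zero]
    exact Real.sqrt_le_sqrt (by linarith)
  · rw [sub_le_iff_le_add]
    refine Real.sqrt_le_iff.2 ⟨by positivity, ?_⟩
    have h1 := Real.sq_sqrt (sub_nonneg.2 h)
    have h2 := Real.sq_sqrt hy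
    nlinarith [mul_nonneg (Real.sqrt_nonneg (x - y)) (Real.sqrt_nonneg y)]

theorem tendsto_mapError_sub_asympMeanError (G : Matrix V V ℝ) (K J : Finset V) {σ : ℝ}
    (hσ : 0 < σ) {Sig : Matrix K K ℝ} (hS : Sig.PosDef) (μ₁ μ₂ : ℕ → EuclideanSpace ℝ K) {c : ℝ}
    (hc : Tendsto (fun N : ℕ => (N : ℝ) * ‖μ₂ N - μ₁ N‖ ^ 2) atTop (𝓝 c)) {n : ℕ}
    (hG : G ^ n = 0) :
    Tendsto (fun N : ℕ => mapError (1 / 2) (1 / 2) (measurementLaw G K J σ N (μ₁ N) Sig)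
      (measurementLaw G K J σ N (μ₂ N) Sig) - asympMeanError G K J σ N (μ₁ N) (μ₂ N) Sig)
      atTop (𝓝 0) := by
  set h : ℕ → Matrix J K ℝ := fun i => impulse G K J i * matrixSqrt Sig with hh
  set m : ℕ → K → ℝ := fun N => (matrixSqrt Sig)⁻¹ *ᵥ (μ₂ N - μ₁ N).ofLp with hm
  obtain ⟨C, hC, hb⟩ := exists_mahalanobis_bound (pow_pos hσ 2) h n fun i hi => by
    rw [hh]
    simp [impulse_eq_zero hG K J hi]
  obtain ⟨D, hD, hDb⟩ := exists_mulVec_bound (matrixSqrt Sig)⁻¹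
  have hL : ∑ i ∈ Finset.range n, h i = transfer G K J 1 * matrixSqrt Sig := by
    rw [transfer_one_eq_sum hG, Matrix.sum_mul]
  rw [hL] at hb
  choose w hw he using fun N => mapError_mean_shift G K J hσ hS N (μ₁ N) (μ₂ N) _ rfl _ rfl
  set δ : ℕ → ℝ := fun N => w N ⬝ᵥ (toep h N *ᵥ fun q => m N q.2) with hδ
  set η : ℕ → ℝ := fun N => etaSq G K J σ N (μ₁ N) (μ₂ N) Sig with hη
  have hmm : ∀ N, m N ⬝ᵥ m N ≤ D * ‖μ₂ N - μ₁ N‖ ^ 2 := by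
    intro N
    refine (hDb _).trans (le_of_eq ?_)
    rw [EuclideanSpace.norm_sq_eq]
    simp [dotProduct, sq]
  -- The bound `C N ‖m‖⁴` is rewritten as `(N‖μ₂ - μ₁‖²)² / N`, up to a constant: a convergent
  -- sequence times `1/N`.
  have hdiff : ∀ N, (δ N - η N) ^ 2 ≤ C * D ^ 2 * ((N * ‖μ₂ N - μ₁ N‖ ^ 2) ^ 2 * (N : ℝ)⁻¹) := by
    intro N
    refine (hb N (m N) (w N) (hw N)).trans ?_
    have h1 : (m N ⬝ᵥ m N) ^ 2 ≤ (D * ‖μ₂ N - μ₁ N‖ ^ 2) ^ 2 :=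
      pow_le_pow_left₀ (dotProduct_self_nonneg' _) (hmm N) 2
    refine (mul_le_mul_of_nonneg_left h1 (by positivity)).trans (le_of_eq ?_)
    rcases eq_or_ne (N : ℝ) 0 with h0 | h0
    · simp [h0]
    · field_simp
  have hlim : Tendsto (fun N => (δ N - η N) ^ 2) atTop (𝓝 0) := by
    refine squeeze_zero (fun N => sq_nonneg _) hdiff ?_
    have := ((hc.pow 2).mul (tendsto_inv_atTop_nhds_zero_nat (𝕜 := ℝ))).const_mul (C * D ^ 2)
    simpa using this
  have hsq : Tendsto (fun N => 1 / 2 * √|δ N - η N|) atTop (𝓝 0) := by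
    have := ((Real.continuous_sqrt.comp Real.continuous_sqrt).tendsto 0).comp hlim
    replace this := this.const_mul (1 / 2 : ℝ)
    simp only [Function.comp_def, Real.sqrt_sq_eq_abs, Real.sqrt_zero, mul_zero] at this
    exact this
  refine squeeze_zero_norm (fun N => ?_) hsq
  rw [he N, asympMeanError, Real.norm_eq_abs]
  refine (abs_gaussianTail_sub_le _ _).trans ?_
  rw [← mul_sub, abs_mul, abs_of_pos (by norm_num : (0 : ℝ) < 1 / 2)]
  exact mul_le_mul_of_nonneg_left (abs_sqrt_sub_sqrt_le _ _) (by norm_num)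

end MeanShiftLimit

/-! ### Extreme singular values as operator bounds -/

section SingularValues

open Module

variable {𝕜 E F : Type*} [RCLike 𝕜] [NormedAddCommGroup E]
    [InnerProductSpace 𝕜 E] [FiniteDimensional 𝕜 E] [NormedAddCommGroup F] [InnerProductSpace 𝕜 F]
    [FiniteDimensional 𝕜 F]

/-- Expand `⟨x, T*T x⟩` in an orthonormal eigenbasis of `T*T`, whose eigenvalues are the squared
singular values. -/
theorem norm_sq_eq_sum_singularValues (T : E →ₗ[𝕜] F) {n : ℕ} (hn : finrank 𝕜 E = n) (x : E) :
    ‖T x‖ ^ 2 = ∑ i : Fin n, T.singularValues i ^ 2 *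
      ‖inner 𝕜 (T.isSymmetric_adjoint_comp_self.eigenvectorBasis hn i) x‖ ^ 2 := by
  set b := T.isSymmetric_adjoint_comp_self.eigenvectorBasis hn with hb
  have h1 : ((‖T x‖ ^ 2 : ℝ) : 𝕜) = inner 𝕜 x ((T.adjoint ∘ₗ T) x) := by
    rw [LinearMap.comp_apply, LinearMap.adjoint_inner_right, inner_self_eq_norm_sq_to_K]
    push_cast
    rfl
  have h2 : ∀ i : Fin n, inner 𝕜 (b i) ((T.adjoint ∘ₗ T) x) =
      ((T.singularValues i ^ 2 : ℝ) : 𝕜) * inner 𝕜 (b i) x := by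
    intro i
    rw [← T.isSymmetric_adjoint_comp_self, hb, LinearMap.IsSymmetric.apply_eigenvectorBasis,
      inner_smul_left, RCLike.conj_ofReal, T.sq_singularValues_fin hn]
  rw [← b.sum_inner_mul_inner] at h1
  simp_rw [h2] at h1
  have h3 : ∀ i : Fin n, inner 𝕜 x (b i) * (((T.singularValues i ^ 2 : ℝ) : 𝕜) * inner 𝕜 (b i) x) =
      ((T.singularValues i ^ 2 * ‖inner 𝕜 (b i) x‖ ^ 2 : ℝ) : 𝕜) := by
    intro i
    rw [mul_left_comm, ← inner_conj_symm x (b i), RCLike.conj_mul]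
    push_cast
    ring
  simp_rw [h3] at h1
  exact_mod_cast h1

theorem norm_apply_le_singularValues_zero (T : E →ₗ[𝕜] F) (x : E) :
    ‖T x‖ ≤ T.singularValues 0 * ‖x‖ := by
  have h0 := T.singularValues_nonneg 0
  refine le_of_pow_le_pow_left₀ two_ne_zero (by positivity) ?_
  rw [mul_pow, norm_sq_eq_sum_singularValues T rfl,
    ← (T.isSymmetric_adjoint_comp_self.eigenvectorBasis rfl).sum_sq_norm_inner_right x,
    Finset.mul_sum]
  refine Finset.sum_le_sum fun i _ => mul_le_mul_of_nonneg_right ?_ (sq_nonneg _)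
  exact pow_le_pow_left₀ (T.singularValues_nonneg _) (T.singularValues_antitone (Nat.zero_le _)) 2

theorem singularValues_last_mul_norm_le (T : E →ₗ[𝕜] F) (x : E) :
    T.singularValues (finrank 𝕜 E - 1) * ‖x‖ ≤ ‖T x‖ := by
  refine le_of_pow_le_pow_left₀ two_ne_zero (norm_nonneg _) ?_
  rw [mul_pow, norm_sq_eq_sum_singularValues T rfl,
    ← (T.isSymmetric_adjoint_comp_self.eigenvectorBasis rfl).sum_sq_norm_inner_right x,
    Finset.mul_sum]
  refine Finset.sum_le_sum fun i _ => mul_le_mul_of_nonneg_right ?_ (sq_nonneg _)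
  exact pow_le_pow_left₀ (T.singularValues_nonneg _) (T.singularValues_antitone (by omega)) 2

theorem singularValues_le_of_norm_le (T : E →ₗ[𝕜] F) {c : ℝ} (hc : 0 ≤ c)
    (h : ∀ x, ‖T x‖ ≤ c * ‖x‖) (i : ℕ) : T.singularValues i ≤ c := by
  rcases lt_or_ge i (finrank 𝕜 E) with hi | hi
  · set b := T.isSymmetric_adjoint_comp_self.eigenvectorBasis rfl with hb
    have h1 := norm_sq_eq_sum_singularValues T rfl (b ⟨i, hi⟩)
    rw [← hb, Finset.sum_eq_single ⟨i, hi⟩ (fun j _ hj => by simp [b.inner_eq_zero hj])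
      (fun h => (h (Finset.mem_univ _)).elim)] at h1
    have h2 := h (b ⟨i, hi⟩)
    simp only [OrthonormalBasis.inner_eq_one, norm_one, one_pow, mul_one,
      OrthonormalBasis.norm_eq_one] at h1 h2
    refine le_of_pow_le_pow_left₀ two_ne_zero hc ?_
    rw [← h1]
    exact pow_le_pow_left₀ (norm_nonneg _) h2 2
  · rw [T.singularValues_of_finrank_le hi]
    exact hc

end SingularValues

/-! ### Factorization of the transfer matrix through the cutset -/

section Cutset

variable {V : Type*} [Fintype V] [DecidableEq V]

theorem norm_cutTransfer_mulVec_le (G : Matrix V V ℝ) (C P : Finset V) (z : ℂ) (x : C → ℂ) :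
    ‖WithLp.toLp 2 (cutTransfer G C P z *ᵥ x)‖ ≤ rhoMax G C P z * ‖WithLp.toLp 2 x‖ :=
  norm_apply_le_singularValues_zero (Matrix.toEuclideanLin (cutTransfer G C P z)) (WithLp.toLp 2 x)

theorem rhoMin_mul_norm_le (G : Matrix V V ℝ) (C P : Finset V) (z : ℂ) (x : C → ℂ) :
    rhoMin G C P z * ‖WithLp.toLp 2 x‖ ≤ ‖WithLp.toLp 2 (cutTransfer G C P z *ᵥ x)‖ := by
  have := singularValues_last_mul_norm_le (Matrix.toEuclideanLin (cutTransfer G C P z))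
    (WithLp.toLp 2 x)
  rwa [finrank_euclideanSpace, Fintype.card_coe] at this

theorem isUnit_det_smul_one_sub {n : Type*} [Fintype n] [DecidableEq n] {A : Matrix n n ℂ} {z : ℂ}
    (hz : z ∉ spectrum ℂ A) : IsUnit (z • (1 : Matrix n n ℂ) - A).det := by
  rw [spectrum.notMem_iff, Algebra.algebraMap_eq_smul_one] at hz
  exact (Matrix.isUnit_iff_isUnit_det _).1 hz

theorem transfer_apply {𝕜 : Type*} [Field 𝕜] (G : Matrix V V 𝕜) (K J : Finset V) (z : 𝕜) (j : J)
    (k : K) : transfer G K J z j k =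
      ((z • (1 : Matrix V V 𝕜) - G)⁻¹ * inputMatrix 𝕜 K) j.1 k := by
  rw [transfer, sensorMatrix, Matrix.mul_assoc, ← Matrix.submatrix_id_id
    ((z • (1 : Matrix V V 𝕜) - G)⁻¹ * inputMatrix 𝕜 K), ← Matrix.submatrix_mul _ _ _ _ _
    Function.bijective_id, Matrix.one_mul]
  rfl

/-- The transfer matrix to the partitioned set factors through the cutset. -/
theorem transfer_eq_cutTransfer_mul {E : Digraph V} {G : Matrix V V ℝ} (hG : IsWeightedAdj E G)
    {K S C P : Finset V} {d : ℕ} (hcut : IsNodeCutset E K d S C P) {z : ℂ}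
    (hz : z ∉ spectrum ℂ (G.map Complex.ofReal)) (hzP : z ∉ spectrum ℂ (blockC G P P)) :
    transfer (G.map Complex.ofReal) K P z =
      cutTransfer G C P z * transfer (G.map Complex.ofReal) K C z := by
  set Gc := G.map Complex.ofReal with hGc
  set X := (z • (1 : Matrix V V ℂ) - Gc)⁻¹ * inputMatrix ℂ K with hX
  have hMX : (z • (1 : Matrix V V ℂ) - Gc) * X = inputMatrix ℂ K :=
    Matrix.mul_nonsing_inv_cancel_left _ _ (isUnit_det_smul_one_sub hz)
  -- An edge from `S` to `P` would be a one-edge path that misses `C`.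
  have hSP : ∀ p ∈ P, ∀ s ∈ S, Gc p s = 0 := by
    intro p hp s hs
    have : G p s = 0 := by
      refine hG p s fun hadj => ?_
      obtain ⟨t, ht, htC⟩ := hcut.separates 1 (fun t => if t = 0 then s else p)
        (fun t ht => by
          obtain rfl : t = 0 := by omega
          simpa using hadj) (by simpa using hs) (by simpa using hp)
      split_ifs at htC
      · exact Finset.disjoint_left.1 hcut.disj_SC hs htC
      · exact Finset.disjoint_left.1 hcut.disj_CP htC hp
    simp [hGc, this]
  -- The rows of `(zI - G) X = Π` in `P`: the right-hand side vanishes there because inputs lie in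
  -- `S`, and the columns in `S` drop out by `hSP`.
  have hrow : (z • (1 : Matrix P P ℂ) - blockC G P P) * transfer Gc K P z =
      blockC G P C * transfer Gc K C z := by
    ext p k
    have h := congrFun (congrFun hMX p.1) k
    have hin : inputMatrix ℂ K p.1 k = 0 := by
      have : p.1 ≠ k.1 := fun h =>
        Finset.disjoint_left.1 hcut.disj_SP (hcut.input_subset k.2) (h ▸ p.2)
      simp [inputMatrix, this]
    rw [hin, Matrix.sub_mul, Matrix.smul_mul, Matrix.one_mul, Matrix.sub_apply, Matrix.smul_apply,
      Matrix.mul_apply, sub_eq_zero] at h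
    have hsum : ∑ v, Gc p.1 v * X v k = ∑ v ∈ C, Gc p.1 v * X v k + ∑ v ∈ P, Gc p.1 v * X v k := by
      rw [← Finset.sum_union hcut.disj_CP]
      refine (Finset.sum_subset (Finset.subset_univ _) fun v _ hv => ?_).symm
      have : v ∈ S := by
        rcases hcut.cover v with h | h | h
        · exact h
        · exact (hv (Finset.mem_union_left _ h)).elim
        · exact (hv (Finset.mem_union_right _ h)).elim
      rw [hSP p.1 p.2 v this, zero_mul]
    rw [Matrix.sub_mul, Matrix.smul_mul, Matrix.one_mul, Matrix.sub_apply, Matrix.smul_apply,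
      Matrix.mul_apply, Matrix.mul_apply]
    simp_rw [transfer_apply, ← hX]
    rw [h, hsum, ← Finset.sum_coe_sort C, ← Finset.sum_coe_sort P]
    simp [blockC, hGc]
  rw [cutTransfer, Matrix.mul_assoc, ← hrow,
    Matrix.nonsing_inv_mul_cancel_left _ _ (isUnit_det_smul_one_sub hzP)]

end Cutset

/-! ### Monotonicity of the regularized quadratic form -/

section Comparison

variable {α α' β : Type*} [Fintype α] [Fintype α'] [Fintype β] [DecidableEq β]

/-- Completing the square about the minimizer of `‖Lg‖² + s‖m - g‖²`. The next two lemmas read off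
the minimum value and that it is attained. -/
theorem dotProduct_regGain_add {s : ℝ} (hs : 0 < s) (L : Matrix α β ℝ) (m y : β → ℝ) :
    (L *ᵥ (m - regGain L s *ᵥ m + y)) ⬝ᵥ (L *ᵥ (m - regGain L s *ᵥ m + y)) +
      s * ((regGain L s *ᵥ m - y) ⬝ᵥ (regGain L s *ᵥ m - y)) =
    s * (m ⬝ᵥ (regGain L s *ᵥ m)) + (L *ᵥ y) ⬝ᵥ (L *ᵥ y) + s * (y ⬝ᵥ y) := by
  set q := regGain L s *ᵥ m with hq
  have h := smul_regGain_mulVec hs L m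
  rw [← hq] at h
  have h1 : ∀ v, (L *ᵥ (m - q)) ⬝ᵥ (L *ᵥ v) = s * (q ⬝ᵥ v) := by
    intro v
    rw [← smul_eq_mul, ← smul_dotProduct, h, Matrix.dotProduct_mulVec, Matrix.mulVec_transpose]
  have h2 := h1 (m - q)
  have h3 := h1 y
  simp only [Matrix.mulVec_add, dotProduct_add, add_dotProduct, sub_dotProduct, dotProduct_sub,
    dotProduct_comm (L *ᵥ y), dotProduct_comm y, dotProduct_comm m] at *
  linarith

theorem dotProduct_regGain_le {s : ℝ} (hs : 0 < s) (L : Matrix α β ℝ) (m g : β → ℝ) :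
    s * (m ⬝ᵥ (regGain L s *ᵥ m)) ≤ (L *ᵥ g) ⬝ᵥ (L *ᵥ g) + s * ((m - g) ⬝ᵥ (m - g)) := by
  have h := dotProduct_regGain_add hs L m (g - (m - regGain L s *ᵥ m))
  rw [add_sub_cancel, show regGain L s *ᵥ m - (g - (m - regGain L s *ᵥ m)) = m - g by abel] at h
  rw [h, add_assoc]
  exact le_add_of_nonneg_right (add_nonneg (dotProduct_self_nonneg' _)
    (mul_nonneg hs.le (dotProduct_self_nonneg' _)))

theorem dotProduct_regGain_eq {s : ℝ} (hs : 0 < s) (L : Matrix α β ℝ) (m : β → ℝ) :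
    (L *ᵥ (m - regGain L s *ᵥ m)) ⬝ᵥ (L *ᵥ (m - regGain L s *ᵥ m)) +
      s * ((regGain L s *ᵥ m) ⬝ᵥ (regGain L s *ᵥ m)) = s * (m ⬝ᵥ (regGain L s *ᵥ m)) := by
  simpa using dotProduct_regGain_add hs L m 0

/-- Insert the minimizer for `L'` as a trial vector in the variational problem for `L`. -/
theorem dotProduct_regGain_mono {s : ℝ} (hs : 0 < s) (L : Matrix α β ℝ) (L' : Matrix α' β ℝ)
    (h : ∀ x, (L *ᵥ x) ⬝ᵥ (L *ᵥ x) ≤ (L' *ᵥ x) ⬝ᵥ (L' *ᵥ x)) (m : β → ℝ) :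
    m ⬝ᵥ (regGain L s *ᵥ m) ≤ m ⬝ᵥ (regGain L' s *ᵥ m) := by
  have h1 := dotProduct_regGain_le hs L m (m - regGain L' s *ᵥ m)
  have h2 := dotProduct_regGain_eq hs L' m
  rw [sub_sub_cancel] at h1
  have h3 := h (m - regGain L' s *ᵥ m)
  exact le_of_mul_le_mul_left (by linarith) hs

theorem dotProduct_regGain_strictMono {s : ℝ} (hs : 0 < s) (L : Matrix α β ℝ) (L' : Matrix α' β ℝ)
    {r : ℝ} (hr : 1 < r)
    (h : ∀ x, r * ((L *ᵥ x) ⬝ᵥ (L *ᵥ x)) ≤ (L' *ᵥ x) ⬝ᵥ (L' *ᵥ x)) (m : β → ℝ)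
    (hm : 0 < m ⬝ᵥ (regGain L s *ᵥ m)) :
    m ⬝ᵥ (regGain L s *ᵥ m) < m ⬝ᵥ (regGain L' s *ᵥ m) := by
  set g := m - regGain L' s *ᵥ m with hg
  have h1 := dotProduct_regGain_le hs L m g
  have h2 := dotProduct_regGain_eq hs L' m
  rw [← hg] at h2
  rw [hg, sub_sub_cancel, ← hg] at h1
  have h3 := h g
  have h4 := dotProduct_self_nonneg' (L *ᵥ g)
  refine lt_of_mul_lt_mul_left ?_ hs.le
  -- If `L'g = 0`, the normal equation gives `g = m`, and the trial vector shows that the form of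
  -- `L` vanishes at `m`, against `hm`. Otherwise `r > 1` gives `‖Lg‖² < ‖L'g‖²`.
  rcases (dotProduct_self_nonneg' (L' *ᵥ g)).eq_or_lt with h5 | h5
  · have h6 : L' *ᵥ g = 0 := dotProduct_self_eq_zero.1 h5.symm
    have h7 : regGain L' s *ᵥ m = 0 := by
      have := smul_regGain_mulVec hs L' m
      rw [← hg, h6, Matrix.mulVec_zero] at this
      exact (smul_eq_zero.1 this).resolve_left hs.ne'
    have h8 : (L *ᵥ g) ⬝ᵥ (L *ᵥ g) ≤ 0 := by
      rw [← h5] at h3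
      nlinarith
    have h9 := mul_pos hs hm
    simp only [h7, dotProduct_zero, mul_zero] at h1
    linarith
  · nlinarith

end Comparison

/-! ### Comparison of cutset and partitioned set for the mean shift -/

section MeanShiftComparison

theorem norm_toLp_ofReal_sq {ι : Type*} [Fintype ι] (x : ι → ℝ) :
    ‖WithLp.toLp 2 (Complex.ofReal ∘ x)‖ ^ 2 = x ⬝ᵥ x := by
  rw [EuclideanSpace.norm_sq_eq]
  simp [dotProduct, sq]

theorem map_ofReal_mulVec {α β : Type*} [Fintype β] (A : Matrix α β ℝ) (x : β → ℝ) :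
    A.map Complex.ofReal *ᵥ (Complex.ofReal ∘ x) = Complex.ofReal ∘ (A *ᵥ x) := by
  ext i
  simp [Matrix.mulVec, dotProduct]

variable {V : Type*} [Fintype V] [DecidableEq V]

theorem map_ofReal_transfer_one (G : Matrix V V ℝ) (K J : Finset V)
    (h1 : (1 : ℂ) ∉ spectrum ℂ (G.map Complex.ofReal)) :
    (transfer G K J 1).map Complex.ofReal = transfer (G.map Complex.ofReal) K J 1 := by
  have hu := isUnit_det_smul_one_sub h1
  set M : Matrix V V ℝ := (1 : ℝ) • (1 : Matrix V V ℝ) - G with hM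
  have hMm : M.map Complex.ofReal = (1 : ℂ) • (1 : Matrix V V ℂ) - G.map Complex.ofReal := by
    ext i j
    by_cases hij : i = j <;> simp [hM, hij]
  have hdet : IsUnit M.det := by
    rw [← hMm] at hu
    have : (M.map Complex.ofReal).det = Complex.ofReal M.det :=
      (RingHom.map_det Complex.ofRealHom M).symm
    rw [this] at hu
    exact isUnit_iff_ne_zero.2 fun h0 => by simp [h0] at hu
  have hinv : (M⁻¹).map Complex.ofReal = (M.map Complex.ofReal)⁻¹ := by
    refine (Matrix.inv_eq_right_inv ?_).symm
    have := Matrix.map_mul (L := M) (M := M⁻¹) (f := Complex.ofRealHom)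
    rw [Matrix.mul_nonsing_inv _ hdet] at this
    refine Eq.trans this.symm ?_
    exact Matrix.map_one _ (map_zero _) (map_one _)
  have hin : (inputMatrix ℝ K).map Complex.ofReal = inputMatrix ℂ K := by
    ext i j
    simp [inputMatrix, Matrix.one_apply, apply_ite Complex.ofReal]
  have hse : (sensorMatrix ℝ J).map Complex.ofReal = sensorMatrix ℂ J := by
    ext i j
    simp [sensorMatrix, Matrix.one_apply, apply_ite Complex.ofReal]
  rw [transfer, transfer, ← hM, ← hMm, ← hinv, ← hin, ← hse]
  have e1 := Matrix.map_mul (L := sensorMatrix ℝ J * M⁻¹) (M := inputMatrix ℝ K)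
    (f := Complex.ofRealHom)
  have e2 := Matrix.map_mul (L := sensorMatrix ℝ J) (M := M⁻¹) (f := Complex.ofRealHom)
  rw [e2] at e1
  exact e1

section

variable {E : Digraph V} {G : Matrix V V ℝ} (hG : IsWeightedAdj E G)
  {K S C P : Finset V} {d : ℕ} (hcut : IsNodeCutset E K d S C P)
  (h1 : (1 : ℂ) ∉ spectrum ℂ (G.map Complex.ofReal)) (h1P : (1 : ℂ) ∉ spectrum ℂ (blockC G P P))

include hG hcut h1 h1P

theorem ofReal_transfer_one_mulVec (x : K → ℝ) :
    (Complex.ofReal ∘ (transfer G K P 1 *ᵥ x)) =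
      cutTransfer G C P 1 *ᵥ (Complex.ofReal ∘ (transfer G K C 1 *ᵥ x)) := by
  rw [← map_ofReal_mulVec, ← map_ofReal_mulVec, map_ofReal_transfer_one G K P h1,
    map_ofReal_transfer_one G K C h1, transfer_eq_cutTransfer_mul hG hcut h1 h1P,
    Matrix.mulVec_mulVec]

theorem transfer_one_le_of_rhoMax_le (hr : rhoMax G C P 1 ≤ 1) (x : K → ℝ) :
    (transfer G K P 1 *ᵥ x) ⬝ᵥ (transfer G K P 1 *ᵥ x) ≤
      (transfer G K C 1 *ᵥ x) ⬝ᵥ (transfer G K C 1 *ᵥ x) := by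
  rw [← norm_toLp_ofReal_sq, ← norm_toLp_ofReal_sq, ofReal_transfer_one_mulVec hG hcut h1 h1P]
  refine pow_le_pow_left₀ (norm_nonneg _) ((norm_cutTransfer_mulVec_le _ _ _ _ _).trans ?_) 2
  exact mul_le_of_le_one_left (norm_nonneg _) hr

theorem rhoMin_sq_mul_transfer_one_le (hr : 0 ≤ rhoMin G C P 1) (x : K → ℝ) :
    rhoMin G C P 1 ^ 2 * ((transfer G K C 1 *ᵥ x) ⬝ᵥ (transfer G K C 1 *ᵥ x)) ≤
      (transfer G K P 1 *ᵥ x) ⬝ᵥ (transfer G K P 1 *ᵥ x) := by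
  rw [← norm_toLp_ofReal_sq, ← norm_toLp_ofReal_sq, ofReal_transfer_one_mulVec hG hcut h1 h1P,
    ← mul_pow]
  exact pow_le_pow_left₀ (by positivity) (rhoMin_mul_norm_le _ _ _ _ _) 2

end

/-- The quadratic form `η²` as a function of `√N (μ₂ - μ₁)`. -/
def etaForm (G : Matrix V V ℝ) (K J : Finset V) (σ : ℝ) (Sig : Matrix K K ℝ)
    (u : EuclideanSpace ℝ K) : ℝ :=
  ((matrixSqrt Sig)⁻¹ *ᵥ u.ofLp) ⬝ᵥ
    (regGain (transfer G K J 1 * matrixSqrt Sig) (σ ^ 2) *ᵥ ((matrixSqrt Sig)⁻¹ *ᵥ u.ofLp))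

theorem continuous_etaForm (G : Matrix V V ℝ) (K J : Finset V) (σ : ℝ) (Sig : Matrix K K ℝ) :
    Continuous (etaForm G K J σ Sig) := by
  unfold etaForm
  simp only [Matrix.mulVec, dotProduct]
  fun_prop

theorem etaSq_eq_etaForm (G : Matrix V V ℝ) (K J : Finset V) (σ : ℝ) (N : ℕ)
    (μ₁ μ₂ : EuclideanSpace ℝ K) (Sig : Matrix K K ℝ) :
    etaSq G K J σ N μ₁ μ₂ Sig = etaForm G K J σ Sig (√(N : ℝ) • (μ₂ - μ₁)) := by
  rw [etaForm, WithLp.ofLp_smul, Matrix.mulVec_smul, Matrix.mulVec_smul, dotProduct_smul,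
    smul_dotProduct, smul_eq_mul, smul_eq_mul, ← mul_assoc, Real.mul_self_sqrt (Nat.cast_nonneg N)]
  rfl

theorem asympMeanError_eq (G : Matrix V V ℝ) (K J : Finset V) (σ : ℝ) (N : ℕ)
    (μ₁ μ₂ : EuclideanSpace ℝ K) (Sig : Matrix K K ℝ) :
    asympMeanError G K J σ N μ₁ μ₂ Sig =
      gaussianTail (1 / 2 * √(etaForm G K J σ Sig (√(N : ℝ) • (μ₂ - μ₁)))) := by
  rw [asympMeanError, etaSq_eq_etaForm]

theorem gaussianTail_half_sqrt_anti {x y : ℝ} (h : x ≤ y) :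
    gaussianTail (1 / 2 * √y) ≤ gaussianTail (1 / 2 * √x) :=
  gaussianTail_strictAnti.antitone
    (mul_le_mul_of_nonneg_left (Real.sqrt_le_sqrt h) (by norm_num))

/-- An error below 1/2 means a positive SNR, which is exactly what the strict comparison of the
forms needs. -/
theorem gaussianTail_half_sqrt_lt {x y : ℝ} (h : 0 < x → x < y)
    (hx : gaussianTail (1 / 2 * √x) < 1 / 2) :
    gaussianTail (1 / 2 * √y) < gaussianTail (1 / 2 * √x) := by
  have hx0 : 0 < x := by
    by_contra! h0
    rw [Real.sqrt_eq_zero_of_nonpos h0, mul_zero, gaussianTail_zero] at hx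
    exact lt_irrefl _ hx
  exact gaussianTail_strictAnti
    (mul_lt_mul_of_pos_left (Real.sqrt_lt_sqrt hx0.le (h hx0)) (by norm_num))

/-- Along a subsequence, two sequences of error probabilities converge to the values of their
asymptotic expressions at a common point. -/
theorem exists_common_limit {E : Type*} [NormedAddCommGroup E] [NormedSpace ℝ E]
    [FiniteDimensional ℝ E] {δ : ℕ → E} {c : ℝ}
    (hc : Tendsto (fun N : ℕ => (N : ℝ) * ‖δ N‖ ^ 2) atTop (𝓝 c)) {f g : E → ℝ}
    (hf : Continuous f) (hg : Continuous g) {a b : ℕ → ℝ}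
    (ha : Tendsto (fun N : ℕ => a N - f (√(N : ℝ) • δ N)) atTop (𝓝 0))
    (hb : Tendsto (fun N : ℕ => b N - g (√(N : ℝ) • δ N)) atTop (𝓝 0)) {p q : ℝ}
    (hp : Tendsto a atTop (𝓝 p)) (hq : Tendsto b atTop (𝓝 q)) : ∃ u, f u = p ∧ g u = q := by
  have hnorm : ∀ N : ℕ, ‖√(N : ℝ) • δ N‖ = √((N : ℝ) * ‖δ N‖ ^ 2) := by
    intro N
    rw [norm_smul, Real.sqrt_mul (Nat.cast_nonneg N), Real.sqrt_sq (norm_nonneg _),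
      Real.norm_of_nonneg (Real.sqrt_nonneg _)]
  obtain ⟨B, hB⟩ := hc.bddAbove_range
  have hbdd : ∀ N : ℕ, √(N : ℝ) • δ N ∈ Metric.closedBall (0 : E) (√B) := by
    intro N
    rw [mem_closedBall_zero_iff, hnorm]
    exact Real.sqrt_le_sqrt (hB ⟨N, rfl⟩)
  have := FiniteDimensional.proper ℝ E
  -- The vectors `√N δ_N` are bounded but need not converge. Both error sequences do converge, so a
  -- single cluster point determines both limits.
  obtain ⟨u, -, φ, hφ, hu⟩ := tendsto_subseq_of_bounded Metric.isBounded_closedBall hbdd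
  refine ⟨u, ?_, ?_⟩
  · have h1 := (hf.tendsto u).comp hu
    have h2 := (hp.sub ha).comp hφ.tendsto_atTop
    simp only [sub_sub_cancel, sub_zero] at h2
    exact tendsto_nhds_unique h1 h2
  · have h1 := (hg.tendsto u).comp hu
    have h2 := (hq.sub hb).comp hφ.tendsto_atTop
    simp only [sub_sub_cancel, sub_zero] at h2
    exact tendsto_nhds_unique h1 h2

end MeanShiftComparison

/-! ### Impulse response and symbol on the unit circle -/

section Symbol

open scoped Matrix.Norms.L2Operator

/-- Gelfand's formula bounds `‖A ^ i‖` by a geometric sequence with ratio between the spectral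
radius and 1. -/
theorem summable_norm_pow_of_spectrum {n : Type*} [Fintype n] [DecidableEq n] [Nonempty n]
    (A : Matrix n n ℂ) (h : ∀ z ∈ spectrum ℂ A, ‖z‖ < 1) : Summable fun i => ‖A ^ i‖ := by
  have hr : spectralRadius ℂ A < (1 : ℝ≥0) :=
    spectrum.spectralRadius_lt_of_forall_lt_of_nonempty (spectrum.nonempty A)
      fun z hz => by exact_mod_cast h z hz
  obtain ⟨r, hr0, hr1⟩ := ENNReal.lt_iff_exists_nnreal_btwn.1 hr
  have hev := (spectrum.pow_norm_pow_one_div_tendsto_nhds_spectralRadius A).eventually_lt_const hr0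
  refine Summable.of_norm_bounded_eventually_nat (g := fun i => (r : ℝ) ^ i)
    (summable_geometric_of_lt_one r.2 (by exact_mod_cast hr1)) ?_
  filter_upwards [hev, eventually_gt_atTop 0] with i hi hi0
  rw [ENNReal.ofReal_lt_coe_iff (by positivity)] at hi
  rw [norm_norm]
  calc ‖A ^ i‖ = (‖A ^ i‖ ^ (1 / i : ℝ)) ^ i := by
        rw [one_div, Real.rpow_inv_natCast_pow (norm_nonneg _) hi0.ne']
    _ ≤ (r : ℝ) ^ i := pow_le_pow_left₀ (by positivity) hi.le i

theorem hasSum_resolvent {n : Type*} [Fintype n] [DecidableEq n] {A : Matrix n n ℂ}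
    (hA : Summable fun i => ‖A ^ i‖) {z : ℂ} (hz : ‖z‖ = 1) :
    HasSum (fun i => z ^ i • A ^ i) (z⁻¹ • (z⁻¹ • (1 : Matrix n n ℂ) - A)⁻¹) := by
  have hz0 : z ≠ 0 := norm_ne_zero_iff.1 (by simp [hz])
  have hs : Summable fun i => (z • A) ^ i := by
    refine Summable.of_norm (hA.congr fun i => ?_)
    rw [smul_pow, norm_smul, norm_pow z, hz, one_pow, one_mul]
  have h1 := hs.one_sub_mul_tsum_pow
  have h2 := hs.hasSum
  have h3 : (z⁻¹ • (1 : Matrix n n ℂ) - A)⁻¹ = z • ∑' i, (z • A) ^ i := by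
    refine Matrix.inv_eq_right_inv ?_
    rw [show z⁻¹ • (1 : Matrix n n ℂ) - A = z⁻¹ • (1 - z • A) by
      rw [smul_sub, smul_smul, inv_mul_cancel₀ hz0, one_smul], Matrix.smul_mul, Matrix.mul_smul,
      smul_smul, inv_mul_cancel₀ hz0, one_smul, h1]
  rw [h3, smul_smul, inv_mul_cancel₀ hz0, one_smul]
  simpa only [smul_pow] using h2

variable {V : Type*} [Fintype V] [DecidableEq V]

theorem map_ofReal_impulse_mul (G : Matrix V V ℝ) (K J : Finset V) (Q : Matrix K K ℝ) (i : ℕ) :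
    (impulse G K J i * Q).map Complex.ofReal = sensorMatrix ℂ J * (G.map Complex.ofReal) ^ i *
      (inputMatrix ℂ K * Q.map Complex.ofReal) := by
  have hin : (inputMatrix ℝ K).map Complex.ofRealHom = inputMatrix ℂ K := by
    ext i j
    simp [inputMatrix, Matrix.one_apply]
  have hse : (sensorMatrix ℝ J).map Complex.ofRealHom = sensorMatrix ℂ J := by
    ext i j
    simp [sensorMatrix, Matrix.one_apply]
  have hpow : (G ^ i).map Complex.ofRealHom = (G.map Complex.ofRealHom) ^ i :=
    map_pow (RingHom.mapMatrix Complex.ofRealHom) G i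
  change (impulse G K J i * Q).map Complex.ofRealHom = sensorMatrix ℂ J *
    (G.map Complex.ofRealHom) ^ i * (inputMatrix ℂ K * Q.map Complex.ofRealHom)
  rw [impulse, Matrix.map_mul, Matrix.map_mul, Matrix.map_mul, hin, hse, hpow, Matrix.mul_assoc]

theorem summable_norm_impulse {G : Matrix V V ℝ}
    (hG : Summable fun i => ‖(G.map Complex.ofReal) ^ i‖) (K J : Finset V) (Q : Matrix K K ℝ) :
    Summable fun i => ‖(impulse G K J i * Q).map Complex.ofReal‖ := by
  refine Summable.of_nonneg_of_le (fun i => norm_nonneg _) (fun i => ?_)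
    ((hG.mul_left ‖sensorMatrix ℂ J‖).mul_right ‖inputMatrix ℂ K * Q.map Complex.ofReal‖)
  rw [map_ofReal_impulse_mul]
  exact (Matrix.l2_opNorm_mul _ _).trans
    (mul_le_mul_of_nonneg_right (Matrix.l2_opNorm_mul _ _) (norm_nonneg _))

/-- The symbol at `z` is the transfer matrix at `z⁻¹`, up to the factor `z⁻¹` that accounts for the
unit delay. The factor is unimodular, so norms are unaffected. -/
theorem hasSum_impulse {G : Matrix V V ℝ}
    (hG : Summable fun i => ‖(G.map Complex.ofReal) ^ i‖) (K J : Finset V) (Q : Matrix K K ℝ)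
    {z : ℂ} (hz : ‖z‖ = 1) :
    HasSum (fun i => z ^ i • (impulse G K J i * Q).map Complex.ofReal)
      (z⁻¹ • (transfer (G.map Complex.ofReal) K J z⁻¹ * Q.map Complex.ofReal)) := by
  have h := hasSum_resolvent hG hz
  have h2 := h.map (AddMonoidHom.mk' (fun X : Matrix V V ℂ =>
    sensorMatrix ℂ J * X * (inputMatrix ℂ K * Q.map Complex.ofReal)) fun X Y => by
      rw [Matrix.mul_add, Matrix.add_mul]) (by
      change Continuous fun X : Matrix V V ℂ =>
        sensorMatrix ℂ J * X * (inputMatrix ℂ K * Q.map Complex.ofReal)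
      fun_prop)
  convert h2 using 1
  · ext1 i
    simp [map_ofReal_impulse_mul]
  · simp [transfer, Matrix.mul_assoc]

end Symbol

/-! ### Upper bound: Toeplitz norm by the supremum of the symbol -/

section ToeplitzNorm

open scoped ComplexConjugate

theorem sum_conj_pow_mul_pow {M : ℕ} {ζ : ℂ} (hζ : IsPrimitiveRoot ζ M) {t a : ℕ} (ht : t < M)
    (ha : a < M) :
    ∑ j ∈ Finset.range M, conj ((ζ ^ j) ^ t) * (ζ ^ j) ^ a = if a = t then (M : ℂ) else 0 := by
  have hM : M ≠ 0 := by omega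
  have hn : ‖ζ‖ = 1 := hζ.norm'_eq_one hM
  have hc : ζ * conj ζ = 1 := by rw [Complex.mul_conj']; simp [hn]
  have h1 : ∀ j, conj ((ζ ^ j) ^ t) * (ζ ^ j) ^ a = (conj (ζ ^ t) * ζ ^ a) ^ j := by
    intro j
    simp only [map_pow, mul_pow, ← pow_mul, mul_comm j]
  simp_rw [h1]
  have hct : ζ ^ t * conj (ζ ^ t) = 1 := by rw [map_pow, ← mul_pow, hc, one_pow]
  split_ifs with h
  · subst h
    rw [mul_comm, hct]
    simp
  · have hw : conj (ζ ^ t) * ζ ^ a ≠ 1 := by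
      intro hw
      apply h
      apply hζ.pow_inj ha ht
      calc ζ ^ a = ζ ^ t * conj (ζ ^ t) * ζ ^ a := by rw [hct, one_mul]
        _ = ζ ^ t := by rw [mul_assoc, hw, mul_one]
    rw [geom_sum_eq hw]
    have : (conj (ζ ^ t) * ζ ^ a) ^ M = 1 := by
      rw [mul_pow, map_pow, ← pow_mul, ← pow_mul, mul_comm t, mul_comm a, pow_mul, pow_mul,
        hζ.pow_eq_one, ← map_pow, hζ.pow_eq_one]
      simp
    rw [this, sub_self, zero_div]

/-- Averaging over the `M`-th roots of unity extracts the terms with `i + k = t`. Since `i + k < n +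
N ≤ M`, the cyclic convolution does not wrap around and coincides with the Toeplitz form. -/
theorem sum_roots_mul_symbol {M N n : ℕ} {ζ : ℂ} (hζ : IsPrimitiveRoot ζ M) (hM : N + n ≤ M)
    (b x : Fin N → ℂ) (h : ℕ → ℂ) (hn : ∀ i, n ≤ i → i < N → h i = 0) :
    ∑ j ∈ Finset.range M, conj (∑ t : Fin N, (ζ ^ j) ^ (t : ℕ) * conj (b t)) *
      ((∑ i ∈ Finset.range n, (ζ ^ j) ^ i * h i) * ∑ k : Fin N, (ζ ^ j) ^ (k : ℕ) * x k) =
    M * ∑ t, ∑ k, if k ≤ t then b t * (h (t - k) * x k) else 0 := by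
  have key : ∀ t k : Fin N, ∑ i ∈ Finset.range n, ∑ j ∈ Finset.range M,
      (conj ((ζ ^ j) ^ (t : ℕ)) * (ζ ^ j) ^ (i + k)) * (b t * (h i * x k)) =
      M * if k ≤ t then b t * (h (t - k) * x k) else 0 := by
    intro t k
    have : ∀ i ∈ Finset.range n, ∑ j ∈ Finset.range M,
        (conj ((ζ ^ j) ^ (t : ℕ)) * (ζ ^ j) ^ (i + k)) * (b t * (h i * x k)) =
        if i + k = t then M * (b t * (h i * x k)) else 0 := by
      intro i hi
      have := Finset.mem_range.1 hi
      rw [← Finset.sum_mul, sum_conj_pow_mul_pow hζ (by omega) (by omega), ite_mul, zero_mul]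
    rw [Finset.sum_congr rfl this]
    split_ifs with hkt
    · have hkt' : (k : ℕ) ≤ t := hkt
      rw [Finset.sum_eq_single (t - k : ℕ)]
      · rw [if_pos (by omega)]
      · intro i _ hi
        rw [if_neg (by omega)]
      · intro hi
        rw [hn _ (by simpa using hi) (by omega)]
        simp
    · rw [mul_zero]
      refine Finset.sum_eq_zero fun i _ => if_neg fun hi => hkt ?_
      rw [Fin.le_def]
      omega
  rw [Finset.mul_sum]
  simp_rw [Finset.mul_sum (a := (M : ℂ)), ← key, map_sum, Finset.sum_mul, Finset.mul_sum]
  rw [Finset.sum_comm]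
  refine Finset.sum_congr rfl fun t _ => ?_
  rw [Finset.sum_comm]
  simp_rw [Finset.sum_comm (s := Finset.range M)]
  rw [Finset.sum_comm]
  refine Finset.sum_congr rfl fun k _ => Finset.sum_congr rfl fun i _ =>
    Finset.sum_congr rfl fun j _ => ?_
  rw [map_mul, Complex.conj_conj, pow_add]
  ring

open scoped Matrix.Norms.L2Operator

variable {α β : Type*} [Fintype α] [Fintype β]

/-- The discrete Fourier transform of a sequence of blocks, at a point `ω` of the unit circle. -/
def blockDFT {α : Type*} {N : ℕ} (ω : ℂ) (x : Fin N × α → ℝ) : EuclideanSpace ℂ α :=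
  WithLp.toLp 2 fun a => ∑ t : Fin N, ω ^ (t : ℕ) * (x (t, a) : ℂ)

/-- The truncated symbol of a Toeplitz matrix. -/
def symbolSum {α β : Type*} (h : ℕ → Matrix α β ℝ) (n : ℕ) (ω : ℂ) : Matrix α β ℂ :=
  ∑ i ∈ Finset.range n, ω ^ i • (h i).map Complex.ofReal

theorem sum_inner_symbolSum {M N n : ℕ} {ζ : ℂ} (hζ : IsPrimitiveRoot ζ M) (hM : N + n ≤ M)
    (h : ℕ → Matrix α β ℝ) (hn : ∀ i, n ≤ i → i < N → h i = 0) (b : Fin N × α → ℝ)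
    (x : Fin N × β → ℝ) :
    ∑ j ∈ Finset.range M, inner ℂ (blockDFT (ζ ^ j) b)
      (WithLp.toLp 2 (symbolSum h n (ζ ^ j) *ᵥ (blockDFT (ζ ^ j) x).ofLp)) =
    M * ((b ⬝ᵥ (toep h N *ᵥ x) : ℝ) : ℂ) := by
  have h1 : ∀ j, inner ℂ (blockDFT (ζ ^ j) b)
      (WithLp.toLp 2 (symbolSum h n (ζ ^ j) *ᵥ (blockDFT (ζ ^ j) x).ofLp)) =
      ∑ a, ∑ c, conj (∑ t : Fin N, (ζ ^ j) ^ (t : ℕ) * conj (b (t, a) : ℂ)) *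
        ((∑ i ∈ Finset.range n, (ζ ^ j) ^ i * (h i a c : ℂ)) *
          ∑ k : Fin N, (ζ ^ j) ^ (k : ℕ) * (x (k, c) : ℂ)) := by
    intro j
    simp only [PiLp.inner_apply, RCLike.inner_apply, Matrix.mulVec, dotProduct, Finset.sum_mul]
    refine Finset.sum_congr rfl fun a _ => Finset.sum_congr rfl fun c _ => ?_
    simp only [blockDFT, symbolSum, Matrix.sum_apply, Matrix.smul_apply, Matrix.map_apply,
      smul_eq_mul, Complex.conj_ofReal, ← Finset.sum_mul]
    ring
  simp_rw [h1]
  rw [Finset.sum_comm]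
  simp_rw [Finset.sum_comm (s := Finset.range M)]
  have h2 := fun a c => sum_roots_mul_symbol hζ hM (fun t => (b (t, a) : ℂ))
    (fun k => (x (k, c) : ℂ)) (fun i => (h i a c : ℂ)) fun i hi hi' => by simp [hn i hi hi']
  simp_rw [h2, ← Finset.mul_sum]
  congr 1
  simp only [dotProduct, toep, Matrix.mulVec, Fintype.sum_prod_type, Complex.ofReal_sum,
    Complex.ofReal_mul, Finset.mul_sum, apply_ite Complex.ofReal, Complex.ofReal_zero, ite_mul,
    zero_mul, mul_ite, mul_zero]
  simp_rw [Finset.sum_comm (s := (Finset.univ : Finset β))]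
  rw [Finset.sum_comm]

/-- Parseval's identity, as the case of the symbol 1, whose Toeplitz matrix is the identity. -/
theorem sum_norm_blockDFT_sq [DecidableEq α] {M N : ℕ} {ζ : ℂ} (hζ : IsPrimitiveRoot ζ M) (hM : N + 1 ≤ M)
    (x : Fin N × α → ℝ) :
    ∑ j ∈ Finset.range M, ‖blockDFT (ζ ^ j) x‖ ^ 2 = M * (x ⬝ᵥ x) := by
  set h : ℕ → Matrix α α ℝ := fun i => if i = 0 then 1 else 0 with hh
  have h1 := sum_inner_symbolSum hζ hM h (fun i hi _ => if_neg (by omega)) x x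
  have h2 : toep h N = 1 := by
    ext ⟨t, a⟩ ⟨k, c⟩
    simp only [toep, hh, Matrix.one_apply, Prod.mk.injEq]
    by_cases hkt : k = t
    · subst hkt
      simp [Matrix.one_apply]
    · by_cases hle : k ≤ t
      · have : (t : ℕ) - k ≠ 0 := by
          have : (k : ℕ) ≠ t := fun h => hkt (Fin.ext h)
          have : (k : ℕ) ≤ t := hle
          omega
        simp [hle, this, Ne.symm hkt]
      · simp [hle, Ne.symm hkt]
  have h3 : ∀ ω, symbolSum h 1 ω = 1 := by
    intro ω
    simp [symbolSum, hh]
  simp_rw [h3, Matrix.one_mulVec, h2] at h1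
  rw [Matrix.one_mulVec] at h1
  have h4 : ∀ v : EuclideanSpace ℂ α, inner ℂ v (WithLp.toLp 2 v.ofLp) = ((‖v‖ ^ 2 : ℝ) : ℂ) := by
    intro v
    rw [WithLp.toLp_ofLp, inner_self_eq_norm_sq_to_K]
    simp
  simp_rw [h4] at h1
  exact_mod_cast h1

/-- Since `N < n`, truncating the symbol leaves the `N`-block matrix unchanged. Cauchy–Schwarz is
applied at each root of unity and then across the roots. -/
theorem dotProduct_toep_le [DecidableEq α] [DecidableEq β] {N n : ℕ} (hNn : N < n) (h : ℕ → Matrix α β ℝ) {H : ℝ}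
    (hH : ∀ ω : ℂ, ‖ω‖ = 1 → ‖symbolSum h n ω‖ ≤ H) (b : Fin N × α → ℝ) (x : Fin N × β → ℝ) :
    b ⬝ᵥ (toep h N *ᵥ x) ≤ H * (√(b ⬝ᵥ b) * √(x ⬝ᵥ x)) := by
  have hM0 : N + n ≠ 0 := by omega
  have hMp : 0 < ((N + n : ℕ) : ℝ) := by positivity
  set ζ := Complex.exp (2 * Real.pi * Complex.I / ((N + n : ℕ) : ℂ)) with hζd
  have hζ : IsPrimitiveRoot ζ (N + n) := Complex.isPrimitiveRoot_exp _ hM0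
  have hζn : ‖ζ‖ = 1 := hζ.norm'_eq_one hM0
  have hH0 : 0 ≤ H := (norm_nonneg _).trans (hH 1 (by simp))
  have h1 := sum_inner_symbolSum hζ le_rfl h (fun i hi hi' => by omega) b x
  have h2 := sum_norm_blockDFT_sq hζ (by omega : N + 1 ≤ N + n) b
  have h3 := sum_norm_blockDFT_sq hζ (by omega : N + 1 ≤ N + n) x
  have h4 : ∀ j, ‖inner ℂ (blockDFT (ζ ^ j) b)
      (WithLp.toLp 2 (symbolSum h n (ζ ^ j) *ᵥ (blockDFT (ζ ^ j) x).ofLp))‖ ≤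
      H * (‖blockDFT (ζ ^ j) b‖ * ‖blockDFT (ζ ^ j) x‖) := by
    intro j
    refine (norm_inner_le_norm _ _).trans ?_
    have h5 : ‖WithLp.toLp 2 (symbolSum h n (ζ ^ j) *ᵥ (blockDFT (ζ ^ j) x).ofLp)‖ ≤
        H * ‖blockDFT (ζ ^ j) x‖ :=
      (Matrix.l2_opNorm_mulVec _ (blockDFT (ζ ^ j) x)).trans
        (mul_le_mul_of_nonneg_right (hH _ (by simp [hζn])) (norm_nonneg _))
    refine (mul_le_mul_of_nonneg_left h5 (norm_nonneg _)).trans (le_of_eq (by ring))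
  have h6 : ‖((N + n : ℕ) : ℂ) * ((b ⬝ᵥ (toep h N *ᵥ x) : ℝ) : ℂ)‖ ≤
      H * (√(((N + n : ℕ) : ℝ) * (b ⬝ᵥ b)) * √(((N + n : ℕ) : ℝ) * (x ⬝ᵥ x))) := by
    rw [← h1]
    refine (norm_sum_le _ _).trans ((Finset.sum_le_sum fun j _ => h4 j).trans ?_)
    rw [← Finset.mul_sum]
    refine mul_le_mul_of_nonneg_left ?_ hH0
    rw [← h2, ← h3]
    exact Real.sum_mul_le_sqrt_mul_sqrt _ _ _
  rw [Real.sqrt_mul hMp.le, Real.sqrt_mul hMp.le, norm_mul, Complex.norm_natCast,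
    Complex.norm_real, Real.norm_eq_abs] at h6
  have h7 : ((N + n : ℕ) : ℝ) * |b ⬝ᵥ (toep h N *ᵥ x)| ≤
      ((N + n : ℕ) : ℝ) * (H * (√(b ⬝ᵥ b) * √(x ⬝ᵥ x))) := by
    refine h6.trans (le_of_eq ?_)
    calc _ = (√((N + n : ℕ) : ℝ) * √((N + n : ℕ) : ℝ)) * (H * (√(b ⬝ᵥ b) * √(x ⬝ᵥ x))) := by ring
      _ = _ := by rw [Real.mul_self_sqrt hMp.le]
  exact (le_abs_self _).trans (le_of_mul_le_mul_left h7 hMp)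

theorem norm_symbolSum_le [DecidableEq β] {h : ℕ → Matrix α β ℝ}
    (hs : Summable fun i => ‖(h i).map Complex.ofReal‖) {ω : ℂ} (hω : ‖ω‖ = 1) {S : Matrix α β ℂ}
    (hS : HasSum (fun i => ω ^ i • (h i).map Complex.ofReal) S) (n : ℕ) :
    ‖symbolSum h n ω‖ ≤ ‖S‖ + ∑' i, ‖(h (i + n)).map Complex.ofReal‖ := by
  have hterm : ∀ i, ‖ω ^ i • (h i).map Complex.ofReal‖ = ‖(h i).map Complex.ofReal‖ := by
    intro i
    rw [norm_smul, norm_pow ω, hω, one_pow, one_mul]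
  have hs' : Summable fun i => ‖ω ^ i • (h i).map Complex.ofReal‖ := by simpa only [hterm] using hs
  have h1 := hS.summable.sum_add_tsum_nat_add n
  rw [hS.tsum_eq] at h1
  have h2 : ‖∑' i, ω ^ (i + n) • (h (i + n)).map Complex.ofReal‖ ≤
      ∑' i, ‖(h (i + n)).map Complex.ofReal‖ := by
    refine (norm_tsum_le_tsum_norm ?_).trans (le_of_eq (tsum_congr fun i => hterm _))
    exact (summable_nat_add_iff n).2 hs'
  rw [symbolSum, eq_sub_of_add_eq h1]
  exact (norm_sub_le _ _).trans (by linarith)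

/-- The spectral norm of a Toeplitz matrix is bounded by the supremum of its symbol. -/
theorem toep_transpose_energy_le [DecidableEq α] [DecidableEq β] {h : ℕ → Matrix α β ℝ}
    (hs : Summable fun i => ‖(h i).map Complex.ofReal‖) {S : ℂ → Matrix α β ℂ}
    (hS : ∀ ω, ‖ω‖ = 1 → HasSum (fun i => ω ^ i • (h i).map Complex.ofReal) (S ω)) {H : ℝ}
    (hH : ∀ ω, ‖ω‖ = 1 → ‖S ω‖ ≤ H) (N : ℕ) (b : Fin N × α → ℝ) :
    ((toep h N)ᵀ *ᵥ b) ⬝ᵥ ((toep h N)ᵀ *ᵥ b) ≤ H ^ 2 * (b ⬝ᵥ b) := by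
  set x := (toep h N)ᵀ *ᵥ b with hx
  have hH0 : 0 ≤ H := (norm_nonneg _).trans (hH 1 (by simp))
  have h1 : b ⬝ᵥ (toep h N *ᵥ x) = x ⬝ᵥ x := by
    rw [Matrix.dotProduct_mulVec, ← Matrix.mulVec_transpose]
  have h2 : x ⬝ᵥ x ≤ H * (√(b ⬝ᵥ b) * √(x ⬝ᵥ x)) := by
    refine h1.ge.trans ?_
    -- The truncation order is free beyond `N`; letting it grow removes the excess of the truncated
    -- symbol over `H`.
    have htail := tendsto_sum_nat_add fun i => ‖(h i).map Complex.ofReal‖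
    have hlim := (htail.const_add H).mul_const (√(b ⬝ᵥ b) * √(x ⬝ᵥ x))
    rw [add_zero] at hlim
    refine ge_of_tendsto hlim ?_
    filter_upwards [eventually_gt_atTop N] with n hn
    exact dotProduct_toep_le hn h (fun ω hω => (norm_symbolSum_le hs hω (hS ω hω) n).trans
      (add_le_add_left (hH ω hω) _)) b x
  have hb := Real.sq_sqrt (dotProduct_self_nonneg' b)
  have hxx := Real.sq_sqrt (dotProduct_self_nonneg' x)
  rcases (Real.sqrt_nonneg (x ⬝ᵥ x)).eq_or_lt with h0 | h0
  · rw [← hxx, ← h0, zero_pow two_ne_zero]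
    exact mul_nonneg (sq_nonneg H) (dotProduct_self_nonneg' b)
  · have h3 : √(x ⬝ᵥ x) ≤ H * √(b ⬝ᵥ b) := by
      refine le_of_mul_le_mul_right ?_ h0
      rw [← sq, hxx]
      linarith
    rw [← hxx, ← hb, ← mul_pow]
    exact pow_le_pow_left₀ h0.le h3 2

end ToeplitzNorm

/-! ### Lower bound by harmonic sequences, and the limit of the Rayleigh quotients -/

section ToeplitzLimit

open scoped ComplexConjugate Matrix.Norms.L2Operator

variable {α β : Type*} [Fintype α] [Fintype β]

theorem exists_norm_conjTranspose_mulVec_gt [DecidableEq α] [DecidableEq β] {S : Matrix α β ℂ} {a : ℝ} (ha : 0 ≤ a)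
    (h : a < ‖S‖ ^ 2) :
    ∃ u : EuclideanSpace ℂ α, a * ‖u‖ ^ 2 < ‖WithLp.toLp 2 (Sᴴ *ᵥ u.ofLp)‖ ^ 2 := by
  by_contra! hle
  have h1 : ‖Sᴴ‖ ≤ √a := by
    rw [Matrix.l2_opNorm_def]
    refine ContinuousLinearMap.opNorm_le_bound _ (Real.sqrt_nonneg a) fun u => ?_
    refine le_of_pow_le_pow_left₀ two_ne_zero (by positivity) ?_
    rw [mul_pow, Real.sq_sqrt ha]
    exact hle u
  rw [Matrix.l2_opNorm_conjTranspose] at h1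
  have h2 := pow_le_pow_left₀ (norm_nonneg S) h1 2
  rw [Real.sq_sqrt ha] at h2
  linarith

/-- The energy of the adjoint Toeplitz matrix applied to the harmonic sequence `conj ω ^ t • u`. -/
theorem toep_transpose_harmonic_energy (h : ℕ → Matrix α β ℝ) {ω : ℂ} (hω : ‖ω‖ = 1)
    (u : EuclideanSpace ℂ α) (N : ℕ) (br bi : Fin N × α → ℝ)
    (hbr : br = fun p => (conj ω ^ (p.1 : ℕ) * u p.2).re)
    (hbi : bi = fun p => (conj ω ^ (p.1 : ℕ) * u p.2).im) :
    ((toep h N)ᵀ *ᵥ br) ⬝ᵥ ((toep h N)ᵀ *ᵥ br) + ((toep h N)ᵀ *ᵥ bi) ⬝ᵥ ((toep h N)ᵀ *ᵥ bi) =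
      ∑ n ∈ Finset.range N, ‖WithLp.toLp 2 ((symbolSum h (n + 1) ω)ᴴ *ᵥ u.ofLp)‖ ^ 2 := by
  set y : Fin N × β → ℂ := fun p =>
    ∑ q, (toep h N q p : ℂ) * (conj ω ^ (q.1 : ℕ) * u q.2) with hy
  have hre : ∀ p, ((toep h N)ᵀ *ᵥ br) p = (y p).re := by
    intro p
    simp [hy, hbr, Matrix.mulVec, dotProduct]
  have him : ∀ p, ((toep h N)ᵀ *ᵥ bi) p = (y p).im := by
    intro p
    simp [hy, hbi, Matrix.mulVec, dotProduct]
  -- Block `k` sees only the `N - k` terms before the end of the window: up to a phase it is a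
  -- truncated symbol applied to `u`.
  have hyp : ∀ p : Fin N × β, y p = conj ω ^ (p.1 : ℕ) *
      ((symbolSum h (N - p.1) ω)ᴴ *ᵥ u.ofLp) p.2 := by
    rintro ⟨k, c⟩
    have e1 : ((symbolSum h (N - k) ω)ᴴ *ᵥ u.ofLp) c =
        ∑ i ∈ Finset.range (N - k), ∑ a, conj ω ^ i * (h i a c : ℂ) * u a := by
      simp only [Matrix.mulVec, dotProduct, symbolSum, Matrix.conjTranspose_apply,
        Matrix.sum_apply, Matrix.smul_apply, Matrix.map_apply, star_sum, smul_eq_mul, star_mul',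
        star_pow, Finset.sum_mul]
      rw [Finset.sum_comm]
      simp
    rw [e1, ← sum_fin_ite_ge k fun i => ∑ a, conj ω ^ i * (h i a c : ℂ) * u a, Finset.mul_sum, hy]
    simp only [toep, Fintype.sum_prod_type]
    refine Finset.sum_congr rfl fun t _ => ?_
    split_ifs with hkt
    · rw [Finset.mul_sum]
      refine Finset.sum_congr rfl fun a _ => ?_
      have : (t : ℕ) = k + (t - k) := by
        have : (k : ℕ) ≤ t := hkt
        omega
      conv_lhs => rw [this, pow_add]
      rw [← this]
      ring
    · simp
  calc _ = ∑ p, ‖y p‖ ^ 2 := by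
        simp only [dotProduct, hre, him, ← Finset.sum_add_distrib, Complex.sq_norm,
          Complex.normSq_apply]
    _ = ∑ k : Fin N, ‖WithLp.toLp 2 ((symbolSum h (N - k) ω)ᴴ *ᵥ u.ofLp)‖ ^ 2 := by
        rw [Fintype.sum_prod_type]
        refine Finset.sum_congr rfl fun k _ => ?_
        rw [EuclideanSpace.norm_sq_eq]
        refine Finset.sum_congr rfl fun c _ => ?_
        rw [hyp, norm_mul, norm_pow, RCLike.norm_conj, hω, one_pow, one_mul]
    _ = _ := by
        rw [Finset.sum_range, ← Equiv.sum_comp Fin.revPerm]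
        refine Finset.sum_congr rfl fun k _ => ?_
        have : N - (Fin.revPerm k : ℕ) = k + 1 := by
          rw [Fin.revPerm_apply, Fin.val_rev]
          omega
        rw [this]

/-- The energy per block of the harmonic sequence is a Cesàro mean that tends to `‖Sᴴu‖²`. Energies
and norms add over real and imaginary parts, so one of these two real sequences exceeds the level
`a`. -/
theorem eventually_exists_energy_gt [DecidableEq α] [DecidableEq β] {h : ℕ → Matrix α β ℝ} {ω : ℂ} (hω : ‖ω‖ = 1)
    {S : Matrix α β ℂ} (hS : HasSum (fun i => ω ^ i • (h i).map Complex.ofReal) S) {a : ℝ}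
    (ha : 0 ≤ a) (haS : a < ‖S‖ ^ 2) :
    ∀ᶠ N in atTop, ∃ b : Fin N × α → ℝ,
      a * (b ⬝ᵥ b) < ((toep h N)ᵀ *ᵥ b) ⬝ᵥ ((toep h N)ᵀ *ᵥ b) := by
  obtain ⟨u, hu⟩ := exists_norm_conjTranspose_mulVec_gt ha haS
  have hcont : Continuous fun B : Matrix α β ℂ => ‖WithLp.toLp 2 (Bᴴ *ᵥ u.ofLp)‖ ^ 2 := by
    fun_prop
  have hlim : Tendsto (fun n => ‖WithLp.toLp 2 ((symbolSum h (n + 1) ω)ᴴ *ᵥ u.ofLp)‖ ^ 2) atTop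
      (𝓝 (‖WithLp.toLp 2 (Sᴴ *ᵥ u.ofLp)‖ ^ 2)) :=
    (hcont.tendsto S).comp (hS.tendsto_sum_nat.comp (tendsto_add_atTop_nat 1))
  filter_upwards [hlim.cesaro.eventually_const_lt hu, eventually_gt_atTop 0] with N hN hN0
  have hN0' : (0 : ℝ) < N := by exact_mod_cast hN0
  set br : Fin N × α → ℝ := fun p => (conj ω ^ (p.1 : ℕ) * u p.2).re with hbr
  set bi : Fin N × α → ℝ := fun p => (conj ω ^ (p.1 : ℕ) * u p.2).im with hbi
  rw [← toep_transpose_harmonic_energy h hω u N br bi hbr hbi, inv_mul_eq_div,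
    lt_div_iff₀ hN0'] at hN
  have hbb : br ⬝ᵥ br + bi ⬝ᵥ bi = N * ‖u‖ ^ 2 := by
    have : ∀ p : Fin N × α, br p * br p + bi p * bi p = ‖u p.2‖ ^ 2 := by
      intro p
      rw [← Complex.normSq_apply, ← Complex.sq_norm, norm_mul, norm_pow, RCLike.norm_conj, hω,
        one_pow, one_mul]
    simp only [dotProduct]
    rw [← Finset.sum_add_distrib, Finset.sum_congr rfl fun p _ => this p, Fintype.sum_prod_type,
      EuclideanSpace.norm_sq_eq]
    simp
  by_contra! hle
  have h1 := hle br
  have h2 := hle bi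
  have h3 : a * (br ⬝ᵥ br + bi ⬝ᵥ bi) = a * ‖u‖ ^ 2 * N := by
    rw [hbb]
    ring
  linarith

/-- The largest Rayleigh quotient of a Toeplitz matrix converges to the squared supremum of its
symbol. -/
theorem tendsto_rayleigh_toep [DecidableEq α] [DecidableEq β] {h : ℕ → Matrix α β ℝ}
    (hs : Summable fun i => ‖(h i).map Complex.ofReal‖) {S : ℂ → Matrix α β ℂ}
    (hS : ∀ ω, ‖ω‖ = 1 → HasSum (fun i => ω ^ i • (h i).map Complex.ofReal) (S ω)) {H : ℝ}
    (hH : ∀ ω, ‖ω‖ = 1 → ‖S ω‖ ≤ H) (hH' : ∃ ω, ‖ω‖ = 1 ∧ ‖S ω‖ = H)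
    (b : ∀ N, Fin N × α → ℝ)
    (hb : ∀ N, 1 ≤ N → 0 < b N ⬝ᵥ b N ∧ ∀ b' : Fin N × α → ℝ,
      ((toep h N)ᵀ *ᵥ b') ⬝ᵥ ((toep h N)ᵀ *ᵥ b') ≤
        ((toep h N)ᵀ *ᵥ b N) ⬝ᵥ ((toep h N)ᵀ *ᵥ b N) / (b N ⬝ᵥ b N) * (b' ⬝ᵥ b')) :
    Tendsto (fun N => ((toep h N)ᵀ *ᵥ b N) ⬝ᵥ ((toep h N)ᵀ *ᵥ b N) / (b N ⬝ᵥ b N)) atTop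
      (𝓝 (H ^ 2)) := by
  obtain ⟨ω, hω, hSω⟩ := hH'
  refine tendsto_order.2 ⟨fun a ha => ?_, fun a ha => ?_⟩
  · rcases lt_or_ge a 0 with ha0 | ha0
    · refine Eventually.of_forall fun N => ha0.trans_le ?_
      exact div_nonneg (dotProduct_self_nonneg' _) (dotProduct_self_nonneg' _)
    · filter_upwards [eventually_exists_energy_gt hω (hS ω hω) ha0 (by rwa [hSω]),
        eventually_ge_atTop 1] with N hN hN1
      obtain ⟨b', hb'⟩ := hN
      have h1 := hb'.trans_le ((hb N hN1).2 b')
      exact lt_of_mul_lt_mul_right h1 (dotProduct_self_nonneg' _)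
  · filter_upwards [eventually_ge_atTop 1] with N hN1
    refine lt_of_le_of_lt ?_ ha
    rw [div_le_iff₀ (hb N hN1).1]
    exact toep_transpose_energy_le hs hS hH N (b N)

end ToeplitzLimit

/-! ### Essential supremum on the circle is a maximum -/

section CircleSup

theorem continuous_resolvent_circle {n : Type*} [Fintype n] [DecidableEq n] {A : Matrix n n ℂ}
    (hA : ∀ z ∈ spectrum ℂ A, ‖z‖ ≠ 1) :
    Continuous fun z : Circle => ((z : ℂ) • (1 : Matrix n n ℂ) - A)⁻¹ := by
  have hc : Continuous fun z : Circle => (z : ℂ) • (1 : Matrix n n ℂ) - A :=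
    by fun_prop
  simp only [Matrix.inv_def, Ring.inverse_eq_inv']
  refine Continuous.smul (hc.matrix_det.inv₀ fun z => ?_) hc.matrix_adjugate
  exact (isUnit_det_smul_one_sub fun hz => hA z hz z.norm_coe).ne_zero

theorem essSup_circle (g : Circle → ℝ) (hg : Continuous g) :
    (∀ z, g z ≤ essSup (fun θ : ℝ => g (Circle.exp θ))
      (volume.restrict (Set.Ioc 0 (2 * Real.pi)))) ∧
    ∃ z, g z = essSup (fun θ : ℝ => g (Circle.exp θ))
      (volume.restrict (Set.Ioc 0 (2 * Real.pi))) := by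
  obtain ⟨z₀, -, hz₀⟩ := isCompact_univ.exists_isMaxOn Set.univ_nonempty hg.continuousOn
  have hmax : ∀ z, g z ≤ g z₀ := fun z => hz₀ (Set.mem_univ z)
  suffices h : essSup (fun θ : ℝ => g (Circle.exp θ))
      (volume.restrict (Set.Ioc 0 (2 * Real.pi))) = g z₀ by
    rw [h]
    exact ⟨hmax, z₀, rfl⟩
  have hset : {a : ℝ | ∀ᵐ θ ∂(volume.restrict (Set.Ioc 0 (2 * Real.pi))),
      g (Circle.exp θ) ≤ a} = Set.Ici (g z₀) := by
    ext a
    simp only [Set.mem_ofPred_eq, Set.mem_Ici]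
    refine ⟨fun h => ?_, fun h => Eventually.of_forall fun θ => (hmax _).trans h⟩
    by_contra! hlt
    obtain ⟨θ₁, rfl⟩ := Circle.exp_surjective z₀
    obtain ⟨θ, hθ, hθe⟩ := Circle.periodic_exp.exists_mem_Ioc Real.two_pi_pos θ₁ 0
    rw [zero_add] at hθ
    rw [hθe] at hlt
    have hU : IsOpen {θ : ℝ | a < g (Circle.exp θ)} :=
      isOpen_lt continuous_const (hg.comp (by fun_prop))
    -- The maximizer may be the endpoint `2π`. As a point of the closure of the open interval it
    -- still gives a nonempty open set, hence one of positive measure, on which `g` exceeds `a`.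
    have hcl : θ ∈ closure (Set.Ioo 0 (2 * Real.pi)) := by
      rw [closure_Ioo Real.two_pi_pos.ne]
      exact Set.Ioc_subset_Icc_self hθ
    have hne := mem_closure_iff.1 hcl _ hU hlt
    have hpos := (hU.inter isOpen_Ioo).measure_pos volume hne
    rw [ae_restrict_iff' measurableSet_Ioc, ae_iff] at h
    refine hpos.ne' (measure_mono_null ?_ h)
    rintro x ⟨hx, hx'⟩
    simp only [Set.mem_ofPred_eq, Classical.not_imp, not_le]
    exact ⟨Set.Ioo_subset_Ioc_self hx', hx⟩
  rw [essSup, limsup_eq, hset, csInf_Ici]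

end CircleSup

/-! ### Asymptotic LD-MAP error and the gains on the circle -/

section CovarianceShift

open scoped Matrix.Norms.L2Operator

variable {V : Type*} [Fintype V] [DecidableEq V]

/-- The gain `‖T(z) Q‖` at a point `z` of the unit circle. -/
def circleGain (G : Matrix V V ℝ) (K J : Finset V) (Q : Matrix K K ℝ) (z : Circle) : ℝ :=
  ‖transfer (G.map Complex.ofReal) K J (z : ℂ) * Q.map Complex.ofReal‖

theorem circleGain_nonneg (G : Matrix V V ℝ) (K J : Finset V) (Q : Matrix K K ℝ) (z : Circle) :
    0 ≤ circleGain G K J Q z :=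
  norm_nonneg _

theorem exists_snrR_eq {G : Matrix V V ℝ}
    (hG : ∀ z ∈ spectrum ℂ (G.map Complex.ofReal), ‖z‖ < 1) (K J : Finset V) (σ : ℝ)
    (Sig : Matrix K K ℝ) :
    ∃ H, snrR G K J σ Sig = 1 + (σ ^ 2)⁻¹ * H ^ 2 ∧
      (∀ z, circleGain G K J (matrixSqrt Sig) z ≤ H) ∧
      ∃ z, circleGain G K J (matrixSqrt Sig) z = H := by
  have hc : Continuous (circleGain G K J (matrixSqrt Sig)) := by
    have := continuous_resolvent_circle fun z hz => (hG z hz).ne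
    unfold circleGain transfer
    fun_prop
  obtain ⟨h1, h2⟩ := essSup_circle _ hc
  refine ⟨_, ?_, h1, h2⟩
  simp only [snrR, circleGain, Circle.coe_exp]

theorem asympCovError_eq (G : Matrix V V ℝ) (K J : Finset V) (σ : ℝ) (Sig : Matrix K K ℝ) :
    asympCovError G K J σ Sig = varianceTestError (snrR G K J σ Sig) := rfl

theorem toep_zero {α β : Type*} (N : ℕ) : toep (fun _ => (0 : Matrix α β ℝ)) N = 0 := by
  ext
  simp [toep]

theorem dotProduct_self_pos' {ι : Type*} [Fintype ι] {b : EuclideanSpace ℝ ι} (hb : b ≠ 0) :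
    0 < b.ofLp ⬝ᵥ b.ofLp := by
  refine (dotProduct_self_nonneg' _).lt_of_ne' fun h => hb ?_
  have := dotProduct_self_eq_zero.1 h
  ext i
  simp [this]

/-- The two hypotheses of the covariance shift model as seen by the statistic `bᵀ Y`. -/
theorem linLaw_covariance_shift (G : Matrix V V ℝ) (K J : Finset V) {σ : ℝ} (hσ : 0 < σ)
    {Sig : Matrix K K ℝ} (hS : Sig.PosDef) (μ : EuclideanSpace ℝ K) (N : ℕ)
    (b : EuclideanSpace ℝ (Fin N × J)) (hb : b ≠ 0) (A : Matrix (Fin N × J) (Fin N × K) ℝ)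
    (hA : A = toep (fun i => impulse G K J i * matrixSqrt Sig) N) :
    ∃ (m : ℝ) (v₁ v₂ : ℝ≥0), v₂ ≠ 0 ∧ linLaw b (measurementLaw G K J σ N μ Sig) = gaussianReal m v₁ ∧
      linLaw b (measurementLaw G K J σ N μ 0) = gaussianReal m v₂ ∧
      (v₁ : ℝ) = (1 + (σ ^ 2)⁻¹ * ((Aᵀ *ᵥ b.ofLp) ⬝ᵥ (Aᵀ *ᵥ b.ofLp) / (b.ofLp ⬝ᵥ b.ofLp))) * v₂ := by
  have hQ : matrixSqrt Sig * (matrixSqrt Sig)ᵀ = Sig := by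
    rw [matrixSqrt_transpose, matrixSqrt_mul_self hS.posSemidef]
  have hbp := dotProduct_self_pos' hb
  have h2 : 0 < σ ^ 2 * (b.ofLp ⬝ᵥ b.ofLp) := by positivity
  have h1 := dotProduct_self_nonneg' (Aᵀ *ᵥ b.ofLp)
  refine ⟨_, _, _, ?_, linLaw_measurementLaw G K J σ N μ hS.posSemidef hQ b,
    linLaw_measurementLaw G K J σ N μ Matrix.PosSemidef.zero (Q := 0) (by simp) b, ?_⟩
  · simpa [toep_zero] using h2
  · rw [← hA]
    simp only [Matrix.mul_zero, toep_zero, Matrix.transpose_zero, Matrix.zero_mulVec,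
      dotProduct_zero, add_zero]
    rw [Real.coe_toNNReal _ (by positivity), Real.coe_toNNReal _ h2.le]
    field_simp

theorem tendsto_ldMapError [Nonempty V] {G : Matrix V V ℝ}
    (hG : ∀ z ∈ spectrum ℂ (G.map Complex.ofReal), ‖z‖ < 1) (K J : Finset V) {σ : ℝ} (hσ : 0 < σ)
    {Sig : Matrix K K ℝ} (hS : Sig.PosDef) (μ : EuclideanSpace ℝ K)
    (b : ∀ N, EuclideanSpace ℝ (Fin N × J))
    (hb : ∀ N, 1 ≤ N → IsDiscriminant (1 / 2) (1 / 2) (measurementLaw G K J σ N μ Sig)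
      (measurementLaw G K J σ N μ 0) (b N)) :
    Tendsto (fun N => ldMapError (1 / 2) (1 / 2) (measurementLaw G K J σ N μ Sig)
      (measurementLaw G K J σ N μ 0) (b N)) atTop (𝓝 (asympCovError G K J σ Sig)) := by
  set h : ℕ → Matrix J K ℝ := fun i => impulse G K J i * matrixSqrt Sig with hh
  obtain ⟨H, hR, hH, z₀, hz₀⟩ := exists_snrR_eq hG K J σ Sig
  have hsum := summable_norm_pow_of_spectrum _ hG
  have hs : Summable fun i => ‖(h i).map Complex.ofReal‖ := summable_norm_impulse hsum K J _
  set T : ℂ → Matrix J K ℂ := fun ω =>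
    ω⁻¹ • (transfer (G.map Complex.ofReal) K J ω⁻¹ * (matrixSqrt Sig).map Complex.ofReal) with hT
  have hser : ∀ ω, ‖ω‖ = 1 → HasSum (fun i => ω ^ i • (h i).map Complex.ofReal) (T ω) :=
    fun ω hω => hasSum_impulse hsum K J _ hω
  have hTn : ∀ z : Circle, ‖T (z : ℂ)⁻¹‖ = circleGain G K J (matrixSqrt Sig) z := by
    intro z
    rw [hT, circleGain]
    simp only [inv_inv]
    rw [norm_smul, Circle.norm_coe, one_mul]
  have hTle : ∀ ω, ‖ω‖ = 1 → ‖T ω‖ ≤ H := by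
    intro ω hω
    have hω' : ω⁻¹ ∈ Submonoid.unitSphere ℂ := mem_sphere_zero_iff_norm.2 (by simp [hω])
    have := hTn ⟨ω⁻¹, hω'⟩
    simp only [inv_inv] at this
    rw [this]
    exact hH _
  set ρ : ∀ N, (Fin N × J → ℝ) → ℝ := fun N x =>
    ((toep h N)ᵀ *ᵥ x) ⬝ᵥ ((toep h N)ᵀ *ᵥ x) / (x ⬝ᵥ x) with hρ
  have hρ0 : ∀ N x, 0 ≤ ρ N x := fun N x =>
    div_nonneg (dotProduct_self_nonneg' _) (dotProduct_self_nonneg' _)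
  have hσ2 : 0 < (σ ^ 2)⁻¹ := by positivity
  have hR1 : ∀ N x, 1 ≤ 1 + (σ ^ 2)⁻¹ * ρ N x := fun N x =>
    le_add_of_nonneg_right (mul_nonneg hσ2.le (hρ0 N x))
  have hdiv : ∀ N (x : EuclideanSpace ℝ (Fin N × J)), x ≠ 0 →
      infoDivergence (1 / 2) (1 / 2) (linLaw x (measurementLaw G K J σ N μ Sig))
        (linLaw x (measurementLaw G K J σ N μ 0)) =
      ((1 + (σ ^ 2)⁻¹ * ρ N x.ofLp) + (1 + (σ ^ 2)⁻¹ * ρ N x.ofLp)⁻¹ - 2) / 4 := by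
    intro N x hx
    obtain ⟨m, v₁, v₂, hv₂, e₁, e₂, hv⟩ := linLaw_covariance_shift G K J hσ hS μ N x hx _ rfl
    have hv₂' : (v₂ : ℝ) ≠ 0 := by exact_mod_cast hv₂
    have hv₁ : v₁ ≠ 0 := by
      have : (v₁ : ℝ) ≠ 0 := by
        rw [hv]
        exact mul_ne_zero (by linarith [hR1 N x.ofLp]) hv₂'
      exact_mod_cast this
    rw [e₁, e₂, infoDivergence_gaussianReal hv₁ hv₂, hv, mul_div_cancel_right₀ _ hv₂']
  have hbpos : ∀ N, 1 ≤ N → 0 < (b N).ofLp ⬝ᵥ (b N).ofLp := fun N hN =>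
    dotProduct_self_pos' (hb N hN).1
  -- Maximal divergence means maximal variance ratio, hence a maximal Rayleigh quotient of the
  -- Toeplitz matrix.
  have hmax : ∀ N, 1 ≤ N → ∀ x : EuclideanSpace ℝ (Fin N × J), x ≠ 0 →
      ρ N x.ofLp ≤ ρ N (b N).ofLp := by
    intro N hN x hx
    have h1 := (hb N hN).2 x hx
    rw [hdiv N x hx, hdiv N (b N) (hb N hN).1] at h1
    have h2 := le_of_add_inv_le (hR1 N x.ofLp) (hR1 N (b N).ofLp) (by linarith)
    exact le_of_mul_le_mul_left (by linarith) hσ2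
  have hlim := tendsto_rayleigh_toep hs hser hTle
    ⟨(z₀ : ℂ)⁻¹, by rw [norm_inv, z₀.norm_coe, inv_one], (hTn z₀).trans hz₀⟩ (fun N => (b N).ofLp) fun N hN => by
      refine ⟨hbpos N hN, fun b' => ?_⟩
      by_cases hb' : WithLp.toLp 2 b' = (0 : EuclideanSpace ℝ (Fin N × J))
      · have : b' = 0 := by simpa using hb'
        simp [this]
      · exact (div_le_iff₀ (dotProduct_self_pos' hb')).1 (hmax N hN _ hb')
  have hlim' : Tendsto (fun N => 1 + (σ ^ 2)⁻¹ * ρ N (b N).ofLp) atTop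
      (𝓝 (snrR G K J σ Sig)) := by
    rw [hR]
    exact (hlim.const_mul _).const_add 1
  rw [asympCovError_eq]
  refine (varianceTestError_tendsto ?_ hlim').congr' ?_
  · filter_upwards [eventually_ge_atTop 1] with N hN
    refine ⟨hR1 N _, ?_⟩
    rw [hR]
    have : ρ N (b N).ofLp ≤ H ^ 2 :=
      (div_le_iff₀ (hbpos N hN)).2 (toep_transpose_energy_le hs hser hTle N _)
    have := mul_le_mul_of_nonneg_left this hσ2.le
    linarith
  · filter_upwards [eventually_ge_atTop 1] with N hN
    obtain ⟨m, v₁, v₂, hv₂, e₁, e₂, hv⟩ :=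
      linLaw_covariance_shift G K J hσ hS μ N (b N) (hb N hN).1 _ rfl
    rw [ldMapError, e₁, e₂, mapError_gaussian_variance hv₂ (hR1 N (b N).ofLp) hv]

section

variable {E : Digraph V} {G : Matrix V V ℝ} (hG : IsWeightedAdj E G)
  {K S C P : Finset V} {d : ℕ} (hcut : IsNodeCutset E K d S C P)
  (hstable : ∀ z ∈ spectrum ℂ (G.map Complex.ofReal), ‖z‖ < 1)
  (hspec : ∀ z ∈ spectrum ℂ (blockC G P P), ‖z‖ ≠ 1)

include hG hcut hstable hspec

theorem transfer_circle_mulVec (Q : Matrix K K ℝ) (z : Circle) (x : K → ℂ) :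
    (transfer (G.map Complex.ofReal) K P (z : ℂ) * Q.map Complex.ofReal) *ᵥ x =
      cutTransfer G C P z *ᵥ
        ((transfer (G.map Complex.ofReal) K C (z : ℂ) * Q.map Complex.ofReal) *ᵥ x) := by
  rw [transfer_eq_cutTransfer_mul hG hcut (fun h => (hstable _ h).ne z.norm_coe)
    (fun h => hspec _ h z.norm_coe), Matrix.mulVec_mulVec, Matrix.mul_assoc]

theorem circleGain_le_rhoMax_mul (Q : Matrix K K ℝ) (z : Circle) :
    circleGain G K P Q z ≤ rhoMax G C P z * circleGain G K C Q z := by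
  have h0 : 0 ≤ rhoMax G C P z := LinearMap.singularValues_nonneg _ _
  rw [circleGain, Matrix.l2_opNorm_def]
  refine ContinuousLinearMap.opNorm_le_bound _ (mul_nonneg h0 (norm_nonneg _)) fun x => ?_
  change ‖WithLp.toLp 2 (_ *ᵥ x.ofLp)‖ ≤ _
  rw [transfer_circle_mulVec hG hcut hstable hspec, mul_assoc]
  exact (norm_cutTransfer_mulVec_le _ _ _ _ _).trans
    (mul_le_mul_of_nonneg_left (Matrix.l2_opNorm_mulVec _ x) h0)

theorem rhoMin_mul_circleGain_le (Q : Matrix K K ℝ) (z : Circle) (h0 : 0 < rhoMin G C P z) :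
    rhoMin G C P z * circleGain G K C Q z ≤ circleGain G K P Q z := by
  rw [mul_comm, ← le_div_iff₀ h0, circleGain, Matrix.l2_opNorm_def]
  refine ContinuousLinearMap.opNorm_le_bound _ (div_nonneg (norm_nonneg _) h0.le) fun x => ?_
  change ‖WithLp.toLp 2 (_ *ᵥ x.ofLp)‖ ≤ _
  rw [div_mul_eq_mul_div, le_div_iff₀ h0, mul_comm]
  refine (rhoMin_mul_norm_le _ _ _ _ _).trans ?_
  rw [← transfer_circle_mulVec hG hcut hstable hspec]
  exact Matrix.l2_opNorm_mulVec _ x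

end

/-- A real supremum over an unbounded family has a default value, so boundedness is needed before a
bound on the supremum controls each `rhoMax`. -/
theorem bddAbove_rhoMax {G : Matrix V V ℝ} {C P : Finset V}
    (hspec : ∀ z ∈ spectrum ℂ (blockC G P P), ‖z‖ ≠ 1) :
    BddAbove (Set.range fun z : Circle => rhoMax G C P z) := by
  have hc : Continuous fun z : Circle => ‖cutTransfer G C P z‖ := by
    have := continuous_resolvent_circle hspec
    unfold cutTransfer
    fun_prop
  obtain ⟨B, hB⟩ := (isCompact_range hc).bddAbove
  refine ⟨B, ?_⟩
  rintro _ ⟨z, rfl⟩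
  refine le_trans ?_ (hB ⟨z, rfl⟩)
  exact singularValues_le_of_norm_le _ (norm_nonneg _) (fun x => Matrix.l2_opNorm_mulVec _ x) 0

end CovarianceShift

end NetDetect

end

/-! ### The main theorem -/

theorem mainTheorem1 {V : Type*} [Fintype V] [DecidableEq V]
    (E : Digraph V) (G : Matrix V V ℝ) (hG : NetDetect.IsWeightedAdj E G)
    (K S C P : Finset V) (d : ℕ) (hcut : NetDetect.IsNodeCutset E K d S C P)
    (hstable : ∀ z ∈ spectrum ℂ (G.map Complex.ofReal), ‖z‖ < 1)
    (hspec : ∀ z ∈ spectrum ℂ (NetDetect.blockC G P P), ‖z‖ ≠ 1)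
    (σ : ℝ) (hσ : 0 < σ) :
    -- mean shift model
    (∀ (Sig : Matrix K K ℝ) (μ₁ μ₂ : ℕ → EuclideanSpace ℝ K) (c : ℝ), Sig.PosDef →
      Tendsto (fun N : ℕ => (N : ℝ) * ‖μ₂ N - μ₁ N‖ ^ 2) atTop (𝓝 c) → (∃ k : ℕ, G ^ k = 0) →
      let Perr : Finset V → ℕ → ℝ := fun J N =>
        NetDetect.mapError (1 / 2) (1 / 2)
          (NetDetect.measurementLaw G K J σ N (μ₁ N) Sig)
          (NetDetect.measurementLaw G K J σ N (μ₂ N) Sig)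
      let Pem : Finset V → ℕ → ℝ := fun J N =>
        NetDetect.asympMeanError G K J σ N (μ₁ N) (μ₂ N) Sig
      -- the asymptotic expression of the error probability of the MAP detector
      (∀ J, J = C ∨ J = P → Tendsto (fun N => Perr J N - Pem J N) atTop (𝓝 0)) ∧
      -- the cutset is at least as good as the partitioned set
      (NetDetect.rhoMax G C P 1 ≤ 1 →
        (∀ N, Pem C N ≤ Pem P N) ∧
        ∀ pC pP : ℝ, Tendsto (Perr C) atTop (𝓝 pC) → Tendsto (Perr P) atTop (𝓝 pP) → pC ≤ pP) ∧
      -- the cutset is worse than the partitioned set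
      (1 < NetDetect.rhoMin G C P 1 →
        (∀ N, Pem P N ≤ Pem C N ∧ (Pem C N < 1 / 2 → Pem P N < Pem C N)) ∧
        ∀ pC pP : ℝ, Tendsto (Perr C) atTop (𝓝 pC) → Tendsto (Perr P) atTop (𝓝 pP) →
          pP ≤ pC ∧ (pC < 1 / 2 → pP < pC))) ∧
    -- covariance shift model
    (∀ (Sig₁ : Matrix K K ℝ) (μ : EuclideanSpace ℝ K), Sig₁.PosDef →
      let Pev : Finset V → ℝ := fun J => NetDetect.asympCovError G K J σ Sig₁
      -- the limit of the error probability of the LD-MAP detector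
      (∀ J, J = C ∨ J = P → ∀ b : ∀ N, EuclideanSpace ℝ (Fin N × J),
        (∀ N, 1 ≤ N → NetDetect.IsDiscriminant (1 / 2) (1 / 2)
          (NetDetect.measurementLaw G K J σ N μ Sig₁)
          (NetDetect.measurementLaw G K J σ N μ 0) (b N)) →
        Tendsto (fun N => NetDetect.ldMapError (1 / 2) (1 / 2)
          (NetDetect.measurementLaw G K J σ N μ Sig₁)
          (NetDetect.measurementLaw G K J σ N μ 0) (b N)) atTop (𝓝 (Pev J))) ∧
      -- the cutset is at least as good as the partitioned set
      ((⨆ z : Circle, NetDetect.rhoMax G C P z) ≤ 1 → Pev C ≤ Pev P) ∧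
      -- the cutset is worse than the partitioned set
      (1 < (⨅ z : Circle, NetDetect.rhoMin G C P z) →
        Pev P ≤ Pev C ∧ (Pev C < 1 / 2 → Pev P < Pev C))) := by
  have : Nonempty V := hcut.source_nonempty.nonempty
  have h1 : (1 : ℂ) ∉ spectrum ℂ (G.map Complex.ofReal) := fun h => by
    simpa using hstable 1 h
  have h1P : (1 : ℂ) ∉ spectrum ℂ (NetDetect.blockC G P P) := fun h => hspec 1 h (by simp)
  have hσ2 : 0 < σ ^ 2 := by positivity
  refine ⟨fun Sig μ₁ μ₂ c hS hc hnil => ?_, fun Sig μ hS => ⟨?_, ?_, ?_⟩⟩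
  · obtain ⟨n, hn⟩ := hnil
    intro Perr Pem
    have hlim : ∀ J, Tendsto (fun N => Perr J N - Pem J N) atTop (𝓝 0) := fun J =>
      NetDetect.tendsto_mapError_sub_asympMeanError G K J hσ hS μ₁ μ₂ hc hn
    have hPem : ∀ J N, Pem J N = NetDetect.gaussianTail
        (1 / 2 * √(NetDetect.etaForm G K J σ Sig (√(N : ℝ) • (μ₂ N - μ₁ N)))) := fun J N =>
      NetDetect.asympMeanError_eq G K J σ N (μ₁ N) (μ₂ N) Sig
    have hcont : ∀ J, Continuous fun u => NetDetect.gaussianTail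
        (1 / 2 * √(NetDetect.etaForm G K J σ Sig u)) := fun J =>
      NetDetect.continuous_gaussianTail.comp (continuous_const.mul
        (Real.continuous_sqrt.comp (NetDetect.continuous_etaForm G K J σ Sig)))
    have hcommon : ∀ pC pP : ℝ, Tendsto (Perr C) atTop (𝓝 pC) → Tendsto (Perr P) atTop (𝓝 pP) →
        ∃ u, NetDetect.gaussianTail (1 / 2 * √(NetDetect.etaForm G K C σ Sig u)) = pC ∧
          NetDetect.gaussianTail (1 / 2 * √(NetDetect.etaForm G K P σ Sig u)) = pP :=
      fun pC pP hC hP => NetDetect.exists_common_limit hc (hcont C) (hcont P)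
        (by simpa only [hPem] using hlim C) (by simpa only [hPem] using hlim P) hC hP
    refine ⟨fun J _ => hlim J, fun hr => ?_, fun hr => ?_⟩
    · have hle : ∀ u, NetDetect.etaForm G K P σ Sig u ≤ NetDetect.etaForm G K C σ Sig u :=
        fun u => NetDetect.dotProduct_regGain_mono hσ2 _ _ (fun x => by
          simpa only [Matrix.mulVec_mulVec] using
            NetDetect.transfer_one_le_of_rhoMax_le hG hcut h1 h1P hr
              (NetDetect.matrixSqrt Sig *ᵥ x)) _
      refine ⟨fun N => ?_, fun pC pP hC hP => ?_⟩
      · rw [hPem, hPem]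
        exact NetDetect.gaussianTail_half_sqrt_anti (hle _)
      · obtain ⟨u, rfl, rfl⟩ := hcommon pC pP hC hP
        exact NetDetect.gaussianTail_half_sqrt_anti (hle u)
    · have hr0 : 0 < NetDetect.rhoMin G C P 1 := one_pos.trans hr
      have hr2 : 1 < NetDetect.rhoMin G C P 1 ^ 2 := one_lt_pow₀ hr two_ne_zero
      have hcmp : ∀ x, NetDetect.rhoMin G C P 1 ^ 2 *
          (((NetDetect.transfer G K C 1 * NetDetect.matrixSqrt Sig) *ᵥ x) ⬝ᵥ
            ((NetDetect.transfer G K C 1 * NetDetect.matrixSqrt Sig) *ᵥ x)) ≤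
          ((NetDetect.transfer G K P 1 * NetDetect.matrixSqrt Sig) *ᵥ x) ⬝ᵥ
            ((NetDetect.transfer G K P 1 * NetDetect.matrixSqrt Sig) *ᵥ x) := fun x => by
        simpa only [Matrix.mulVec_mulVec] using
          NetDetect.rhoMin_sq_mul_transfer_one_le hG hcut h1 h1P hr0.le
            (NetDetect.matrixSqrt Sig *ᵥ x)
      have hle : ∀ u, NetDetect.etaForm G K C σ Sig u ≤ NetDetect.etaForm G K P σ Sig u :=
        fun u => NetDetect.dotProduct_regGain_mono hσ2 _ _ (fun x =>
          (le_mul_of_one_le_left (NetDetect.dotProduct_self_nonneg' _) hr2.le).trans (hcmp x)) _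
      have hlt : ∀ u, 0 < NetDetect.etaForm G K C σ Sig u →
          NetDetect.etaForm G K C σ Sig u < NetDetect.etaForm G K P σ Sig u :=
        fun u hu => NetDetect.dotProduct_regGain_strictMono hσ2 _ _ hr2 hcmp _ hu
      refine ⟨fun N => ?_, fun pC pP hC hP => ?_⟩
      · rw [hPem, hPem]
        exact ⟨NetDetect.gaussianTail_half_sqrt_anti (hle _),
          NetDetect.gaussianTail_half_sqrt_lt (hlt _)⟩
      · obtain ⟨u, rfl, rfl⟩ := hcommon pC pP hC hP
        exact ⟨NetDetect.gaussianTail_half_sqrt_anti (hle u),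
          NetDetect.gaussianTail_half_sqrt_lt (hlt u)⟩
  · exact fun J _ b hb => NetDetect.tendsto_ldMapError hstable K J hσ hS μ b hb
  · intro hr
    obtain ⟨HC, hRC, hC, -⟩ := NetDetect.exists_snrR_eq hstable K C σ Sig
    -- It suffices to compare gains at the point where that of `P` is maximal.
    obtain ⟨HP, hRP, -, z, hz⟩ := NetDetect.exists_snrR_eq hstable K P σ Sig
    have hHP : 0 ≤ HP := hz ▸ NetDetect.circleGain_nonneg _ _ _ _ _
    have hle : HP ≤ HC := by
      rw [← hz]
      refine (NetDetect.circleGain_le_rhoMax_mul hG hcut hstable hspec _ z).trans ?_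
      refine (mul_le_of_le_one_left (NetDetect.circleGain_nonneg _ _ _ _ _) ?_).trans (hC z)
      exact (le_ciSup (NetDetect.bddAbove_rhoMax hspec) z).trans hr
    have hsq : (σ ^ 2)⁻¹ * HP ^ 2 ≤ (σ ^ 2)⁻¹ * HC ^ 2 :=
      mul_le_mul_of_nonneg_left (pow_le_pow_left₀ hHP hle 2) (by positivity)
    have hnn : 0 ≤ (σ ^ 2)⁻¹ * HP ^ 2 := by positivity
    simp only [NetDetect.asympCovError_eq, hRC, hRP]
    exact NetDetect.varianceTestError_strictAntiOn.antitoneOn (Set.mem_Ici.2 (by linarith))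
      (Set.mem_Ici.2 (by linarith)) (by linarith)
  · intro hr
    obtain ⟨HC, hRC, -, z, hz⟩ := NetDetect.exists_snrR_eq hstable K C σ Sig
    obtain ⟨HP, hRP, hP, -⟩ := NetDetect.exists_snrR_eq hstable K P σ Sig
    have hHC : 0 ≤ HC := hz ▸ NetDetect.circleGain_nonneg _ _ _ _ _
    have hbdd : BddBelow (Set.range fun z : Circle => NetDetect.rhoMin G C P z) :=
      ⟨0, by rintro _ ⟨z, rfl⟩; exact LinearMap.singularValues_nonneg _ _⟩
    -- The comparison is made at a maximizer `z` of the gain of `C`, so a bound at this single point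
    -- gives a strict inequality between the suprema when `HC > 0`.
    have hρ : 1 < NetDetect.rhoMin G C P z := hr.trans_le (ciInf_le hbdd z)
    have hmul : NetDetect.rhoMin G C P z * HC ≤ HP := by
      rw [← hz]
      exact (NetDetect.rhoMin_mul_circleGain_le hG hcut hstable hspec _ z
        (one_pos.trans hρ)).trans (hP z)
    have hle : HC ≤ HP := (le_mul_of_one_le_left hHC hρ.le).trans hmul
    have hsq : (σ ^ 2)⁻¹ * HC ^ 2 ≤ (σ ^ 2)⁻¹ * HP ^ 2 :=
      mul_le_mul_of_nonneg_left (pow_le_pow_left₀ hHC hle 2) (by positivity)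
    have hnn : 0 ≤ (σ ^ 2)⁻¹ * HC ^ 2 := by positivity
    have hmC : 1 + (σ ^ 2)⁻¹ * HC ^ 2 ∈ Set.Ici (1 : ℝ) := Set.mem_Ici.2 (by linarith)
    have hmP : 1 + (σ ^ 2)⁻¹ * HP ^ 2 ∈ Set.Ici (1 : ℝ) := Set.mem_Ici.2 (by linarith)
    simp only [NetDetect.asympCovError_eq, hRC, hRP]
    refine ⟨NetDetect.varianceTestError_strictAntiOn.antitoneOn hmC hmP (by linarith),
      fun hlt => NetDetect.varianceTestError_strictAntiOn hmC hmP ?_⟩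
    -- A vanishing gain means `R = 1` and error 1/2, which `hlt` excludes.
    have hHC0 : HC ≠ 0 := by
      rintro rfl
      rw [zero_pow two_ne_zero, mul_zero, add_zero, NetDetect.varianceTestError_one] at hlt
      exact lt_irrefl _ hlt
    have hHC1 : 0 < HC := hHC.lt_of_ne' hHC0
    have hlt' : HC < HP := (lt_mul_of_one_lt_left hHC1 hρ).trans_le hmul
    have := mul_lt_mul_of_pos_left (pow_lt_pow_left₀ hlt' hHC two_ne_zero)
      (inv_pos.2 hσ2)
    linarith
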